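/- Let $n\ge 1$, let $\sigma>2/n$, with $\sigma<2/(n-2)$ if $n\ge 3$, and let $(u_0^\varepsilon)_{0<\varepsilon\le 1}$ be a family in $H^1(\mathbb{R}^n)$ such that $$\sup_{0<\varepsilon\le 1}\bigl(\|u_0^\varepsilon\|_{L^2}+\|\varepsilon\nabla u_0^\varepsilon\|_{L^2}\bigr)<\infty \qquad\text{and}\qquad \limsup_{\varepsilon\to 0}\varepsilon^{n\sigma}\|u_0^\varepsilon\|_{L^{2\sigma+2}}^{2\sigma+2}=0 .$$ For $0<\varepsilon\le 1$ let $u^\varepsilon, v^\varepsilon\in C([0,\infty);H^1(\mathbb{R}^n))$ be the solutions (in the sense of distributions) on $[0,\infty)\times\mathbb{R}^n$ of $$i\varepsilon\partial_t u^\varepsilon+\tfrac12\varepsilon^2\Delta u^\varepsilon=\varepsilon^{n\sigma}|u^\varepsilon|^{2\sigma}u^\varepsilon,\qquad u^\varepsilon|_{t=0}=u_0^\varepsilon,$$ $$i\varepsilon\partial_t v^\varepsilon+\tfrac12\varepsilon^2\Delta v^\varepsilon=0,\qquad v^\varepsilon|_{t=0}=u_0^\varepsilon .$$ Let $T>0$.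 The following properties are equivalent: (1) $\displaystyle\sup_{0\le t\le T}\bigl(\|u^\varepsilon(t)-v^\varepsilon(t)\|_{L^2}+\|\varepsilon\nabla u^\varepsilon(t)-\varepsilon\nabla v^\varepsilon(t)\|_{L^2}\bigr)\xrightarrow[\varepsilon\to 0]{}0$; (2) $\displaystyle\limsup_{\varepsilon\to 0}\ \sup_{0\le t\le T}\varepsilon^{n\sigma}\|v^\varepsilon(t)\|_{L^{2\sigma+2}}^{2\sigma+2}=0$. -/

import Mathlib

open MeasureTheory Filter Topology Set
open scoped SchwartzMap LineDeriv Laplacian ENNReal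

noncomputable section

/-- Euclidean space `ℝⁿ`. -/
abbrev Rn (n : ℕ) : Type := EuclideanSpace ℝ (Fin n)

/-- The Hilbert space `L²(ℝⁿ)` of complex-valued functions. -/
abbrev L2 (n : ℕ) : Type := Lp ℂ 2 (volume : Measure (Rn n))

/-- The space `L²(ℝⁿ)ⁿ` of square integrable vector fields `g = (g₁, …, gₙ)`; its norm is
`(∑ i, ‖gᵢ‖²_{L²}) ^ (1/2) = ‖ |g| ‖_{L²}`. -/
abbrev L2Vec (n : ℕ) : Type := PiLp 2 (fun _ : Fin n => L2 n)

/-- The Sobolev space `H¹(ℝⁿ)`, as the space of pairs `(f, ∇f)` where `f ∈ L²` and where the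
distributional partial derivatives `∂ᵢ f` are the components of the (unique) `L²` vector field
`∇f`. It carries the graph norm, whose topology is the usual one of `H¹`. -/
def H1 (n : ℕ) : Submodule ℂ (L2 n × L2Vec n) where
  carrier := {p | ∀ i : Fin n,
    ∂_{(EuclideanSpace.single i (1 : ℝ) : Rn n)} (p.1 : 𝓢'(Rn n, ℂ)) = (p.2 i : 𝓢'(Rn n, ℂ))}
  zero_mem' := fun i => by
    have h : ((0 : L2 n) : 𝓢'(Rn n, ℂ)) = 0 :=
      map_zero (Lp.toTemperedDistributionCLM ℂ (volume : Measure (Rn n)) 2)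
    simp only [Prod.fst_zero, Prod.snd_zero, PiLp.zero_apply, h]
    exact map_zero (LineDeriv.lineDerivOpCLM ℂ 𝓢'(Rn n, ℂ) (EuclideanSpace.single i (1 : ℝ) : Rn n))
  add_mem' := fun {p q} hp hq i => by
    have h : ∀ f g : L2 n, ((f + g : L2 n) : 𝓢'(Rn n, ℂ)) = (f : 𝓢'(Rn n, ℂ)) + g :=
      map_add (Lp.toTemperedDistributionCLM ℂ (volume : Measure (Rn n)) 2)
    simp only [Prod.fst_add, Prod.snd_add, PiLp.add_apply, h, LineDeriv.lineDerivOp_add,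
      hp i, hq i]
  smul_mem' := fun c p hp i => by
    have h : ∀ f : L2 n, ((c • f : L2 n) : 𝓢'(Rn n, ℂ)) = c • (f : 𝓢'(Rn n, ℂ)) :=
      map_smul (Lp.toTemperedDistributionCLM ℂ (volume : Measure (Rn n)) 2) c
    simp only [Prod.smul_fst, Prod.smul_snd, PiLp.smul_apply, h, LineDeriv.lineDerivOp_smul,
      hp i]

namespace H1

variable {n : ℕ}

/-- The underlying `L²` function of an element of `H¹(ℝⁿ)`. -/
def fn (f : H1 n) : L2 n := f.1.1

/-- The gradient of an element of `H¹(ℝⁿ)`. -/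
def grad (f : H1 n) : L2Vec n := f.1.2

/-- The semiclassical norm `‖f‖_{L²} + ‖ε ∇f‖_{L²}`. -/
def scNorm (ε : ℝ) (f : H1 n) : ℝ := ‖fn f‖ + ‖ε • grad f‖

/-- The quantity `ε ^ (nσ) * ‖f‖_{L^{2σ+2}} ^ (2σ+2)`, with values in `[0, ∞]`. -/
def scPotential (σ ε : ℝ) (f : H1 n) : ℝ≥0∞ :=
  ENNReal.ofReal (ε ^ ((n : ℝ) * σ)) *
    eLpNorm (fn f) (ENNReal.ofReal (2 * σ + 2)) volume ^ (2 * σ + 2)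

end H1

/-- `u ∈ C([0, ∞); H¹(ℝⁿ))` solves the Cauchy problem
`iε ∂ₜ u + (ε² / 2) Δ u = N(u)` on `ℝ₊ × ℝⁿ`, `u(0) = u₀`, in the sense of (tempered)
distributions: for every test function `φ`, the function `t ↦ iε ⟨u(t), φ⟩` has on `[0, ∞)` the
derivative `⟨N(u(t)), φ⟩ - (ε² / 2) ⟨u(t), Δφ⟩`, where `⟨f, φ⟩ = ∫ f φ`. -/
def SolvesSchrodinger {n : ℕ} (ε : ℝ) (N : H1 n → Rn n → ℂ) (u₀ : H1 n) (u : ℝ → H1 n) : Prop :=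
  ContinuousOn u (Ici 0) ∧ u 0 = u₀ ∧
    ∀ φ : 𝓢(Rn n, ℂ), ∀ t ∈ Ici (0 : ℝ),
      HasDerivWithinAt (fun s : ℝ => Complex.I * ε * ∫ x, H1.fn (u s) x * φ x)
        ((∫ x, N (u t) x * φ x) - (ε : ℂ) ^ 2 / 2 * ∫ x, H1.fn (u t) x * (Δ φ) x)
        (Ici 0) t

/-- `u` is the solution of `iε ∂ₜ u + (ε² / 2) Δ u = ε ^ (nσ) |u| ^ (2σ) u`, `u(0) = u₀`. -/
def IsNLSSolution {n : ℕ} (σ ε : ℝ) (u₀ : H1 n) (u : ℝ → H1 n) : Prop :=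
  SolvesSchrodinger ε
    (fun f x => ((ε ^ ((n : ℝ) * σ) * ‖H1.fn f x‖ ^ (2 * σ) : ℝ) : ℂ) * H1.fn f x) u₀ u

/-- `v` is the free evolution of `u₀`: `iε ∂ₜ v + (ε² / 2) Δ v = 0`, `v(0) = u₀`. -/
def IsFreeSolution {n : ℕ} (ε : ℝ) (u₀ : H1 n) (v : ℝ → H1 n) : Prop :=
  SolvesSchrodinger ε (fun _ _ => 0) u₀ v

end

/-!
# Linearizable solutions of the semiclassical nonlinear Schrödinger equation

In the rescaled time `s = t / ε` the equation reads `i ∂ₛ u + (ε² / 2) Δ u = ε ^ (nσ) |u| ^ (2σ) u`.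
Put `r = 2σ + 2` and `δ = n (1/2 - 1/r) = nσ / (2σ + 2)`, so that the conditions on `σ` say that
`0 < δ < 1` and `δ (σ + 1) > 1`. The norm `N(f) = ε ^ δ ‖f‖_{L^r}` (`scLpNorm`) makes everything
independent of `ε`: `N(f) ^ r` is the potential energy (`scPotential_eq`), the free group `U(s)`
satisfies `N(U(s) φ) ≤ |s|^{-δ} N'(φ)` with the dual norm `N'` (`scLpNorm_schrodinger_le`),
the nonlinearity is locally Lipschitz from `N` to `N'`, and `N` is controlled by the semiclassical
`H¹` norm (`exists_scLpNorm_le`).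

*Small potential energy implies linearizability.* The Strichartz estimate bounds `N(v)` in `L^q(ds)`,
`q = 2 / δ`, by the `L²` norm of the data. Since `σ > 2 / n`, the exponent `q` is smaller than
`k = 2σ / (1 - δ)`, so uniform smallness of `N(v)` implies smallness in `L^k(ds)`, on time
intervals of length `T / ε` as well (`exists_lintegral_scLpNorm_rpow_le`). The space `L^k` is the one
for which Duhamel's formula closes up: `N(u) ≤ N(v) + |s|^{-δ} * N(u) ^ (2σ + 1)`, and the
Hardy–Littlewood–Sobolev inequality with a continuity argument makes `N(u)` small in `L^k`
(`exists_lintegral_rpow_le_of_le_add_convolution`). The Duhamel term is then small in `L²`, by duality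
with the Strichartz estimate. The same linear estimate holds for the finite differences of `u`,
because the equation is invariant under translations (`IsFlowSymmetry`), and this controls the gradient
(`exists_scNorm_sub_le`). Conservation laws are not needed.

*Linearizability implies small potential energy.* Fix a time `t` and pair `u(s) - v(s)` with the free
evolution of the complex conjugate of `v(t)`. The derivative in `s` of this pairing is `-i` times the
pairing with the nonlinearity, which is close to the potential energy `P` of `v(t)` for
`|s - t| ≤ τ`, as `v` is Hölder continuous in time with values in `L^r`. The pairing itself is
bounded by a multiple of the size `κ` of `u - v` in `L²`. Integration over a window of length `τ` gives
`P ≤ C (τ ^ γ + κ / τ)` (`exists_scLpNorm_rpow_le`), and one lets first `κ`, then `τ` tend to `0`.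

The tools from harmonic analysis are proved along the way, for operators on Schwartz functions: the
Hardy–Littlewood–Sobolev inequality on the line by the layer cake formula, Riesz–Thorin
interpolation between `L¹ → L^∞` and `L² → L²` by the three lines theorem, whence the dispersive
estimate and the Hausdorff–Young inequality, and the Strichartz estimate by the `TT*` method, where
the supremum defining the `L^r` norm is taken over countably many test functions so that a maximizer
can be chosen measurably in time.
-/

/-! ### The Hardy–Littlewood–Sobolev inequality on the line -/

/-- The singular kernel `|t|^{-δ}` on the line, with values in `[0, ∞]`. -/
noncomputable def rieszKernel (δ t : ℝ) : ℝ≥0∞ := ENNReal.ofReal (|t| ^ (-δ))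

lemma measurable_rieszKernel (δ : ℝ) : Measurable (rieszKernel δ) := by
  unfold rieszKernel; fun_prop

lemma rieszKernel_neg (δ t : ℝ) : rieszKernel δ (-t) = rieszKernel δ t := by
  simp [rieszKernel]

lemma lintegral_rpow_neg_Ioc {δ ρ : ℝ} (hδ1 : δ < 1) (hρ : 0 ≤ ρ) :
    ∫⁻ t in Ioc 0 ρ, ENNReal.ofReal (t ^ (-δ)) = ENNReal.ofReal (ρ ^ (1 - δ) / (1 - δ)) := by
  have hint : IntervalIntegrable (fun t : ℝ => t ^ (-δ)) volume 0 ρ :=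
    intervalIntegral.intervalIntegrable_rpow' (by linarith)
  rw [← ofReal_integral_eq_lintegral_ofReal]
  · rw [← intervalIntegral.integral_of_le hρ, integral_rpow (Or.inl (by linarith))]
    rw [Real.zero_rpow (by linarith)]
    congr 1
    rw [show -δ + 1 = 1 - δ by ring, sub_zero]
  · exact (intervalIntegrable_iff_integrableOn_Ioc_of_le hρ).1 hint
  · filter_upwards [ae_restrict_mem measurableSet_Ioc] with t ht
    exact Real.rpow_nonneg ht.1.le _

/-- Among all sets of given measure, the integral of the kernel is largest over an interval
centred at `s`. The bound splits `|t - s|` at `|B|`: the near part is integrated exactly, and the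
far part is at most `|B|^{-δ}` on a set of measure `|B|`. -/
lemma setLIntegral_rieszKernel_le {δ : ℝ} (hδ0 : 0 < δ) (hδ1 : δ < 1) (B : Set ℝ) (s : ℝ) :
    ∫⁻ t in B, rieszKernel δ (t - s) ≤
      ENNReal.ofReal (2 / (1 - δ) + 1) * volume B ^ (1 - δ) := by
  have hC : ENNReal.ofReal (2 / (1 - δ) + 1) ≠ 0 := by
    have : 0 < 2 / (1 - δ) := div_pos two_pos (by linarith)
    simp only [ne_eq, ENNReal.ofReal_eq_zero, not_le]; linarith
  rcases eq_or_ne (volume B) 0 with h0 | h0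
  · rw [Measure.restrict_eq_zero.2 h0]; simp
  rcases eq_or_ne (volume B) ⊤ with h1 | h1
  · rw [h1, ENNReal.top_rpow_of_pos (by linarith), ENNReal.mul_top hC]; exact le_top
  set ρ := (volume B).toReal with hρ
  have hρ0 : 0 < ρ := ENNReal.toReal_pos h0 h1
  have hB : volume B = ENNReal.ofReal ρ := (ENNReal.ofReal_toReal h1).symm
  set g : ℝ → ℝ≥0∞ := (Ioc 0 ρ).indicator (fun t => ENNReal.ofReal (t ^ (-δ))) with hg
  have hgm : Measurable g := by
    apply Measurable.indicator _ measurableSet_Ioc; fun_prop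
  have hgi : ∫⁻ t, g t = ENNReal.ofReal (ρ ^ (1 - δ) / (1 - δ)) := by
    rw [hg, lintegral_indicator measurableSet_Ioc, lintegral_rpow_neg_Ioc hδ1 hρ0.le]
  have hpt : ∀ t, rieszKernel δ t ≤ g t + g (-t) + ENNReal.ofReal (ρ ^ (-δ)) := by
    intro t
    by_cases ht : ρ < |t|
    · refine le_trans ?_ le_add_self
      exact ENNReal.ofReal_le_ofReal (Real.rpow_le_rpow_of_nonpos hρ0 ht.le (by linarith))
    · refine le_trans ?_ le_self_add
      push Not at ht
      rcases lt_trichotomy t 0 with h | h | h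
      · have : -t ∈ Ioc 0 ρ := ⟨by linarith, by rwa [abs_of_neg h] at ht⟩
        simp only [hg, indicator_of_mem this, rieszKernel, abs_of_neg h]
        exact le_add_self
      · subst h
        simp [rieszKernel, Real.zero_rpow (show -δ ≠ 0 by linarith)]
      · have : t ∈ Ioc 0 ρ := ⟨h, by rwa [abs_of_pos h] at ht⟩
        simp only [hg, indicator_of_mem this, rieszKernel, abs_of_pos h]
        exact le_self_add
  calc ∫⁻ t in B, rieszKernel δ (t - s)
      ≤ ∫⁻ t in B, ((g (t - s) + g (-(t - s))) + ENNReal.ofReal (ρ ^ (-δ))) :=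
        lintegral_mono fun t => hpt _
    _ = (∫⁻ t in B, (g (t - s) + g (-(t - s)))) + ENNReal.ofReal (ρ ^ (-δ)) * volume B := by
        rw [lintegral_add_right _ measurable_const, setLIntegral_const]
    _ ≤ (∫⁻ t, (g (t - s) + g (-(t - s)))) + ENNReal.ofReal (ρ ^ (-δ)) * volume B := by
        gcongr; exact Measure.restrict_le_self
    _ = ENNReal.ofReal (2 / (1 - δ) + 1) * volume B ^ (1 - δ) := by
        rw [lintegral_add_left (by fun_prop), lintegral_sub_right_eq_self (fun t => g t) s,
          lintegral_sub_right_eq_self (fun t => g (-t)) s, lintegral_neg_eq_self g, hgi, hB,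
          ENNReal.ofReal_rpow_of_pos hρ0, ← ENNReal.ofReal_mul (by positivity),
          ← ENNReal.ofReal_mul (by have : 0 < 2 / (1 - δ) := div_pos two_pos (by linarith)
                                   linarith), ← ENNReal.ofReal_add, ← ENNReal.ofReal_add]
        · congr 1
          have : ρ ^ (-δ) * ρ = ρ ^ (1 - δ) := by
            rw [← Real.rpow_add_one hρ0.ne']; congr 1; ring
          rw [this]
          ring
        all_goals
          have : 0 < 1 - δ := by linarith
          positivity

/-- The layer cake formula with respect to the measure of density `H`. -/
lemma lintegral_mul_eq_lintegral_superlevel {f : ℝ → ℝ} (hf0 : ∀ x, 0 ≤ f x) (hf : Measurable f)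
    {H : ℝ → ℝ≥0∞} (hH : Measurable H) :
    ∫⁻ s, ENNReal.ofReal (f s) * H s = ∫⁻ a in Ioi (0 : ℝ), ∫⁻ s in {s | a < f s}, H s := by
  have h1 := lintegral_eq_lintegral_meas_lt (volume.withDensity H) (f := f)
    (Eventually.of_forall hf0) hf.aemeasurable
  rw [lintegral_withDensity_eq_lintegral_mul _ hH hf.ennreal_ofReal] at h1
  simp only [Pi.mul_apply] at h1
  simp_rw [mul_comm (ENNReal.ofReal _) (H _)]
  rw [h1]
  refine lintegral_congr fun a => ?_
  rw [withDensity_apply _ (measurableSet_lt measurable_const hf)]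

/-- Hölder's inequality with exponents `1 / (1 - δ)` and `1 / δ`; for `γ` the distribution
function of `g`, the hypothesis is a normalization of `‖g‖_{L^m}`. -/
lemma setLIntegral_measure_rpow_le {δ m : ℝ} (hδ0 : 0 < δ) (hδ1 : δ < 1)
    (hm1 : m * (1 - δ) < 1) : ∃ C : ℝ≥0∞, C ≠ ⊤ ∧ ∀ γ : ℝ → ℝ≥0∞, Measurable γ →
    (∫⁻ b in Ioi (0 : ℝ), γ b * ENNReal.ofReal (b ^ (m - 1)) ≤ 1) → ∀ β : ℝ, 0 ≤ β →
      ∫⁻ b in Ioc 0 β, γ b ^ (1 - δ) ≤ C * ENNReal.ofReal (β ^ (1 - m * (1 - δ))) := by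
  set θ := (m - 1) * (1 - δ) / δ with hθ
  have h1δ : 0 < 1 - δ := by linarith
  have hθ1 : θ < 1 := by rw [hθ, div_lt_one hδ0]; linarith
  refine ⟨ENNReal.ofReal ((1 - θ)⁻¹) ^ δ, ENNReal.rpow_ne_top_of_nonneg hδ0.le ENNReal.ofReal_ne_top,
    fun γ hγ hint β hβ => ?_⟩
  have hpq : (1 / (1 - δ)).HolderConjugate (1 / δ) := by
    rw [Real.holderConjugate_iff]
    refine ⟨by rw [lt_div_iff₀ h1δ]; linarith, by field_simp; ring⟩
  have key := ENNReal.lintegral_mul_le_Lp_mul_Lq (volume.restrict (Ioc 0 β)) hpq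
    (f := fun b => (γ b * ENNReal.ofReal (b ^ (m - 1))) ^ (1 - δ))
    (g := fun b => ENNReal.ofReal (b ^ (-((m - 1) * (1 - δ))))) (by fun_prop) (by fun_prop)
  have e1 : ∫⁻ b in Ioc 0 β, γ b ^ (1 - δ) = ∫⁻ b in Ioc 0 β,
      ((fun b => (γ b * ENNReal.ofReal (b ^ (m - 1))) ^ (1 - δ)) *
        fun b => ENNReal.ofReal (b ^ (-((m - 1) * (1 - δ))))) b := by
    refine setLIntegral_congr_fun measurableSet_Ioc fun b hb => ?_
    have hb0 : 0 < b := hb.1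
    simp only [Pi.mul_apply]
    rw [ENNReal.mul_rpow_of_nonneg _ _ h1δ.le, mul_assoc,
      ENNReal.ofReal_rpow_of_pos (by positivity), ← ENNReal.ofReal_mul (by positivity),
      ← Real.rpow_mul hb0.le, ← Real.rpow_add hb0]
    simp
  rw [e1]
  refine key.trans ?_
  have e2 : (∫⁻ b in Ioc 0 β, ((γ b * ENNReal.ofReal (b ^ (m - 1))) ^ (1 - δ)) ^ (1 / (1 - δ)))
      ≤ 1 := by
    refine le_trans ?_ hint
    simp_rw [← ENNReal.rpow_mul, mul_one_div_cancel h1δ.ne', ENNReal.rpow_one]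
    exact lintegral_mono_set Ioc_subset_Ioi_self
  have e3 : (∫⁻ b in Ioc 0 β, ENNReal.ofReal (b ^ (-((m - 1) * (1 - δ)))) ^ (1 / δ))
      = ENNReal.ofReal (β ^ (1 - θ) / (1 - θ)) := by
    rw [← lintegral_rpow_neg_Ioc hθ1 hβ]
    refine setLIntegral_congr_fun measurableSet_Ioc fun b hb => ?_
    have hb0 : 0 < b := hb.1
    rw [ENNReal.ofReal_rpow_of_pos (by positivity), ← Real.rpow_mul hb0.le]
    congr 2
    rw [hθ]; ring
  have h1θ : 0 < 1 - θ := by linarith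
  calc _ ≤ (1 : ℝ≥0∞) ^ (1 / (1 / (1 - δ))) *
        ENNReal.ofReal (β ^ (1 - θ) / (1 - θ)) ^ (1 / (1 / δ)) := by
        rw [e3]; gcongr
    _ = _ := by
        rw [ENNReal.one_rpow, one_mul, one_div_one_div, div_eq_inv_mul,
          ENNReal.ofReal_mul (by positivity), ENNReal.mul_rpow_of_nonneg _ _ hδ0.le,
          ENNReal.ofReal_rpow_of_nonneg (by positivity : 0 ≤ β ^ (1 - θ)) hδ0.le,
          ← Real.rpow_mul hβ]
        congr 3
        rw [hθ]; field_simp; ring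

/-- The Hardy–Littlewood–Sobolev inequality for functions of norm at most one. By the layer cake
formula, the double integral is an integral over levels `a`, `b` of the interaction `J a b` of the
superlevel sets, for which there are two bounds, one better for `b` small and one for `b` large.
-/
lemma hls_normalized {δ p m : ℝ} (hδ0 : 0 < δ) (hδ1 : δ < 1) (hp : 1 < p) (hm : 1 < m)
    (hpm : 1 / p + 1 / m = 2 - δ) : ∃ C : ℝ≥0∞, C ≠ ⊤ ∧ ∀ f g : ℝ → ℝ, (∀ x, 0 ≤ f x) →
    (∀ x, 0 ≤ g x) → Measurable f → Measurable g → (∫⁻ s, ENNReal.ofReal (f s ^ p) ≤ 1) →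
    (∫⁻ s, ENNReal.ofReal (g s ^ m) ≤ 1) →
      ∫⁻ s, ENNReal.ofReal (f s) * ∫⁻ t, ENNReal.ofReal (g t) * rieszKernel δ (t - s) ≤ C := by
  have h1δ : 0 < 1 - δ := by linarith
  have hp0 : 0 < p := by linarith
  have hm0 : 0 < m := by linarith
  have hpm' : m + p = (2 - δ) * (p * m) := by field_simp at hpm; linarith
  have hm1 : m * (1 - δ) < 1 := by
    by_contra h; push Not at h
    have : p * 1 ≤ p * (m * (1 - δ)) := mul_le_mul_of_nonneg_left h hp0.le
    nlinarith
  have hp1 : p * (1 - δ) < 1 := by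
    by_contra h; push Not at h
    have : m * 1 ≤ m * (p * (1 - δ)) := mul_le_mul_of_nonneg_left h hm0.le
    nlinarith
  obtain ⟨C₁, hC₁, H₁⟩ := setLIntegral_measure_rpow_le hδ0 hδ1 hm1
  obtain ⟨C₂, hC₂, H₂⟩ := setLIntegral_measure_rpow_le hδ0 hδ1 hp1
  set K := ENNReal.ofReal (2 / (1 - δ) + 1) with hK
  refine ⟨K * (C₁ + C₂), ENNReal.mul_ne_top ENNReal.ofReal_ne_top (by finiteness),
    fun f g hf0 hg0 hf hg hfp hgm => ?_⟩
  have hkm : Measurable fun z : ℝ × ℝ => rieszKernel δ (z.2 - z.1) :=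
    (measurable_rieszKernel δ).comp (by fun_prop)
  set φ : ℝ → ℝ≥0∞ := fun a => volume {s | a < f s} with hφ
  set γ : ℝ → ℝ≥0∞ := fun b => volume {s | b < g s} with hγ
  have hφm : Measurable φ := Antitone.measurable fun a b hab =>
    measure_mono fun s (hs : b < f s) => lt_of_le_of_lt hab hs
  have hγm : Measurable γ := Antitone.measurable fun a b hab =>
    measure_mono fun s (hs : b < g s) => lt_of_le_of_lt hab hs
  have norm1 : ∀ {h : ℝ → ℝ} {e : ℝ}, (∀ x, 0 ≤ h x) → Measurable h → 1 < e →
      (∫⁻ s, ENNReal.ofReal (h s ^ e) ≤ 1) →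
      ∫⁻ b in Ioi (0 : ℝ), volume {s | b < h s} * ENNReal.ofReal (b ^ (e - 1)) ≤ 1 := by
    intro h e h0 hh he hle
    rw [lintegral_rpow_eq_lintegral_meas_lt_mul volume (Eventually.of_forall h0)
      hh.aemeasurable (by linarith)] at hle
    refine le_trans ?_ hle
    exact le_mul_of_one_le_left zero_le (by simpa using he.le)
  have hφ1 := norm1 hf0 hf hp hfp
  have hγ1 := norm1 hg0 hg hm hgm
  set J : ℝ → ℝ → ℝ≥0∞ := fun a b =>
    ∫⁻ s in {s | a < f s}, ∫⁻ t in {t | b < g t}, rieszKernel δ (t - s) with hJ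
  have e1 : ∫⁻ s, ENNReal.ofReal (f s) * ∫⁻ t, ENNReal.ofReal (g t) * rieszKernel δ (t - s)
      = ∫⁻ a in Ioi (0 : ℝ), ∫⁻ b in Ioi (0 : ℝ), J a b := by
    rw [lintegral_mul_eq_lintegral_superlevel hf0 hf]
    · refine lintegral_congr fun a => ?_
      have : ∀ s, ∫⁻ t, ENNReal.ofReal (g t) * rieszKernel δ (t - s) =
          ∫⁻ b in Ioi (0 : ℝ), ∫⁻ t in {t | b < g t}, rieszKernel δ (t - s) := fun s =>
        lintegral_mul_eq_lintegral_superlevel hg0 hg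
          ((measurable_rieszKernel δ).comp (measurable_id.sub_const s))
      simp_rw [this]
      rw [lintegral_lintegral_swap]
      have hset : MeasurableSet {z : (ℝ × ℝ) × ℝ | z.1.2 < g z.2} :=
        measurableSet_lt (by fun_prop) (by fun_prop)
      have : (Function.uncurry fun (x y : ℝ) => ∫⁻ t in {t | y < g t}, rieszKernel δ (t - x)) =
          fun z : ℝ × ℝ => ∫⁻ t, {w : (ℝ × ℝ) × ℝ | w.1.2 < g w.2}.indicator
            (fun w => rieszKernel δ (w.2 - w.1.1)) (z, t) := by
        ext z
        rw [Function.uncurry, ← lintegral_indicator (measurableSet_lt measurable_const hg)]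
        rfl
      rw [this]
      refine (Measurable.lintegral_prod_right' (f := fun w : (ℝ × ℝ) × ℝ =>
        {w : (ℝ × ℝ) × ℝ | w.1.2 < g w.2}.indicator
            (fun w => rieszKernel δ (w.2 - w.1.1)) w) ?_).aemeasurable
      exact (((measurable_rieszKernel δ).comp (by fun_prop)).indicator hset)
    · exact Measurable.lintegral_prod_right' (f := fun z : ℝ × ℝ =>
        ENNReal.ofReal (g z.2) * rieszKernel δ (z.2 - z.1)) (by fun_prop)
  have bJ1 : ∀ a b, J a b ≤ K * (φ a * γ b ^ (1 - δ)) := fun a b => by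
    calc J a b ≤ ∫⁻ s in {s | a < f s}, K * γ b ^ (1 - δ) :=
          lintegral_mono fun s => setLIntegral_rieszKernel_le hδ0 hδ1 _ s
      _ = _ := by rw [setLIntegral_const]; ring
  have bJ2 : ∀ a b, J a b ≤ K * (γ b * φ a ^ (1 - δ)) := fun a b => by
    have : J a b = ∫⁻ t in {t | b < g t}, ∫⁻ s in {s | a < f s}, rieszKernel δ (s - t) := by
      rw [hJ, lintegral_lintegral_swap hkm.aemeasurable]
      refine lintegral_congr fun t => lintegral_congr fun s => ?_
      rw [← rieszKernel_neg]; ring_nf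
    rw [this]
    calc _ ≤ ∫⁻ s in {s | b < g s}, K * φ a ^ (1 - δ) :=
          lintegral_mono fun s => setLIntegral_rieszKernel_le hδ0 hδ1 _ s
      _ = _ := by rw [setLIntegral_const]; ring
  -- the diagonal `b = a ^ (p / m)` separates the regions where each of the two bounds is used
  have split : ∀ a ∈ Ioi (0 : ℝ), ∀ b ∈ Ioi (0 : ℝ), J a b ≤
      K * (φ a * (Ioc 0 (a ^ (p / m))).indicator (fun b => γ b ^ (1 - δ)) b) +
      K * (γ b * (Ioc 0 (b ^ (m / p))).indicator (fun a => φ a ^ (1 - δ)) a) := by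
    intro a ha b hb
    have ha0 : 0 < a := ha
    have hb0 : 0 < b := hb
    by_cases hab : b ≤ a ^ (p / m)
    · rw [indicator_of_mem (show b ∈ Ioc 0 (a ^ (p / m)) from ⟨hb, hab⟩)]
      exact (bJ1 a b).trans le_self_add
    · have : a ∈ Ioc 0 (b ^ (m / p)) := by
        refine ⟨ha, ?_⟩
        push Not at hab
        calc a = (a ^ (p / m)) ^ (m / p) := by
              rw [← Real.rpow_mul ha0.le, show p / m * (m / p) = 1 by field_simp, Real.rpow_one]
          _ ≤ _ := Real.rpow_le_rpow (by positivity) hab.le (by positivity)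
      rw [indicator_of_mem this]
      exact (bJ2 a b).trans le_add_self
  have T1 : ∀ {P M : ℝ} {C : ℝ≥0∞} {F G : ℝ → ℝ≥0∞}, Measurable F → Measurable G → 1 < P → 1 < M →
      M + P = (2 - δ) * (P * M) →
      (∫⁻ b in Ioi (0 : ℝ), F b * ENNReal.ofReal (b ^ (P - 1)) ≤ 1) →
      (∀ β : ℝ, 0 ≤ β →
        ∫⁻ b in Ioc 0 β, G b ^ (1 - δ) ≤ C * ENNReal.ofReal (β ^ (1 - M * (1 - δ)))) →
      ∫⁻ a in Ioi (0 : ℝ), ∫⁻ b in Ioi (0 : ℝ),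
        K * (F a * (Ioc 0 (a ^ (P / M))).indicator (fun b => G b ^ (1 - δ)) b) ≤ K * C := by
    intro P M C F G hF hG hP hM hPM hF1 hG1
    have hP0 : 0 < P := by linarith
    have hM0 : 0 < M := by linarith
    calc _ ≤ ∫⁻ a in Ioi (0 : ℝ), K * C * (F a * ENNReal.ofReal (a ^ (P - 1))) := by
          refine setLIntegral_mono (by fun_prop) fun a ha => ?_
          have ha0 : 0 < a := ha
          rw [lintegral_const_mul _ (by
              refine measurable_const.mul ?_
              exact Measurable.indicator (by fun_prop) measurableSet_Ioc),
            lintegral_const_mul _ (Measurable.indicator (by fun_prop) measurableSet_Ioc),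
            lintegral_indicator measurableSet_Ioc, Measure.restrict_restrict measurableSet_Ioc,
            inter_eq_self_of_subset_left Ioc_subset_Ioi_self]
          have h2 := hG1 (a ^ (P / M)) (by positivity)
          rw [← Real.rpow_mul ha0.le,
            show P / M * (1 - M * (1 - δ)) = P - 1 by field_simp; linarith] at h2
          calc _ ≤ K * (F a * (C * ENNReal.ofReal (a ^ (P - 1)))) := by gcongr
            _ = _ := by ring
      _ ≤ K * C * 1 := by
          rw [lintegral_const_mul _ (by fun_prop)]; gcongr
      _ = _ := mul_one _
  have mind : ∀ {F G : ℝ → ℝ≥0∞} {e : ℝ}, Measurable F → Measurable G →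
      Measurable fun z : ℝ × ℝ =>
        K * (F z.1 * (Ioc 0 (z.1 ^ e)).indicator (fun b => G b ^ (1 - δ)) z.2) := by
    intro F G e hF hG
    refine measurable_const.mul ((hF.comp measurable_fst).mul ?_)
    have hs : MeasurableSet {z : ℝ × ℝ | 0 < z.2 ∧ z.2 ≤ z.1 ^ e} :=
      (measurableSet_lt measurable_const measurable_snd).inter
        (measurableSet_le measurable_snd (by fun_prop))
    exact Measurable.indicator (f := fun z : ℝ × ℝ => G z.2 ^ (1 - δ)) (by fun_prop) hs
  rw [e1]
  calc _ ≤ ∫⁻ a in Ioi (0 : ℝ), ∫⁻ b in Ioi (0 : ℝ),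
        (K * (φ a * (Ioc 0 (a ^ (p / m))).indicator (fun b => γ b ^ (1 - δ)) b) +
        K * (γ b * (Ioc 0 (b ^ (m / p))).indicator (fun a => φ a ^ (1 - δ)) a)) :=
        setLIntegral_mono' measurableSet_Ioi fun a ha =>
          setLIntegral_mono' measurableSet_Ioi fun b hb => split a ha b hb
    _ = (∫⁻ a in Ioi (0 : ℝ), ∫⁻ b in Ioi (0 : ℝ),
          K * (φ a * (Ioc 0 (a ^ (p / m))).indicator (fun b => γ b ^ (1 - δ)) b)) +
        ∫⁻ a in Ioi (0 : ℝ), ∫⁻ b in Ioi (0 : ℝ),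
          K * (γ b * (Ioc 0 (b ^ (m / p))).indicator (fun a => φ a ^ (1 - δ)) a) := by
        rw [← lintegral_add_left]
        · refine lintegral_congr fun a => lintegral_add_left ?_ _
          exact (mind hφm hγm).comp (measurable_const.prodMk measurable_id)
        · exact Measurable.lintegral_prod_right' (mind hφm hγm)
    _ ≤ K * C₁ + K * C₂ := by
        refine add_le_add (T1 hφm hγm hp hm hpm' hφ1 (H₁ γ hγm hγ1)) ?_
        rw [lintegral_lintegral_swap]
        · exact T1 hγm hφm hm hp (by linarith) hγ1 (H₂ φ hφm hφ1)
        · exact ((mind (e := m / p) hγm hφm).comp measurable_swap).aemeasurable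
    _ = _ := by ring

/-- The Hardy–Littlewood–Sobolev inequality on the line, as a bound for a bilinear form. -/
theorem hardy_littlewood_sobolev {δ p m : ℝ} (hδ0 : 0 < δ) (hδ1 : δ < 1) (hp : 1 < p) (hm : 1 < m)
    (hpm : 1 / p + 1 / m = 2 - δ) : ∃ C : ℝ≥0∞, C ≠ ⊤ ∧ ∀ f g : ℝ → ℝ≥0∞,
    Measurable f → Measurable g →
      ∫⁻ s, f s * ∫⁻ t, g t * rieszKernel δ (t - s) ≤
        C * ((∫⁻ s, f s ^ p) ^ (1 / p) * (∫⁻ s, g s ^ m) ^ (1 / m)) := by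
  obtain ⟨C, hC, H⟩ := hls_normalized hδ0 hδ1 hp hm hpm
  have hp0 : 0 < p := by linarith
  have hm0 : 0 < m := by linarith
  refine ⟨C + 1, by finiteness, fun f g hf hg => ?_⟩
  have hker : ∀ s, Measurable fun t => rieszKernel δ (t - s) := fun s =>
    (measurable_rieszKernel δ).comp (measurable_id.sub_const s)
  rcases eq_or_ne (∫⁻ s, f s ^ p) 0 with hF0 | hF0
  · have : f =ᵐ[volume] 0 := by
      filter_upwards [(lintegral_eq_zero_iff (by fun_prop)).1 hF0] with s hs
      simpa [hp0, hp0.le, not_lt.2 hp0.le] using hs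
    rw [lintegral_congr_ae (g := fun _ => 0) (by filter_upwards [this] with s hs; simp [hs])]
    simp
  rcases eq_or_ne (∫⁻ s, g s ^ m) 0 with hG0 | hG0
  · have : g =ᵐ[volume] 0 := by
      filter_upwards [(lintegral_eq_zero_iff (by fun_prop)).1 hG0] with s hs
      simpa [hm0, hm0.le, not_lt.2 hm0.le] using hs
    have h2 : ∀ s, ∫⁻ t, g t * rieszKernel δ (t - s) = 0 := fun s => by
      rw [lintegral_congr_ae (g := fun _ => 0) (by filter_upwards [this] with s hs; simp [hs])]
      simp
    simp [h2]
  rcases eq_or_ne (∫⁻ s, f s ^ p) ⊤ with hF1 | hF1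
  · rw [hF1, ENNReal.top_rpow_of_pos (by positivity), ENNReal.top_mul
      (by simp only [ne_eq, ENNReal.rpow_eq_zero_iff]; push Not
          exact ⟨fun h => absurd h hG0, fun _ => by positivity⟩),
      ENNReal.mul_top (by simp)]
    exact le_top
  rcases eq_or_ne (∫⁻ s, g s ^ m) ⊤ with hG1 | hG1
  · rw [hG1, ENNReal.top_rpow_of_pos (by positivity), ENNReal.mul_top
      (by simp only [ne_eq, ENNReal.rpow_eq_zero_iff]; push Not
          exact ⟨fun h => absurd h hF0, fun _ => by positivity⟩),
      ENNReal.mul_top (by simp)]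
    exact le_top
  -- normalize both functions and replace them by real-valued ones
  have nrm : ∀ {h : ℝ → ℝ≥0∞} {e : ℝ}, Measurable h → 1 < e → ∫⁻ s, h s ^ e ≠ 0 →
      ∫⁻ s, h s ^ e ≠ ⊤ → ∃ (k : ℝ → ℝ), (∀ x, 0 ≤ k x) ∧ Measurable k ∧
        (∫⁻ s, ENNReal.ofReal (k s ^ e) ≤ 1) ∧
        ∀ᵐ s, h s = (∫⁻ s, h s ^ e) ^ (1 / e) * ENNReal.ofReal (k s) := by
    intro h e hh he h0 h1
    have he0 : 0 < e := by linarith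
    set N := (∫⁻ s, h s ^ e) ^ (1 / e) with hN
    have hN0 : N ≠ 0 := by
      simp only [hN, ne_eq, ENNReal.rpow_eq_zero_iff]; push Not
      exact ⟨fun h => absurd h h0, fun _ => by positivity⟩
    have hN1 : N ≠ ⊤ := ENNReal.rpow_ne_top_of_nonneg (by positivity) h1
    have hNe : N ^ e = ∫⁻ s, h s ^ e := by
      rw [hN, ← ENNReal.rpow_mul, one_div_mul_cancel he0.ne', ENNReal.rpow_one]
    have hae : ∀ᵐ s, h s < ⊤ := by
      filter_upwards [ae_lt_top (by fun_prop) h1] with s hs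
      by_contra hc
      simp only [not_lt, top_le_iff] at hc
      rw [hc, ENNReal.top_rpow_of_pos he0] at hs
      exact lt_irrefl _ hs
    have hfin : ∀ᵐ s, ENNReal.ofReal (h s / N).toReal = h s / N := by
      filter_upwards [hae] with s hs
      exact ENNReal.ofReal_toReal (ENNReal.div_ne_top hs.ne hN0)
    refine ⟨fun s => (h s / N).toReal, fun s => ENNReal.toReal_nonneg, by fun_prop, ?_, ?_⟩
    · calc _ = ∫⁻ s, (N ^ e)⁻¹ * h s ^ e := by
            refine lintegral_congr_ae ?_
            filter_upwards [hfin] with s hs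
            rw [← ENNReal.ofReal_rpow_of_nonneg ENNReal.toReal_nonneg he0.le, hs,
              ENNReal.div_rpow_of_nonneg _ _ he0.le, ENNReal.div_eq_inv_mul]
        _ ≤ 1 := by
            rw [lintegral_const_mul _ (by fun_prop), ← hNe]
            exact ENNReal.inv_mul_le_one _
    · filter_upwards [hfin] with s hs
      rw [hs, ENNReal.mul_div_cancel hN0 hN1]
  obtain ⟨f', hf0, hfm, hf1, hff⟩ := nrm hf hp hF0 hF1
  obtain ⟨g', hg0, hgm, hg1, hgg⟩ := nrm hg hm hG0 hG1
  set F := (∫⁻ s, f s ^ p) ^ (1 / p)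
  set G := (∫⁻ s, g s ^ m) ^ (1 / m)
  have hI : ∀ s, ∫⁻ t, g t * rieszKernel δ (t - s) =
      G * ∫⁻ t, ENNReal.ofReal (g' t) * rieszKernel δ (t - s) := fun s => by
    rw [← lintegral_const_mul G (f := fun t => ENNReal.ofReal (g' t) * rieszKernel δ (t - s))
      (hgm.ennreal_ofReal.mul (hker s))]
    refine lintegral_congr_ae ?_
    filter_upwards [hgg] with t ht
    rw [ht]; ring
  have hin : Measurable fun s => ∫⁻ t, ENNReal.ofReal (g' t) * rieszKernel δ (t - s) :=
    Measurable.lintegral_prod_right' (f := fun z : ℝ × ℝ =>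
        ENNReal.ofReal (g' z.2) * rieszKernel δ (z.2 - z.1))
        ((by fun_prop : Measurable fun z : ℝ × ℝ => ENNReal.ofReal (g' z.2)).mul
          ((measurable_rieszKernel δ).comp (by fun_prop)))
  calc _ = ∫⁻ s, F * G * (ENNReal.ofReal (f' s) *
          ∫⁻ t, ENNReal.ofReal (g' t) * rieszKernel δ (t - s)) := by
        refine lintegral_congr_ae ?_
        filter_upwards [hff] with s hs
        rw [hI, hs]; ring
    _ ≤ F * G * C := by
        rw [lintegral_const_mul _ (by fun_prop)]
        gcongr
        exact H f' g' hf0 hg0 hfm hgm hf1 hg1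
    _ ≤ (C + 1) * (F * G) := by rw [mul_comm]; gcongr; exact le_self_add

/-- The converse of Hölder's inequality for `[0, ∞]`-valued functions on the line. -/
lemma lintegral_rpow_le_of_forall_lintegral_mul_le {b p : ℝ} (hbp : b.HolderConjugate p)
    {h : ℝ → ℝ≥0∞} (hh : Measurable h) {C : ℝ≥0∞}
    (H : ∀ f : ℝ → ℝ≥0∞, Measurable f → ∫⁻ s, f s * h s ≤ C * (∫⁻ s, f s ^ p) ^ (1 / p)) :
    (∫⁻ s, h s ^ b) ^ (1 / b) ≤ C := by
  have hb1 : 1 < b := hbp.lt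
  have hb0 : 0 < b := by linarith
  have hp0 : 0 < p := hbp.symm.pos
  have hpb : (b - 1) * p = b := hbp.sub_one_mul_conj
  have hinv : 1 / b = 1 - 1 / p := by
    have := hbp.inv_add_inv_eq_one
    rw [one_div, one_div]; linarith
  -- the truncations `k N` of `h` are integrable, and are tested against their powers `k N ^ (b - 1)`
  set k : ℕ → ℝ → ℝ≥0∞ := fun N => (Icc (-(N : ℝ)) N).indicator fun s => min (h s) N with hk
  have hkm : ∀ N, Measurable (k N) := fun N =>
    (hh.min measurable_const).indicator measurableSet_Icc
  have hkle : ∀ N s, k N s ≤ h s := fun N s => by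
    by_cases hs : s ∈ Icc (-(N : ℝ)) N
    · simp [hk, hs]
    · simp [hk, hs]
  have hfin : ∀ N, ∫⁻ s, k N s ^ b ≠ ⊤ := fun N => by
    have : ∀ s, k N s ^ b ≤ (Icc (-(N : ℝ)) N).indicator (fun _ => (N : ℝ≥0∞) ^ b) s := fun s => by
      by_cases hs : s ∈ Icc (-(N : ℝ)) N
      · simp only [hk, indicator_of_mem hs]
        gcongr; exact min_le_right _ _
      · simp [hk, hs, hb0]
    refine ne_top_of_le_ne_top ?_ (lintegral_mono this)
    rw [lintegral_indicator measurableSet_Icc, setLIntegral_const]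
    have : (N : ℝ≥0∞) ^ b ≠ ⊤ := ENNReal.rpow_ne_top_of_nonneg hb0.le (by simp)
    exact ENNReal.mul_ne_top this (by simp)
  have hbd : ∀ N, ∫⁻ s, k N s ^ b ≤ C ^ b := fun N => by
    rcases eq_or_ne (∫⁻ s, k N s ^ b) 0 with h0 | h0
    · rw [h0]; exact bot_le
    have h1 := H (fun s => k N s ^ (b - 1)) ((hkm N).pow_const _)
    have h2 : ∫⁻ s, k N s ^ b ≤ ∫⁻ s, k N s ^ (b - 1) * h s := by
      refine lintegral_mono fun s => ?_
      rcases eq_or_ne (k N s) 0 with hz | hz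
      · rw [hz, ENNReal.zero_rpow_of_pos hb0]; exact bot_le
      have hz1 : k N s ≠ ⊤ := by
        by_cases hs : s ∈ Icc (-(N : ℝ)) N
        · simp only [hk, indicator_of_mem hs]
          exact ne_top_of_le_ne_top (by simp) (min_le_right _ _)
        · simp [hk, hs]
      calc k N s ^ b = k N s ^ (b - 1) * k N s := by
            conv_rhs => rw [← ENNReal.rpow_one (k N s), ← ENNReal.rpow_mul,
              ← ENNReal.rpow_add _ _ hz hz1]
            congr 1; ring
        _ ≤ _ := by gcongr; exact hkle N s
    simp_rw [← ENNReal.rpow_mul, hpb] at h1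
    set X := ∫⁻ s, k N s ^ b
    have h3 : X ≤ C * X ^ (1 / p) := h2.trans h1
    have hX : X = X ^ (1 / b) * X ^ (1 / p) := by
      rw [← ENNReal.rpow_add _ _ h0 (hfin N), hinv]; simp
    have hXp0 : X ^ (1 / p) ≠ 0 := by
      simp only [ne_eq, ENNReal.rpow_eq_zero_iff]; push Not
      exact ⟨fun h => absurd h h0, fun _ => by positivity⟩
    have hXp1 : X ^ (1 / p) ≠ ⊤ := ENNReal.rpow_ne_top_of_nonneg (by positivity) (hfin N)
    have h4 : X ^ (1 / b) ≤ C := by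
      rw [← ENNReal.mul_le_mul_iff_left hXp0 hXp1, ← hX]
      exact h3
    calc X = (X ^ (1 / b)) ^ b := by
          rw [← ENNReal.rpow_mul, one_div_mul_cancel hb0.ne', ENNReal.rpow_one]
      _ ≤ C ^ b := by gcongr
  have hsup : ∫⁻ s, h s ^ b ≤ C ^ b := by
    have hmono : Monotone fun N s => k N s ^ b := by
      intro N M hNM s
      have hNM' : (N : ℝ) ≤ M := by exact_mod_cast hNM
      simp only
      gcongr
      by_cases hs : s ∈ Icc (-(N : ℝ)) N
      · have hs' : s ∈ Icc (-(M : ℝ)) M := ⟨by linarith [hs.1], by linarith [hs.2]⟩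
        simp only [hk, indicator_of_mem hs, indicator_of_mem hs']
        gcongr
      · simp [hk, hs]
    have hlim : ∀ s, h s ^ b ≤ ⨆ N, k N s ^ b := by
      intro s
      have : Tendsto (fun N => k N s) atTop (𝓝 (h s)) := by
        obtain ⟨N₀, hN₀⟩ := exists_nat_ge |s|
        have h1 : Tendsto (fun N : ℕ => min (h s) (N : ℝ≥0∞)) atTop (𝓝 (min (h s) ⊤)) :=
          tendsto_const_nhds.min ENNReal.tendsto_nat_nhds_top
        rw [min_eq_left le_top] at h1
        refine h1.congr' ?_
        filter_upwards [eventually_ge_atTop N₀] with N hN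
        have hN' : (N₀ : ℝ) ≤ N := by exact_mod_cast hN
        have : s ∈ Icc (-(N : ℝ)) N := abs_le.1 (hN₀.trans hN')
        simp [hk, this]
      have h2 : Tendsto (fun N => k N s ^ b) atTop (𝓝 (h s ^ b)) :=
        (ENNReal.continuous_rpow_const.tendsto _).comp this
      exact le_of_tendsto' h2 fun N => le_iSup (fun N => k N s ^ b) N
    calc _ ≤ ∫⁻ s, ⨆ N, k N s ^ b := lintegral_mono hlim
      _ = ⨆ N, ∫⁻ s, k N s ^ b := lintegral_iSup (fun N => (hkm N).pow_const _) hmono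
      _ ≤ C ^ b := iSup_le hbd
  calc _ ≤ (C ^ b) ^ (1 / b) := by gcongr
    _ = C := by rw [← ENNReal.rpow_mul, mul_one_div_cancel hb0.ne', ENNReal.rpow_one]

/-- The Hardy–Littlewood–Sobolev inequality on the line: convolution with `|t|^{-δ}` is bounded
from `L^m` to `L^b` when `1 / b = 1 / m - (1 - δ)`. -/
theorem hardy_littlewood_sobolev_convolution {δ b m : ℝ} (hδ0 : 0 < δ) (hδ1 : δ < 1) (hb : 1 < b)
    (hm : 1 < m) (hbm : 1 / m - 1 / b = 1 - δ) : ∃ C : ℝ≥0∞, C ≠ ⊤ ∧ ∀ g : ℝ → ℝ≥0∞,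
    Measurable g →
      (∫⁻ s, (∫⁻ t, g t * rieszKernel δ (t - s)) ^ b) ^ (1 / b) ≤
        C * (∫⁻ s, g s ^ m) ^ (1 / m) := by
  have hbp := Real.HolderConjugate.conjExponent hb
  set p := b.conjExponent
  have hinv : 1 / p = 1 - 1 / b := by
    have := hbp.inv_add_inv_eq_one
    rw [one_div, one_div]; linarith
  obtain ⟨C, hC, H⟩ := hardy_littlewood_sobolev (p := p) (m := m) hδ0 hδ1 hbp.symm.lt hm
    (by rw [hinv]; linarith)
  refine ⟨C, hC, fun g hg => ?_⟩
  refine lintegral_rpow_le_of_forall_lintegral_mul_le hbp ?_ fun f hf => ?_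
  · exact Measurable.lintegral_prod_right' (f := fun z : ℝ × ℝ =>
        g z.2 * rieszKernel δ (z.2 - z.1))
        ((hg.comp measurable_snd).mul ((measurable_rieszKernel δ).comp (by fun_prop)))
  · refine (H f g hf hg).trans_eq ?_
    ring

/-! ### Approximation by Schwartz functions and duality in Lebesgue spaces -/

/-- Dominated convergence in `L^p`. -/
lemma tendsto_eLpNorm_sub_of_dominated {α E : Type*} [MeasurableSpace α] {μ : Measure α}
    [NormedAddCommGroup E] {F : ℕ → α → E} {f : α → E} {G : α → ℝ} {p : ℝ≥0∞} (hp0 : p ≠ 0)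
    (hp : p ≠ ⊤) (hF : ∀ j, AEStronglyMeasurable (F j) μ) (hG : MemLp G p μ)
    (hbd : ∀ j, ∀ᵐ x ∂μ, ‖F j x‖ ≤ G x)
    (hlim : ∀ᵐ x ∂μ, Tendsto (fun j => F j x) atTop (𝓝 (f x))) :
    Tendsto (fun j => eLpNorm (F j - f) p μ) atTop (𝓝 0) := by
  have hpr : 0 < p.toReal := ENNReal.toReal_pos hp0 hp
  have hfm : AEStronglyMeasurable f μ := aestronglyMeasurable_of_tendsto_ae atTop hF hlim
  have hall : ∀ᵐ x ∂μ, ∀ j, ‖F j x‖ ≤ G x := ae_all_iff.2 hbd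
  have hfG : ∀ᵐ x ∂μ, ‖f x‖ ≤ G x := by
    filter_upwards [hall, hlim] with x h1 h2
    exact le_of_tendsto' h2.norm h1
  have h2G : MemLp (fun x => 2 * G x) p μ := hG.const_mul 2
  suffices h : Tendsto (fun j => ∫⁻ x, ‖(F j - f) x‖ₑ ^ p.toReal ∂μ) atTop (𝓝 0) by
    simp_rw [eLpNorm_eq_lintegral_rpow_enorm_toReal hp0 hp]
    have := ((ENNReal.continuous_rpow_const (y := 1 / p.toReal)).tendsto _).comp h
    rwa [ENNReal.zero_rpow_of_pos (by positivity)] at this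
  have := tendsto_lintegral_of_dominated_convergence' (μ := μ)
    (F := fun j x => ‖(F j - f) x‖ₑ ^ p.toReal) (f := fun _ => 0)
    (fun x => ‖2 * G x‖ₑ ^ p.toReal)
    (fun j => ((hF j).sub hfm).enorm.pow_const _) ?_ ?_ ?_
  · simpa using this
  · intro j
    filter_upwards [hbd j, hfG] with x h1 h2
    gcongr
    have h3 : ‖(F j - f) x‖ ≤ ‖2 * G x‖ := by
      rw [Pi.sub_apply, Real.norm_eq_abs]
      refine (norm_sub_le _ _).trans (le_trans ?_ (le_abs_self _))
      linarith
    exact enorm_le_iff_norm_le.2 h3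
  · exact (lintegral_rpow_enorm_lt_top_of_eLpNorm_lt_top hp0 hp h2G.2).ne
  · filter_upwards [hlim] with x hx
    have h1 : Tendsto (fun j => (F j - f) x) atTop (𝓝 0) := by
      simpa using hx.sub_const (f x)
    have h2 := ((ENNReal.continuous_rpow_const (y := p.toReal)).tendsto _).comp h1.enorm
    simpa [hpr, Function.comp_def] using h2

/-- A bounded function with bounded support is an almost everywhere limit of Schwartz functions
that are uniformly bounded and vanish off a common ball; hence it is a limit in all `L^p`
with `p < ∞` at once. -/
lemma exists_schwartz_tendsto_ae {n : ℕ} {f : Rn n → ℂ} (hf : Measurable f) {M R : ℝ}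
    (hM : ∀ x, ‖f x‖ ≤ M) (hR : ∀ x, R < ‖x‖ → f x = 0) :
    ∃ φ : ℕ → 𝓢(Rn n, ℂ), (∀ j x, ‖φ j x‖ ≤ M) ∧ (∀ j x, R + 1 < ‖x‖ → φ j x = 0) ∧
      ∀ᵐ x, Tendsto (fun j => φ j x) atTop (𝓝 (f x)) := by
  have hM0 : 0 ≤ M := (norm_nonneg _).trans (hM 0)
  have hfsupp : Function.support f ⊆ Metric.closedBall 0 R := fun x hx => by
    by_contra h
    rw [mem_closedBall_zero_iff, not_le] at h
    exact hx (hR x h)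
  have hfcs : HasCompactSupport f := HasCompactSupport.of_support_subset_isCompact
    (isCompact_closedBall 0 R) hfsupp
  have hfint : Integrable f := by
    have h1 : IntegrableOn f (Metric.closedBall 0 R) :=
      Measure.integrableOn_of_bounded (M := M) (isCompact_closedBall _ _).measure_lt_top.ne
        hf.aestronglyMeasurable (Eventually.of_forall hM)
    exact (integrableOn_iff_integrable_of_support_subset hfsupp).1 h1
  let b : ℕ → ContDiffBump (0 : Rn n) := fun j =>
    ⟨1 / (2 * (j + 1)), 1 / (j + 1), by positivity, by
      apply one_div_lt_one_div_of_lt <;> nlinarith [(Nat.cast_nonneg j : (0 : ℝ) ≤ j)]⟩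
  have hbout : Tendsto (fun j => (b j).rOut) atTop (𝓝 0) := tendsto_one_div_add_atTop_nhds_zero_nat
  set c : ℕ → Rn n → ℂ := fun j =>
    convolution ((b j).normed volume) f (ContinuousLinearMap.lsmul ℝ ℝ) volume with hc
  have hcs : ∀ j, HasCompactSupport (c j) := fun j =>
    HasCompactSupport.convolution _ (b j).hasCompactSupport_normed hfcs
  have hcd : ∀ j, ContDiff ℝ (⊤ : ℕ∞) (c j) := fun j =>
    (b j).hasCompactSupport_normed.contDiff_convolution_left _ (b j).contDiff_normed
      hfint.locallyIntegrable
  refine ⟨fun j => (hcs j).toSchwartzMap (hcd j), fun j x => ?_, fun j x hx => ?_, ?_⟩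
  · change ‖c j x‖ ≤ M
    rw [hc]
    simp only [convolution_def, ContinuousLinearMap.lsmul_apply]
    calc _ ≤ ∫ t, (b j).normed volume t * M := by
          refine norm_integral_le_of_norm_le ((b j).integrable_normed.mul_const M)
            (Eventually.of_forall fun t => ?_)
          rw [norm_smul, Real.norm_of_nonneg ((b j).nonneg_normed t)]
          exact mul_le_mul_of_nonneg_left (hM _) ((b j).nonneg_normed t)
      _ = M := by rw [integral_mul_const, (b j).integral_normed, one_mul]
  · change c j x = 0
    by_contra h
    have h1 := support_convolution_subset (ContinuousLinearMap.lsmul ℝ ℝ) (show x ∈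
      Function.support (c j) from h)
    obtain ⟨y, hy, z, hz, hyz⟩ := Set.mem_add.1 h1
    rw [(b j).support_normed_eq, mem_ball_zero_iff] at hy
    have hz' := mem_closedBall_zero_iff.1 (hfsupp hz)
    have hle : (b j).rOut ≤ 1 := by
      change 1 / ((j : ℝ) + 1) ≤ 1
      rw [div_le_one (by positivity)]; linarith [(Nat.cast_nonneg j : (0 : ℝ) ≤ j)]
    have := norm_add_le y z
    rw [hyz] at this
    linarith
  · refine ContDiffBump.ae_convolution_tendsto_right_of_locallyIntegrable (K := 2) hbout
      (Eventually.of_forall fun j => ?_) hfint.locallyIntegrable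
    change 1 / ((j : ℝ) + 1) ≤ 2 * (1 / (2 * ((j : ℝ) + 1)))
    have : (0 : ℝ) < j + 1 := by positivity
    field_simp; exact le_refl _

lemma memLp_indicator_closedBall_const {n : ℕ} (M R : ℝ) (p : ℝ≥0∞) :
    MemLp ((Metric.closedBall (0 : Rn n) R).indicator fun _ => M) p volume :=
  memLp_indicator_const p measurableSet_closedBall M
    (Or.inr (isCompact_closedBall _ _).measure_lt_top.ne)

/-- `exists_schwartz_tendsto_ae`, together with the convergence in all `L^p`, `p < ∞`. -/
lemma exists_schwartz_tendsto_eLpNorm {n : ℕ} {f : Rn n → ℂ} (hf : Measurable f) {M R : ℝ}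
    (hM : ∀ x, ‖f x‖ ≤ M) (hR : ∀ x, R < ‖x‖ → f x = 0) :
    ∃ φ : ℕ → 𝓢(Rn n, ℂ), (∀ j x, ‖φ j x‖ ≤ M) ∧ (∀ j x, R + 1 < ‖x‖ → φ j x = 0) ∧
      (∀ᵐ x, Tendsto (fun j => φ j x) atTop (𝓝 (f x))) ∧
      ∀ p : ℝ≥0∞, p ≠ 0 → p ≠ ⊤ →
        Tendsto (fun j => eLpNorm (⇑(φ j) - f) p volume) atTop (𝓝 0) := by
  obtain ⟨φ, h1, h2, h3⟩ := exists_schwartz_tendsto_ae hf hM hR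
  refine ⟨φ, h1, h2, h3, fun p hp0 hp => ?_⟩
  refine tendsto_eLpNorm_sub_of_dominated hp0 hp
    (fun j => (φ j).continuous.aestronglyMeasurable)
    (memLp_indicator_closedBall_const M (R + 1) p) (fun j => Eventually.of_forall fun x => ?_) h3
  by_cases hx : R + 1 < ‖x‖
  · rw [h2 j x hx, norm_zero]
    exact indicator_nonneg (fun _ _ => (norm_nonneg _).trans (hM 0)) x
  · rw [indicator_of_mem (mem_closedBall_zero_iff.2 (not_lt.1 hx))]
    exact h1 j x

lemma tendsto_eLpNorm_of_tendsto_sub {α E : Type*} [MeasurableSpace α] {μ : Measure α}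
    [NormedAddCommGroup E] {F : ℕ → α → E} {f : α → E} {p : ℝ≥0∞} (hp : 1 ≤ p)
    (hF : ∀ j, AEStronglyMeasurable (F j) μ) (hf : AEStronglyMeasurable f μ)
    (h : Tendsto (fun j => eLpNorm (F j - f) p μ) atTop (𝓝 0)) :
    Tendsto (fun j => eLpNorm (F j) p μ) atTop (𝓝 (eLpNorm f p μ)) := by
  have hle : ∀ j, eLpNorm (F j) p μ ≤ eLpNorm f p μ + eLpNorm (F j - f) p μ := fun j => by
    have := eLpNorm_add_le hf ((hF j).sub hf) hp
    simpa using this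
  have hge : ∀ j, eLpNorm f p μ - eLpNorm (F j - f) p μ ≤ eLpNorm (F j) p μ := fun j => by
    rw [tsub_le_iff_right]
    have := eLpNorm_add_le (hF j) (hf.sub (hF j)) hp
    rw [eLpNorm_sub_comm f] at this
    simpa using this
  refine tendsto_of_tendsto_of_tendsto_of_le_of_le (g := fun j => eLpNorm f p μ -
    eLpNorm (F j - f) p μ) (h := fun j => eLpNorm f p μ + eLpNorm (F j - f) p μ) ?_ ?_ hge hle
  · rcases eq_or_ne (eLpNorm f p μ) ⊤ with ht | ht
    · rw [ht]
      have hev : ∀ᶠ j in atTop, (⊤ : ℝ≥0∞) - eLpNorm (F j - f) p μ = ⊤ := by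
        filter_upwards [h.eventually (gt_mem_nhds ENNReal.zero_lt_top)] with j hj
        exact ENNReal.top_sub hj.ne
      exact tendsto_const_nhds.congr' (hev.mono fun j hj => hj.symm)
    · simpa using ENNReal.Tendsto.sub (tendsto_const_nhds (x := eLpNorm f p μ)) h (Or.inl ht)
  · simpa using (tendsto_const_nhds (x := eLpNorm f p μ)).add h

/-- The converse of Hölder's inequality: testing against Schwartz functions computes the
`L^r` norm. -/
theorem eLpNorm_le_of_forall_schwartz {n : ℕ} {r r' : ℝ} (hr : 2 ≤ r)
    (hrr : r.HolderConjugate r') {h : Rn n → ℂ} (hh : LocallyIntegrable h) {C : ℝ≥0∞}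
    (H : ∀ φ : 𝓢(Rn n, ℂ), ‖∫ x, h x * φ x‖ₑ ≤ C * eLpNorm φ (ENNReal.ofReal r') volume) :
    eLpNorm h (ENNReal.ofReal r) volume ≤ C := by
  have hr0 : 0 < r := hrr.pos
  have hr'0 : 0 < r' := hrr.symm.pos
  rcases eq_or_ne C ⊤ with hC | hC
  · rw [hC]; exact le_top
  set h' := hh.aestronglyMeasurable.mk h with hh'
  have hae : h =ᵐ[volume] h' := hh.aestronglyMeasurable.ae_eq_mk
  have hm : Measurable h' := hh.aestronglyMeasurable.stronglyMeasurable_mk.measurable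
  set E : ℕ → Set (Rn n) := fun N => {x | ‖h' x‖ ≤ N ∧ ‖x‖ ≤ N} with hE
  have hEm : ∀ N, MeasurableSet (E N) := fun N =>
    (measurableSet_le hm.norm measurable_const).inter
      (measurableSet_le measurable_norm measurable_const)
  -- On `E N`, where `h` and `x` are bounded, test against the extremal function
  -- `g = |h| ^ (r - 2) * conj h`, a limit of Schwartz functions. There the integral `X`
  -- is finite, so that a power of it can be cancelled.
  have key : ∀ N, ∫⁻ x in E N, ‖h' x‖ₑ ^ r ≤ C ^ r := by
    intro N
    set g : Rn n → ℂ := (E N).indicator fun x =>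
      ((‖h' x‖ ^ (r - 2) : ℝ) : ℂ) * starRingEnd ℂ (h' x) with hg
    have hgm : Measurable g := by
      refine Measurable.indicator ?_ (hEm N)
      fun_prop
    have hgn : ∀ x ∈ E N, ‖g x‖ = ‖h' x‖ ^ (r - 1) := fun x hx => by
      rw [hg, indicator_of_mem hx, norm_mul, Complex.norm_real, Real.norm_of_nonneg (by positivity),
        RCLike.norm_conj]
      rcases eq_or_ne (h' x) 0 with h0 | h0
      · rw [h0, norm_zero, mul_zero, Real.zero_rpow (by linarith)]
      · rw [← Real.rpow_add_one (norm_ne_zero_iff.2 h0)]; congr 1; ring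
    have hgM : ∀ x, ‖g x‖ ≤ (N : ℝ) ^ (r - 1) := fun x => by
      by_cases hx : x ∈ E N
      · rw [hgn x hx]
        exact Real.rpow_le_rpow (norm_nonneg _) hx.1 (by linarith)
      · rw [hg, indicator_of_notMem hx, norm_zero]; positivity
    have hgR : ∀ x, (N : ℝ) < ‖x‖ → g x = 0 := fun x hx =>
      indicator_of_notMem (fun hx' => absurd hx'.2 (not_le.2 hx)) _
    obtain ⟨φ, hφ1, hφ2, hφ3, hφ4⟩ := exists_schwartz_tendsto_eLpNorm hgm hgM hgR
    have hlim1 : Tendsto (fun j => ∫ x, h x * φ j x) atTop (𝓝 (∫ x, h x * g x)) := by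
      refine tendsto_integral_of_dominated_convergence
        ((Metric.closedBall (0 : Rn n) (N + 1)).indicator fun x => ‖h x‖ * (N : ℝ) ^ (r - 1))
        (fun j => hh.aestronglyMeasurable.mul (φ j).continuous.aestronglyMeasurable) ?_
        (fun j => Eventually.of_forall fun x => ?_) ?_
      · rw [integrable_indicator_iff measurableSet_closedBall]
        exact ((hh.integrableOn_isCompact (isCompact_closedBall _ _)).norm).mul_const _
      · by_cases hx : (N : ℝ) + 1 < ‖x‖
        · rw [hφ2 j x hx, mul_zero, norm_zero]
          exact indicator_nonneg (fun _ _ => by positivity) x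
        · rw [indicator_of_mem (mem_closedBall_zero_iff.2 (not_lt.1 hx)), norm_mul]
          exact mul_le_mul_of_nonneg_left (hφ1 j x) (norm_nonneg _)
      · filter_upwards [hφ3] with x hx
        exact hx.const_mul _
    have hr'1 : (1 : ℝ≥0∞) ≤ ENNReal.ofReal r' := by
      rw [← ENNReal.ofReal_one]; exact ENNReal.ofReal_le_ofReal hrr.symm.lt.le
    have hr'pos : ENNReal.ofReal r' ≠ 0 := by simpa using hr'0
    have hlim2 := tendsto_eLpNorm_of_tendsto_sub hr'1
      (fun j => (φ j).continuous.aestronglyMeasurable) hgm.aestronglyMeasurable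
      (hφ4 _ hr'pos ENNReal.ofReal_ne_top)
    have hbd : ‖∫ x, h x * g x‖ₑ ≤ C * eLpNorm g (ENNReal.ofReal r') volume :=
      le_of_tendsto_of_tendsto' hlim1.enorm (ENNReal.Tendsto.const_mul hlim2 (Or.inr hC))
        fun j => H (φ j)
    set X := ∫⁻ x in E N, ‖h' x‖ₑ ^ r with hX
    have hXfin : X ≠ ⊤ := by
      have : X ≤ ∫⁻ x in Metric.closedBall (0 : Rn n) N, (N : ℝ≥0∞) ^ r := by
        calc X ≤ ∫⁻ x in E N, (N : ℝ≥0∞) ^ r := by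
              refine setLIntegral_mono measurable_const fun x hx => ?_
              gcongr
              rw [← ofReal_norm, ← ENNReal.ofReal_natCast]
              exact ENNReal.ofReal_le_ofReal hx.1
          _ ≤ _ := lintegral_mono_set fun x hx => mem_closedBall_zero_iff.2 hx.2
      refine ne_top_of_le_ne_top ?_ this
      rw [setLIntegral_const]
      exact ENNReal.mul_ne_top (ENNReal.rpow_ne_top_of_nonneg hr0.le (by simp))
        (isCompact_closedBall _ _).measure_lt_top.ne
    have e1 : ‖∫ x, h x * g x‖ₑ = X := by
      have : ∫ x, h x * g x = ((∫ x in E N, ‖h' x‖ ^ r : ℝ) : ℂ) := by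
        rw [← integral_complex_ofReal, ← integral_indicator (hEm N)]
        refine integral_congr_ae ?_
        filter_upwards [hae] with x hx
        rw [hx]
        by_cases hx' : x ∈ E N
        · rw [hg, indicator_of_mem hx', indicator_of_mem hx']
          have : h' x * (((‖h' x‖ ^ (r - 2) : ℝ) : ℂ) * starRingEnd ℂ (h' x)) =
              ((‖h' x‖ ^ (r - 2) : ℝ) : ℂ) * (h' x * starRingEnd ℂ (h' x)) := by ring
          rw [this, Complex.mul_conj, Complex.normSq_eq_norm_sq, ← Complex.ofReal_mul]
          congr 1
          rcases eq_or_ne (h' x) 0 with h0 | h0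
          · rw [h0, norm_zero, Real.zero_rpow hr0.ne']; simp
          · rw [← Real.rpow_natCast, ← Real.rpow_add (norm_pos_iff.2 h0)]; congr 1; norm_num
        · rw [hg, indicator_of_notMem hx', indicator_of_notMem hx', mul_zero]
      rw [this, ← ofReal_norm, Complex.norm_real, Real.norm_of_nonneg (by positivity),
        ofReal_integral_eq_lintegral_ofReal]
      · refine lintegral_congr fun x => ?_
        rw [← ENNReal.ofReal_rpow_of_nonneg (norm_nonneg _) hr0.le, ofReal_norm]
      · have h2 : AEStronglyMeasurable (fun x => ‖h' x‖ ^ r) (volume.restrict (E N)) :=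
          (hm.norm.pow_const r).aestronglyMeasurable
        refine ⟨h2, ?_⟩
        rw [hasFiniteIntegral_iff_ofReal (Eventually.of_forall fun x => by positivity)]
        refine lt_top_iff_ne_top.2 ?_
        convert! hXfin using 1
        refine lintegral_congr fun x => ?_
        rw [← ENNReal.ofReal_rpow_of_nonneg (norm_nonneg _) hr0.le, ofReal_norm]
      · exact Eventually.of_forall fun x => by positivity
    have e2 : eLpNorm g (ENNReal.ofReal r') volume = X ^ (1 / r') := by
      rw [eLpNorm_eq_lintegral_rpow_enorm_toReal hr'pos ENNReal.ofReal_ne_top,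
        ENNReal.toReal_ofReal hr'0.le, hX, ← lintegral_indicator (hEm N)]
      congr 1
      refine lintegral_congr fun x => ?_
      by_cases hx : x ∈ E N
      · rw [indicator_of_mem hx, ← ofReal_norm, hgn x hx, ← ofReal_norm,
          ENNReal.ofReal_rpow_of_nonneg (by positivity) hr'0.le,
          ENNReal.ofReal_rpow_of_nonneg (by positivity) hr0.le, ← Real.rpow_mul (norm_nonneg _),
          hrr.sub_one_mul_conj]
      · rw [indicator_of_notMem hx, hg, indicator_of_notMem hx, enorm_zero,
          ENNReal.zero_rpow_of_pos hr'0]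
    rw [e1, e2] at hbd
    rcases eq_or_ne X 0 with h0 | h0
    · rw [h0]; exact bot_le
    have hinv : 1 / r + 1 / r' = 1 := by
      have := hrr.inv_add_inv_eq_one
      simpa [one_div] using this
    have hX2 : X = X ^ (1 / r) * X ^ (1 / r') := by
      rw [← ENNReal.rpow_add _ _ h0 hXfin, hinv, ENNReal.rpow_one]
    have hXp0 : X ^ (1 / r') ≠ 0 := by
      simp only [ne_eq, ENNReal.rpow_eq_zero_iff]; push Not
      exact ⟨fun h => absurd h h0, fun _ => by positivity⟩
    have hXp1 : X ^ (1 / r') ≠ ⊤ := ENNReal.rpow_ne_top_of_nonneg (by positivity) hXfin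
    have h4 : X ^ (1 / r) ≤ C := by
      rw [← ENNReal.mul_le_mul_iff_left hXp0 hXp1, ← hX2]
      exact hbd
    calc X = (X ^ (1 / r)) ^ r := by
          rw [← ENNReal.rpow_mul, one_div_mul_cancel hr0.ne', ENNReal.rpow_one]
      _ ≤ C ^ r := by gcongr
  have hsup : ∫⁻ x, ‖h' x‖ₑ ^ r ≤ C ^ r := by
    have hmono : Monotone E := fun N M hNM x hx => by
      have : (N : ℝ) ≤ M := by exact_mod_cast hNM
      exact ⟨hx.1.trans this, hx.2.trans this⟩
    have hun : ⋃ N, E N = univ := by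
      refine eq_univ_of_forall fun x => ?_
      obtain ⟨N, hN⟩ := exists_nat_ge (max ‖h' x‖ ‖x‖)
      exact mem_iUnion.2 ⟨N, (le_max_left _ _).trans hN, (le_max_right _ _).trans hN⟩
    have h1 := setLIntegral_iUnion_of_directed (μ := volume) (fun x => ‖h' x‖ₑ ^ r)
      (s := E) (hmono.directed_le)
    rw [hun, setLIntegral_univ] at h1
    rw [h1]
    exact iSup_le key
  rw [eLpNorm_congr_ae hae, eLpNorm_eq_lintegral_rpow_enorm_toReal (by simpa using hr0)
    ENNReal.ofReal_ne_top, ENNReal.toReal_ofReal hr0.le]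
  calc _ ≤ (C ^ r) ^ (1 / r) := by gcongr
    _ = C := by rw [← ENNReal.rpow_mul, mul_one_div_cancel hr0.ne', ENNReal.rpow_one]

section

/-! ### The bilinear pairing of `L²` and interpolation of operators on Schwartz functions -/

lemma enorm_integral_mul_le {α : Type*} [MeasurableSpace α] {μ : Measure α} {f g : α → ℂ}
    {p q : ℝ≥0∞} [hpq : ENNReal.HolderConjugate p q] (hf : AEStronglyMeasurable f μ)
    (hg : AEStronglyMeasurable g μ) : ‖∫ x, f x * g x ∂μ‖ₑ ≤ eLpNorm f p μ * eLpNorm g q μ := by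
  refine (enorm_integral_le_lintegral_enorm _).trans ?_
  have := eLpNorm_smul_le_mul_eLpNorm (r := 1) hg hf (hpqr := hpq)
  rw [eLpNorm_one_eq_lintegral_enorm] at this
  simpa [smul_eq_mul] using this

lemma holderConjugate_ofReal {r r' : ℝ} (h : r.HolderConjugate r') :
    ENNReal.HolderConjugate (ENNReal.ofReal r) (ENNReal.ofReal r') where
  inv_add_inv_eq_inv := by
    rw [← ENNReal.ofReal_inv_of_pos h.pos, ← ENNReal.ofReal_inv_of_pos h.symm.pos,
      ← ENNReal.ofReal_add (by have := h.pos; positivity) (by have := h.symm.pos; positivity),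
      h.inv_add_inv_eq_one]
    simp

/-- The bilinear pairing `⟨f, g⟩ = ∫ f g` of `L²` functions, without complex conjugation. -/
noncomputable def l2Pair {n : ℕ} : L2 n →L[ℂ] L2 n →L[ℂ] ℂ :=
  (ContinuousLinearMap.mul ℂ ℂ).lpPairing volume 2 2

lemma l2Pair_eq_integral {n : ℕ} (f g : L2 n) : l2Pair f g = ∫ x, f x * g x := by
  simp [l2Pair, ContinuousLinearMap.lpPairing_eq_integral]

lemma l2Pair_toLp {n : ℕ} (f : L2 n) (φ : 𝓢(Rn n, ℂ)) :
    l2Pair f (φ.toLp 2) = ∫ x, f x * φ x := by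
  rw [l2Pair_eq_integral]
  refine integral_congr_ae ?_
  filter_upwards [φ.coeFn_toLp 2] with x hx
  rw [hx]

lemma integral_toLp_mul {n : ℕ} (φ ψ : 𝓢(Rn n, ℂ)) : ∫ x, (φ.toLp 2 volume) x * ψ x = ∫ x, φ x * ψ x := by
  refine integral_congr_ae ?_
  filter_upwards [φ.coeFn_toLp 2 volume] with x hx
  rw [hx]

lemma norm_l2Pair_le {n : ℕ} (f g : L2 n) : ‖l2Pair f g‖ ≤ ‖f‖ * ‖g‖ := by
  rw [l2Pair_eq_integral]
  have h := enorm_integral_mul_le (p := 2) (q := 2) (Lp.aestronglyMeasurable f)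
    (Lp.aestronglyMeasurable g)
  rw [← Lp.enorm_def, ← Lp.enorm_def, ← ofReal_norm, ← ofReal_norm, ← ofReal_norm,
    ← ENNReal.ofReal_mul (norm_nonneg _), ENNReal.ofReal_le_ofReal_iff (by positivity)] at h
  exact h

lemma eLpNorm_toLp_two {n : ℕ} (φ : 𝓢(Rn n, ℂ)) :
    eLpNorm φ 2 volume = ENNReal.ofReal ‖φ.toLp 2‖ := by
  rw [SchwartzMap.norm_toLp, ENNReal.ofReal_toReal (φ.eLpNorm_lt_top 2 volume).ne]

lemma norm_integral_mul_schwartz_le {n : ℕ} (f : L2 n) (φ : 𝓢(Rn n, ℂ)) :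
    ‖∫ x, f x * φ x‖ ≤ ‖f‖ * ‖φ.toLp 2‖ := by
  rw [← l2Pair_toLp]; exact norm_l2Pair_le _ _

lemma tendsto_bilinear_apply {E ι : Type*} [NormedAddCommGroup E] [NormedSpace ℂ E]
    (B : E →L[ℂ] E →L[ℂ] ℂ) {l : Filter ι} {f g : ι → E} {f₀ g₀ : E}
    (hf : Tendsto f l (𝓝 f₀)) (hg : Tendsto g l (𝓝 g₀)) :
    Tendsto (fun j => B (f j) (g j)) l (𝓝 (B f₀ g₀)) := by
  have hc : Continuous fun p : E × E => B p.1 p.2 := by fun_prop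
  exact (hc.tendsto (f₀, g₀)).comp (hf.prodMk_nhds hg)

lemma tendsto_l2Pair {n : ℕ} {ι : Type*} {l : Filter ι} {f g : ι → L2 n} {f₀ g₀ : L2 n}
    (hf : Tendsto f l (𝓝 f₀)) (hg : Tendsto g l (𝓝 g₀)) :
    Tendsto (fun j => l2Pair (f j) (g j)) l (𝓝 (l2Pair f₀ g₀)) :=
  tendsto_bilinear_apply l2Pair hf hg

namespace SchwartzMap

variable {n : ℕ}

/-- The extension to `L²` of a linear operator on Schwartz functions. -/
noncomputable def l2Extend (T : 𝓢(Rn n, ℂ) →ₗ[ℂ] 𝓢(Rn n, ℂ)) : L2 n →L[ℂ] L2 n :=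
  ((SchwartzMap.toLpCLM ℂ ℂ 2 (volume : Measure (Rn n))).toLinearMap ∘ₗ T).extendOfNorm
    (SchwartzMap.toLpCLM ℂ ℂ 2 (volume : Measure (Rn n))).toLinearMap

lemma denseRange_toLp_two :
    DenseRange (SchwartzMap.toLpCLM ℂ ℂ 2 (volume : Measure (Rn n))).toLinearMap :=
  SchwartzMap.denseRange_toLpCLM (F := ℂ) (E := Rn n) ENNReal.ofNat_ne_top

lemma l2Extend_toLp {T : 𝓢(Rn n, ℂ) →ₗ[ℂ] 𝓢(Rn n, ℂ)}
    (hT : ∀ φ, ‖(T φ).toLp 2 volume‖ ≤ ‖φ.toLp 2 volume‖) (φ : 𝓢(Rn n, ℂ)) :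
    l2Extend T (φ.toLp 2) = (T φ).toLp 2 :=
  LinearMap.extendOfNorm_eq denseRange_toLp_two ⟨1, fun φ => by simpa using hT φ⟩ φ

lemma norm_l2Extend_le {T : 𝓢(Rn n, ℂ) →ₗ[ℂ] 𝓢(Rn n, ℂ)}
    (hT : ∀ φ, ‖(T φ).toLp 2 volume‖ ≤ ‖φ.toLp 2 volume‖) (f : L2 n) :
    ‖l2Extend T f‖ ≤ ‖f‖ := by
  have := LinearMap.norm_extendOfNorm_apply_le (f := (SchwartzMap.toLpCLM ℂ ℂ 2
    (volume : Measure (Rn n))).toLinearMap ∘ₗ T) denseRange_toLp_two 1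
    (fun φ => by simpa using hT φ) f
  rwa [one_mul] at this

lemma tendsto_toLp_of_tendsto_eLpNorm {F : ℕ → Rn n → ℂ} {f : Rn n → ℂ}
    (hF : ∀ j, MemLp (F j) 2 volume) (hf : MemLp f 2 volume)
    (h : Tendsto (fun j => eLpNorm (F j - f) 2 volume) atTop (𝓝 0)) :
    Tendsto (fun j => (hF j).toLp (F j)) atTop (𝓝 (hf.toLp f)) := by
  rw [tendsto_iff_norm_sub_tendsto_zero]
  have : ∀ j, ‖(hF j).toLp (F j) - hf.toLp f‖ = (eLpNorm (F j - f) 2 volume).toReal := fun j => by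
    rw [← MemLp.toLp_sub, Lp.norm_toLp]
  simp_rw [this]
  simpa [Function.comp_def] using (ENNReal.tendsto_toReal ENNReal.zero_ne_top).comp h

lemma memLp_of_bounded {f : Rn n → ℂ} (hf : Measurable f) {M R : ℝ}
    (hM : ∀ x, ‖f x‖ ≤ M) (hR : ∀ x, R < ‖x‖ → f x = 0) (p : ℝ≥0∞) : MemLp f p volume := by
  refine (memLp_indicator_closedBall_const M R p).mono hf.aestronglyMeasurable
    (Eventually.of_forall fun x => ?_)
  rw [Real.norm_eq_abs]
  refine le_trans ?_ (le_abs_self _)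
  by_cases hx : R < ‖x‖
  · rw [hR x hx, norm_zero]
    exact indicator_nonneg (fun _ _ => (norm_nonneg _).trans (hM 0)) x
  · rw [indicator_of_mem (mem_closedBall_zero_iff.2 (not_lt.1 hx))]
    exact hM x

/-- An `L¹ → L^∞` bound on Schwartz functions passes to bounded functions with bounded support:
along an approximating sequence, a subsequence converges almost everywhere. -/
lemma enorm_l2Extend_apply_le {T : 𝓢(Rn n, ℂ) →ₗ[ℂ] 𝓢(Rn n, ℂ)}
    (hT : ∀ φ, ‖(T φ).toLp 2 volume‖ ≤ ‖φ.toLp 2 volume‖) {A : ℝ≥0∞} (hA : A ≠ ⊤)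
    (hT1 : ∀ φ x, ‖T φ x‖ₑ ≤ A * eLpNorm φ 1 volume) {f : Rn n → ℂ} (hf : Measurable f) {M R : ℝ}
    (hM : ∀ x, ‖f x‖ ≤ M) (hR : ∀ x, R < ‖x‖ → f x = 0) (hf2 : MemLp f 2 volume) :
    ∀ᵐ x, ‖l2Extend T (hf2.toLp f) x‖ₑ ≤ A * eLpNorm f 1 volume := by
  obtain ⟨φ, -, -, -, hφ⟩ := exists_schwartz_tendsto_eLpNorm hf hM hR
  have h1 : Tendsto (fun j => (φ j).toLp 2) atTop (𝓝 (hf2.toLp f)) :=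
    tendsto_toLp_of_tendsto_eLpNorm (fun j => (φ j).memLp 2) hf2 (hφ 2 (by simp) (by simp))
  have h2 : Tendsto (fun j => (T (φ j)).toLp 2) atTop (𝓝 (l2Extend T (hf2.toLp f))) := by
    simp_rw [← l2Extend_toLp hT]
    exact ((l2Extend T).continuous.tendsto _).comp h1
  obtain ⟨ns, hns, hae⟩ := (tendstoInMeasure_of_tendsto_Lp h2).exists_seq_tendsto_ae
  have h3 := tendsto_eLpNorm_of_tendsto_sub le_rfl (fun j => (φ j).continuous.aestronglyMeasurable)
    hf.aestronglyMeasurable (hφ 1 (by simp) (by simp))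
  have h4 : ∀ᵐ x, ∀ j, (T (φ (ns j))).toLp 2 volume x = T (φ (ns j)) x :=
    ae_all_iff.2 fun j => (T (φ (ns j))).coeFn_toLp 2 volume
  filter_upwards [hae, h4] with x hx hx4
  refine le_of_tendsto_of_tendsto' hx.enorm
    (ENNReal.Tendsto.const_mul (h3.comp hns.tendsto_atTop) (Or.inr hA)) fun j => ?_
  rw [hx4]
  exact hT1 _ x

/-- The bound of the bilinear form on the line `re z = 0` in the interpolation argument. -/
lemma enorm_l2Pair_l2Extend_le {T : 𝓢(Rn n, ℂ) →ₗ[ℂ] 𝓢(Rn n, ℂ)}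
    (hT : ∀ φ, ‖(T φ).toLp 2 volume‖ ≤ ‖φ.toLp 2 volume‖) {A : ℝ≥0∞} (hA : A ≠ ⊤)
    (hT1 : ∀ φ x, ‖T φ x‖ₑ ≤ A * eLpNorm φ 1 volume) {f g : Rn n → ℂ} (hf : Measurable f)
    {M R : ℝ} (hM : ∀ x, ‖f x‖ ≤ M) (hR : ∀ x, R < ‖x‖ → f x = 0) (hf2 : MemLp f 2 volume)
    (hg2 : MemLp g 2 volume) :
    ‖l2Pair (l2Extend T (hf2.toLp f)) (hg2.toLp g)‖ₑ ≤
      A * eLpNorm f 1 volume * eLpNorm g 1 volume := by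
  rw [l2Pair_eq_integral]
  calc _ ≤ ∫⁻ x, ‖l2Extend T (hf2.toLp f) x * (hg2.toLp g) x‖ₑ :=
        enorm_integral_le_lintegral_enorm _
    _ ≤ ∫⁻ x, A * eLpNorm f 1 volume * ‖g x‖ₑ := by
        refine lintegral_mono_ae ?_
        filter_upwards [enorm_l2Extend_apply_le hT hA hT1 hf hM hR hf2, hg2.coeFn_toLp]
          with x h1 h2
        rw [enorm_mul, h2]
        gcongr
    _ = _ := by
        rw [lintegral_const_mul'' _ hg2.1.enorm, eLpNorm_one_eq_lintegral_enorm (f := g)]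

/-- The holomorphic family of functions `c ↦ |c| ^ (s (1 - z / 2)) sgn c` of Riesz–Thorin
interpolation: it has modulus `|c| ^ s` at `Re z = 0` and `|c| ^ (s / 2)` at `Re z = 1`. -/
noncomputable def interpFamily (s : ℝ) (z c : ℂ) : ℂ :=
  if c = 0 then 0 else c / ‖c‖ * Complex.exp (s * (1 - z / 2) * Real.log ‖c‖)

lemma norm_interpFamily (s : ℝ) (z : ℂ) {c : ℂ} (hc : c ≠ 0) :
    ‖interpFamily s z c‖ = ‖c‖ ^ (s * (1 - z.re / 2)) := by
  have hc' : 0 < ‖c‖ := norm_pos_iff.2 hc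
  rw [interpFamily, if_neg hc, norm_mul, norm_div, Complex.norm_real, norm_norm, div_self hc'.ne',
    one_mul, Complex.norm_exp, Real.rpow_def_of_pos hc']
  congr 1
  simp [mul_comm]

lemma interpFamily_eq_self {s : ℝ} {z c : ℂ} (h : (s : ℂ) * (1 - z / 2) = 1) :
    interpFamily s z c = c := by
  rcases eq_or_ne c 0 with hc | hc
  · simp [interpFamily, hc]
  have hc' : (0 : ℝ) < ‖c‖ := norm_pos_iff.2 hc
  have hc'' : (‖c‖ : ℂ) ≠ 0 := by exact_mod_cast hc'.ne'
  rw [interpFamily, if_neg hc, h, one_mul, ← Complex.ofReal_exp, Real.exp_log hc']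
  field_simp

lemma norm_interpFamily_le {s : ℝ} (hs : 0 < s) {z : ℂ} (h0 : 0 ≤ z.re) (h1 : z.re ≤ 1) (c : ℂ) :
    ‖interpFamily s z c‖ ≤ (1 + ‖c‖) ^ s := by
  rcases eq_or_ne c 0 with hc | hc
  · simp [interpFamily, hc]
  rw [norm_interpFamily s z hc]
  calc ‖c‖ ^ (s * (1 - z.re / 2)) ≤ (1 + ‖c‖) ^ (s * (1 - z.re / 2)) :=
        Real.rpow_le_rpow (norm_nonneg _) (by linarith) (mul_nonneg hs.le (by linarith))
    _ ≤ (1 + ‖c‖) ^ s :=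
        Real.rpow_le_rpow_of_exponent_le (by linarith [norm_nonneg c]) (by nlinarith)

/-- Riesz–Thorin interpolation for simple functions with bounded support. -/
lemma norm_l2Pair_l2Extend_simpleFunc_le {r r' : ℝ} (hr : 2 < r) (hrr : r.HolderConjugate r')
    {T : 𝓢(Rn n, ℂ) →ₗ[ℂ] 𝓢(Rn n, ℂ)}
    (hT : ∀ φ, ‖(T φ).toLp 2 volume‖ ≤ ‖φ.toLp 2 volume‖) {A : ℝ} (hA : 0 < A)
    (hT1 : ∀ φ x, ‖T φ x‖ₑ ≤ ENNReal.ofReal A * eLpNorm φ 1 volume)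
    (f g : SimpleFunc (Rn n) ℂ) {R : ℝ} (hf : ∀ x, R < ‖x‖ → f x = 0)
    (hg : ∀ x, R < ‖x‖ → g x = 0) (hf2 : MemLp f 2 volume) (hg2 : MemLp g 2 volume) :
    ‖l2Pair (l2Extend T (hf2.toLp f)) (hg2.toLp g)‖ ≤ A ^ (1 - 2 / r) *
      ((eLpNorm f (ENNReal.ofReal r') volume).toReal *
        (eLpNorm g (ENNReal.ofReal r') volume).toReal) := by
  have hr0 : 0 < r := hrr.pos
  have hr'0 : 0 < r' := hrr.symm.pos
  have hinv : 1 / r + 1 / r' = 1 := by simpa [one_div] using hrr.inv_add_inv_eq_one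
  -- a simple function is a finite linear combination of indicators of bounded sets
  have hbd : ∀ h : SimpleFunc (Rn n) ℂ, ∃ M : ℝ, ∀ x, ‖h x‖ ≤ M := fun h => by
    obtain ⟨M, hM⟩ := h.exists_forall_norm_le
    exact ⟨M, hM⟩
  have hmem : ∀ h : SimpleFunc (Rn n) ℂ, (∀ x, R < ‖x‖ → h x = 0) → ∀ p, MemLp h p volume :=
    fun h hR p => by
      obtain ⟨M, hM⟩ := hbd h
      exact memLp_of_bounded h.measurable hM hR p
  have hmap : ∀ h : SimpleFunc (Rn n) ℂ, (∀ x, R < ‖x‖ → h x = 0) → ∀ z x, R < ‖x‖ →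
      h.map (interpFamily r' z) x = 0 := fun h hR z x hx => by
    simp [hR x hx, interpFamily]
  -- the holomorphic family of `L²` functions attached to a simple function
  have hfam : ∀ h : SimpleFunc (Rn n) ℂ, ∀ hR : (∀ x, R < ‖x‖ → h x = 0),
      Differentiable ℂ (fun z => (hmem _ (hmap h hR z) 2).toLp (h.map (interpFamily r' z))) ∧
      ∃ K : ℝ, ∀ z : ℂ, 0 ≤ z.re → z.re ≤ 1 →
        ‖(hmem _ (hmap h hR z) 2).toLp (h.map (interpFamily r' z))‖ ≤ K := by
    intro h hR
    set S := h.range.filter (fun c => c ≠ 0) with hS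
    have hset : ∀ c ∈ S, ∀ x, R < ‖x‖ → (h ⁻¹' {c}).indicator (fun _ => (1 : ℂ)) x = 0 := by
      intro c hc x hx
      refine indicator_of_notMem (fun hx' => ?_) _
      have h1 : h x = c := hx'
      exact (Finset.mem_filter.1 hc).2 (h1 ▸ hR x hx)
    have hW : ∀ c : ℂ, ∃ W : L2 n, c ∈ S → W =ᵐ[volume]
        (h ⁻¹' {c}).indicator (fun _ => (1 : ℂ)) := fun c => by
      by_cases hc : c ∈ S
      · have := memLp_of_bounded (p := 2) (M := 1) (f := (h ⁻¹' {c}).indicator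
          (fun _ => (1 : ℂ))) (measurable_const.indicator (h.measurableSet_fiber c))
          (fun x => (norm_indicator_le_norm_self _ _).trans (by simp)) (hset c hc)
        exact ⟨this.toLp _, fun _ => this.coeFn_toLp⟩
      · exact ⟨0, fun h => absurd h hc⟩
    choose W hW using hW
    have heq : ∀ z, (hmem _ (hmap h hR z) 2).toLp (h.map (interpFamily r' z)) =
        ∑ c ∈ S, interpFamily r' z c • W c := by
      intro z
      apply Lp.ext
      have h1 : ∀ᵐ x, ∀ c ∈ S, W c x = (h ⁻¹' {c}).indicator (fun _ => (1 : ℂ)) x :=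
        (ae_ball_iff S.countable_toSet).2 fun c hc => hW c hc
      have h2 : ∀ᵐ x, ∀ c ∈ S, (interpFamily r' z c • W c : L2 n) x =
          interpFamily r' z c * W c x :=
        (ae_ball_iff S.countable_toSet).2 fun c hc => Lp.coeFn_smul _ _
      filter_upwards [(hmem _ (hmap h hR z) 2).coeFn_toLp, h1, h2,
        Lp.coeFn_finsetSum S (fun c => interpFamily r' z c • W c)] with x e1 e2 e3 e4
      rw [e1, e4, Finset.sum_apply, Finset.sum_congr rfl fun c hc => by rw [e3 c hc, e2 c hc]]
      rw [SimpleFunc.map_apply]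
      by_cases hx : h x = 0
      · rw [hx, Finset.sum_eq_zero]
        · simp [interpFamily]
        · intro c hc
          rw [indicator_of_notMem, mul_zero]
          intro hx'
          have h1 : h x = c := hx'
          exact (Finset.mem_filter.1 hc).2 (by rw [← h1, hx])
      · rw [Finset.sum_eq_single (h x)]
        · simp
        · intro c _ hc
          rw [indicator_of_notMem, mul_zero]
          intro hx'
          exact hc (show h x = c from hx').symm
        · intro hc
          exact absurd (Finset.mem_filter.2 ⟨h.mem_range_self x, hx⟩) hc
    refine ⟨?_, ∑ c ∈ S, (1 + ‖c‖) ^ r' * ‖W c‖, fun z h0 h1 => ?_⟩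
    · rw [show (fun z => (hmem _ (hmap h hR z) 2).toLp (h.map (interpFamily r' z))) =
        fun z => ∑ c ∈ S, interpFamily r' z c • W c from funext heq]
      refine Differentiable.fun_sum fun c hc => Differentiable.smul_const ?_ _
      simp only [interpFamily, if_neg (Finset.mem_filter.1 hc).2]
      fun_prop
    · rw [heq]
      refine (norm_sum_le _ _).trans (Finset.sum_le_sum fun c _ => ?_)
      rw [norm_smul]
      exact mul_le_mul_of_nonneg_right (norm_interpFamily_le hr'0 h0 h1 c) (norm_nonneg _)
  obtain ⟨hdf, Kf, hKf⟩ := hfam f hf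
  obtain ⟨hdg, Kg, hKg⟩ := hfam g hg
  set ff : ℂ → L2 n := fun z => (hmem _ (hmap f hf z) 2).toLp (f.map (interpFamily r' z)) with hff
  set gg : ℂ → L2 n := fun z => (hmem _ (hmap g hg z) 2).toLp (g.map (interpFamily r' z)) with hgg
  set F : ℂ → ℂ := fun z => l2Pair (l2Extend T (ff z)) (gg z) with hF
  have hFd : Differentiable ℂ F := by
    have h1 : Differentiable ℂ fun z => l2Pair (l2Extend T (ff z)) :=
      l2Pair.differentiable.comp ((l2Extend T).differentiable.comp hdf)
    exact h1.clm_apply hdg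
  have hFle : ∀ z, ‖F z‖ ≤ ‖ff z‖ * ‖gg z‖ := fun z =>
    (norm_l2Pair_le _ _).trans (mul_le_mul_of_nonneg_right (norm_l2Extend_le hT _) (norm_nonneg _))
  -- the `L¹` and `L²` norms of the family on the two boundary lines
  set X : SimpleFunc (Rn n) ℂ → ℝ≥0∞ := fun h => ∫⁻ x, ‖h x‖ₑ ^ r' with hX
  have hXfin : ∀ h : SimpleFunc (Rn n) ℂ, (∀ x, R < ‖x‖ → h x = 0) → X h ≠ ⊤ := fun h hR => by
    have := lintegral_rpow_enorm_lt_top_of_eLpNorm_lt_top (p := ENNReal.ofReal r') (by simpa using hr'0)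
      ENNReal.ofReal_ne_top (hmem h hR (ENNReal.ofReal r')).2
    rw [ENNReal.toReal_ofReal hr'0.le] at this
    exact this.ne
  have hpt : ∀ (h : SimpleFunc (Rn n) ℂ) (z : ℂ) x, 0 < r' * (1 - z.re / 2) →
      ‖h.map (interpFamily r' z) x‖ₑ = ‖h x‖ₑ ^ (r' * (1 - z.re / 2)) := by
    intro h z x hz
    rw [SimpleFunc.map_apply]
    rcases eq_or_ne (h x) 0 with h0 | h0
    · rw [h0, enorm_zero, ENNReal.zero_rpow_of_pos hz]; simp [interpFamily]
    · rw [← ofReal_norm, norm_interpFamily _ _ h0, ← ofReal_norm,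
        ENNReal.ofReal_rpow_of_pos (norm_pos_iff.2 h0)]
  have hL1 : ∀ (h : SimpleFunc (Rn n) ℂ) (z : ℂ), z.re = 0 →
      eLpNorm (h.map (interpFamily r' z)) 1 volume = X h := fun h z hz => by
    rw [eLpNorm_one_eq_lintegral_enorm]
    refine lintegral_congr fun x => ?_
    rw [hpt h z x (by rw [hz]; linarith), hz]; simp
  have hL2 : ∀ (h : SimpleFunc (Rn n) ℂ) (z : ℂ), z.re = 1 →
      eLpNorm (h.map (interpFamily r' z)) 2 volume = X h ^ (1 / 2 : ℝ) := fun h z hz => by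
    rw [eLpNorm_eq_lintegral_rpow_enorm_toReal (by simp) (by simp)]
    simp only [ENNReal.toReal_ofNat]
    congr 1
    refine lintegral_congr fun x => ?_
    rw [hpt h z x (by rw [hz]; linarith), hz, ← ENNReal.rpow_mul]
    congr 1; ring
  have ha : ∀ z ∈ Complex.re ⁻¹' {(0 : ℝ)}, ‖F z‖ ≤ A * (X f).toReal * (X g).toReal := by
    intro z hz
    have hz : z.re = 0 := hz
    obtain ⟨M, hM⟩ := hbd (f.map (interpFamily r' z))
    have := enorm_l2Pair_l2Extend_le hT ENNReal.ofReal_ne_top hT1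
      (f.map (interpFamily r' z)).measurable hM (hmap f hf z) (hmem _ (hmap f hf z) 2)
      (hmem _ (hmap g hg z) 2)
    rw [hL1 f z hz, hL1 g z hz, ← ofReal_norm] at this
    have h2 := ENNReal.toReal_mono (ENNReal.mul_ne_top (ENNReal.mul_ne_top ENNReal.ofReal_ne_top
      (hXfin f hf)) (hXfin g hg)) this
    rwa [ENNReal.toReal_ofReal (norm_nonneg _), ENNReal.toReal_mul, ENNReal.toReal_mul,
      ENNReal.toReal_ofReal hA.le] at h2
  have hb : ∀ z ∈ Complex.re ⁻¹' {(1 : ℝ)}, ‖F z‖ ≤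
      (X f).toReal ^ (1 / 2 : ℝ) * (X g).toReal ^ (1 / 2 : ℝ) := by
    intro z hz
    have hz : z.re = 1 := hz
    refine (hFle z).trans_eq ?_
    rw [hff, hgg]
    simp only
    rw [Lp.norm_toLp, Lp.norm_toLp, hL2 f z hz, hL2 g z hz, ENNReal.toReal_rpow,
      ENNReal.toReal_rpow]
  have hθ : (2 / r : ℝ) ∈ Icc (0 : ℝ) 1 := ⟨by positivity, by rw [div_le_one hr0]; exact hr.le⟩
  have key := Complex.HadamardThreeLines.norm_le_interp_of_mem_verticalClosedStrip₀₁' F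
    (z := ((2 / r : ℝ) : ℂ)) (a := A * (X f).toReal * (X g).toReal)
    (b := (X f).toReal ^ (1 / 2 : ℝ) * (X g).toReal ^ (1 / 2 : ℝ))
    (by simpa [Complex.HadamardThreeLines.verticalClosedStrip] using hθ) hFd.diffContOnCl (by
      refine ⟨Kf * Kg, ?_⟩
      rintro _ ⟨z, hz, rfl⟩
      have hz : z.re ∈ Icc (0 : ℝ) 1 := hz
      refine (hFle z).trans ?_
      have := hKf z hz.1 hz.2
      have := hKg z hz.1 hz.2
      have := norm_nonneg (ff z)
      have := norm_nonneg (gg z)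
      gcongr
      · linarith
      ) ha hb
  have hself : ∀ h : SimpleFunc (Rn n) ℂ, h.map (interpFamily r' ((2 / r : ℝ) : ℂ)) = h := fun h => by
    ext x
    rw [SimpleFunc.map_apply, interpFamily_eq_self]
    have : r' * (1 - 2 / r / 2) = 1 := by
      have : (1 : ℝ) - 2 / r / 2 = 1 / r' := by linear_combination -hinv
      rw [this]; field_simp
    exact_mod_cast this
  have hFz : F ((2 / r : ℝ) : ℂ) = l2Pair (l2Extend T (hf2.toLp f)) (hg2.toLp g) := by
    have h1 : ff ((2 / r : ℝ) : ℂ) = hf2.toLp f :=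
      (MemLp.toLp_eq_toLp_iff (hmem _ (hmap f hf _) 2) hf2).2 (.of_eq (by rw [hself]))
    have h2 : gg ((2 / r : ℝ) : ℂ) = hg2.toLp g :=
      (MemLp.toLp_eq_toLp_iff (hmem _ (hmap g hg _) 2) hg2).2 (.of_eq (by rw [hself]))
    rw [hF]
    simp only
    rw [h1, h2]
  rw [hFz] at key
  refine key.trans_eq ?_
  have hnorm : ∀ h : SimpleFunc (Rn n) ℂ, (eLpNorm h (ENNReal.ofReal r') volume).toReal =
      (X h).toReal ^ (1 / r') := fun h => by
    rw [eLpNorm_eq_lintegral_rpow_enorm_toReal (by simpa using hr'0) ENNReal.ofReal_ne_top,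
      ENNReal.toReal_ofReal hr'0.le, ENNReal.toReal_rpow]
  rw [hnorm, hnorm, Complex.ofReal_re]
  have hXf : 0 ≤ (X f).toReal := ENNReal.toReal_nonneg
  have hXg : 0 ≤ (X g).toReal := ENNReal.toReal_nonneg
  have h1r' : 1 / r' = 1 - 2 / r + 1 / 2 * (2 / r) := by linear_combination hinv
  have hpow : ∀ x : ℝ, 0 ≤ x → x ^ (1 / r') = x ^ (1 - 2 / r) * (x ^ (1 / 2 : ℝ)) ^ (2 / r) := by
    intro x hx
    rw [← Real.rpow_mul hx, h1r', Real.rpow_add_of_nonneg hx (by linarith [hθ.2]) (by positivity)]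
  rw [hpow _ hXf, hpow _ hXg, Real.mul_rpow (by positivity) hXg, Real.mul_rpow hA.le hXf,
    Real.mul_rpow (by positivity) (by positivity)]
  ring

/-- Simple functions with bounded support approximate a Schwartz function in all `L^p`. -/
lemma exists_simpleFunc_tendsto (φ : 𝓢(Rn n, ℂ)) : ∃ f : ℕ → SimpleFunc (Rn n) ℂ,
    (∀ (j : ℕ) x, (j : ℝ) < ‖x‖ → f j x = 0) ∧ ∀ p : ℝ≥0∞, p ≠ 0 → p ≠ ⊤ →
      Tendsto (fun j => eLpNorm (⇑(f j) - ⇑φ) p volume) atTop (𝓝 0) := by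
  have hφm : Measurable φ := φ.continuous.measurable
  set a := fun j => SimpleFunc.approxOn φ hφm univ 0 (mem_univ _) j with ha
  refine ⟨fun j => (a j).restrict (Metric.closedBall 0 j), fun j x hx => ?_, fun p hp0 hp => ?_⟩
  · rw [SimpleFunc.restrict_apply _ measurableSet_closedBall, indicator_of_notMem]
    simpa using hx
  · refine tendsto_eLpNorm_sub_of_dominated hp0 hp
      (fun j => (SimpleFunc.measurable _).aestronglyMeasurable)
      (G := fun x => ‖φ x‖ + ‖φ x‖) ((φ.memLp p).norm.add (φ.memLp p).norm)
      (fun j => Eventually.of_forall fun x => ?_) (Eventually.of_forall fun x => ?_)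
    · rw [SimpleFunc.restrict_apply _ measurableSet_closedBall]
      exact (norm_indicator_le_norm_self _ _).trans
        (SimpleFunc.norm_approxOn_zero_le hφm (mem_univ _) x j)
    · have h1 : Tendsto (fun j => a j x) atTop (𝓝 (φ x)) :=
        SimpleFunc.tendsto_approxOn hφm (mem_univ _) (by simp)
      refine h1.congr' ?_
      obtain ⟨N, hN⟩ := exists_nat_ge ‖x‖
      filter_upwards [eventually_ge_atTop N] with j hj
      have : (N : ℝ) ≤ j := by exact_mod_cast hj
      rw [SimpleFunc.restrict_apply _ measurableSet_closedBall, indicator_of_mem]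
      simpa using hN.trans this

/-- Riesz–Thorin interpolation between `L¹ → L^∞` and `L² → L²`, for operators on Schwartz
functions. -/
theorem eLpNorm_le_of_interpolation {r r' : ℝ} (hr : 2 < r) (hrr : r.HolderConjugate r')
    {T : 𝓢(Rn n, ℂ) →ₗ[ℂ] 𝓢(Rn n, ℂ)}
    (hT : ∀ φ, ‖(T φ).toLp 2 volume‖ ≤ ‖φ.toLp 2 volume‖) {A : ℝ} (hA : 0 < A)
    (hT1 : ∀ φ x, ‖T φ x‖ₑ ≤ ENNReal.ofReal A * eLpNorm φ 1 volume) (φ : 𝓢(Rn n, ℂ)) :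
    eLpNorm (T φ) (ENNReal.ofReal r) volume ≤
      ENNReal.ofReal (A ^ (1 - 2 / r)) * eLpNorm φ (ENNReal.ofReal r') volume := by
  have hr'0 : 0 < r' := hrr.symm.pos
  have hr'1 : (1 : ℝ≥0∞) ≤ ENNReal.ofReal r' := by
    rw [← ENNReal.ofReal_one]; exact ENNReal.ofReal_le_ofReal hrr.symm.lt.le
  have hr'p : ENNReal.ofReal r' ≠ 0 := by simpa using hr'0
  refine eLpNorm_le_of_forall_schwartz hr.le hrr (T φ).continuous.locallyIntegrable fun ψ => ?_
  obtain ⟨f, hf0, hf⟩ := exists_simpleFunc_tendsto φ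
  obtain ⟨g, hg0, hg⟩ := exists_simpleFunc_tendsto ψ
  have hmem : ∀ (h : SimpleFunc (Rn n) ℂ) (R : ℝ), (∀ x, R < ‖x‖ → h x = 0) → ∀ p,
      MemLp h p volume := fun h R hR p => by
    obtain ⟨M, hM⟩ := h.exists_forall_norm_le
    exact memLp_of_bounded h.measurable hM hR p
  have hf2 := tendsto_toLp_of_tendsto_eLpNorm (fun j => hmem (f j) j (hf0 j) 2) (φ.memLp 2)
    (hf 2 (by simp) (by simp))
  have hg2 := tendsto_toLp_of_tendsto_eLpNorm (fun j => hmem (g j) j (hg0 j) 2) (ψ.memLp 2)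
    (hg 2 (by simp) (by simp))
  have hnf := tendsto_eLpNorm_of_tendsto_sub hr'1
    (fun j => (f j).measurable.aestronglyMeasurable) φ.continuous.aestronglyMeasurable
    (hf _ hr'p ENNReal.ofReal_ne_top)
  have hng := tendsto_eLpNorm_of_tendsto_sub hr'1
    (fun j => (g j).measurable.aestronglyMeasurable) ψ.continuous.aestronglyMeasurable
    (hg _ hr'p ENNReal.ofReal_ne_top)
  have hlim := tendsto_l2Pair (((l2Extend T).continuous.tendsto _).comp hf2) hg2
  have hφfin := (φ.eLpNorm_lt_top (ENNReal.ofReal r') volume).ne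
  have hψfin := (ψ.eLpNorm_lt_top (ENNReal.ofReal r') volume).ne
  have hle := le_of_tendsto_of_tendsto' hlim.norm
    ((((ENNReal.tendsto_toReal hφfin).comp hnf).mul
      ((ENNReal.tendsto_toReal hψfin).comp hng)).const_mul (A ^ (1 - 2 / r))) fun j =>
    norm_l2Pair_l2Extend_simpleFunc_le hr hrr hT hA hT1 (f j) (g j) (hf0 j) (hg0 j)
      (hmem (f j) j (hf0 j) 2) (hmem (g j) j (hg0 j) 2)
  have hT2 : l2Extend T ((φ.memLp 2).toLp φ) = (T φ).toLp 2 := l2Extend_toLp hT φ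
  rw [hT2, show (ψ.memLp 2 volume).toLp ψ = ψ.toLp 2 volume from rfl, l2Pair_toLp] at hle
  rw [integral_toLp_mul] at hle
  rw [← ofReal_norm]
  refine (ENNReal.ofReal_le_ofReal hle).trans_eq ?_
  rw [ENNReal.ofReal_mul (by positivity), ENNReal.ofReal_mul ENNReal.toReal_nonneg,
    ENNReal.ofReal_toReal hφfin, ENNReal.ofReal_toReal hψfin, mul_assoc]

end SchwartzMap

end

section

/-! ### Fourier multipliers, the Schrödinger group and its dispersive estimate -/

namespace SchwartzMap

variable {n : ℕ}

open FourierTransform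

lemma fourier_fourierMultiplierCLM_apply {g : Rn n → ℂ} (hg : g.HasTemperateGrowth)
    (φ : 𝓢(Rn n, ℂ)) (ξ : Rn n) : 𝓕 (fourierMultiplierCLM ℂ g φ) ξ = g ξ * 𝓕 φ ξ := by
  rw [fourierMultiplierCLM_apply, FourierTransform.fourier_fourierInv_eq,
    smulLeftCLM_apply_apply hg, smul_eq_mul]

lemma norm_toLp_two_le_of_norm_le {φ ψ : 𝓢(Rn n, ℂ)} {C : ℝ}
    (h : ∀ ξ, ‖φ ξ‖ ≤ C * ‖ψ ξ‖) : ‖φ.toLp 2 volume‖ ≤ C * ‖ψ.toLp 2 volume‖ := by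
  refine Lp.norm_le_mul_norm_of_ae_le_mul ?_
  filter_upwards [φ.coeFn_toLp 2 volume, ψ.coeFn_toLp 2 volume] with x h1 h2
  rw [h1, h2]; exact h x

/-- Comparison of `L²` norms on the Fourier side. -/
lemma norm_toLp_two_le_of_norm_fourier_le {φ ψ : 𝓢(Rn n, ℂ)} {C : ℝ}
    (h : ∀ ξ, ‖𝓕 φ ξ‖ ≤ C * ‖𝓕 ψ ξ‖) : ‖φ.toLp 2 volume‖ ≤ C * ‖ψ.toLp 2 volume‖ := by
  rw [← norm_fourier_toL2_eq φ, ← norm_fourier_toL2_eq ψ]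
  exact norm_toLp_two_le_of_norm_le h

lemma ext_of_fourier {φ ψ : 𝓢(Rn n, ℂ)} (h : ∀ ξ, 𝓕 φ ξ = 𝓕 ψ ξ) : φ = ψ := by
  have h1 : 𝓕 φ = 𝓕 ψ := SchwartzMap.ext h
  have h2 : (𝓕⁻ (𝓕 φ : 𝓢(Rn n, ℂ)) : 𝓢(Rn n, ℂ)) = 𝓕⁻ (𝓕 ψ : 𝓢(Rn n, ℂ)) := by rw [h1]
  rwa [FourierTransform.fourierInv_fourier_eq, FourierTransform.fourierInv_fourier_eq] at h2

lemma fourier_sub' (φ ψ : 𝓢(Rn n, ℂ)) : 𝓕 (φ - ψ) = 𝓕 φ - 𝓕 ψ :=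
  map_sub (fourierTransformCLM ℂ (V := Rn n) (E := ℂ)) φ ψ

/-- Fourier multipliers with an even symbol are symmetric for the bilinear pairing. -/
lemma integral_fourierMultiplierCLM_mul {g : Rn n → ℂ} (hg : g.HasTemperateGrowth)
    (heven : ∀ ξ, g (-ξ) = g ξ) (φ ψ : 𝓢(Rn n, ℂ)) :
    ∫ x, fourierMultiplierCLM ℂ g φ x * ψ x = ∫ x, φ x * fourierMultiplierCLM ℂ g ψ x := by
  have hinv : ∀ (χ : 𝓢(Rn n, ℂ)) ξ, 𝓕⁻ χ ξ = 𝓕 χ (-ξ) := fun χ ξ => by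
    rw [fourierInv_coe, fourier_coe, Real.fourierInv_eq_fourier_neg]
  have h1 : ∀ φ ψ : 𝓢(Rn n, ℂ), ∫ x, fourierMultiplierCLM ℂ g φ x * ψ x =
      ∫ ξ, g ξ * 𝓕 φ ξ * 𝓕 ψ (-ξ) := fun φ ψ => by
    rw [fourierMultiplierCLM_apply, integral_fourierInv_mul_eq]
    simp_rw [smulLeftCLM_apply_apply hg, hinv, smul_eq_mul]
  rw [h1]
  have h2 := h1 ψ φ
  simp_rw [mul_comm _ (φ _)] at h2
  rw [h2, ← integral_neg_eq_self]
  refine integral_congr_ae (Eventually.of_forall fun ξ => ?_)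
  simp only [neg_neg, heven]
  ring

lemma hasTemperateGrowth_exp_I_mul : (fun x : ℝ => Complex.exp (Complex.I * x)).HasTemperateGrowth := by
  refine ⟨(contDiff_const.mul Complex.ofRealCLM.contDiff).cexp, fun m => ⟨0, 1, fun x => ?_⟩⟩
  rw [norm_iteratedFDeriv_eq_norm_iteratedDeriv]
  have hind : ∀ m : ℕ, iteratedDeriv m (fun x : ℝ => Complex.exp (Complex.I * x)) =
      fun x : ℝ => Complex.I ^ m * Complex.exp (Complex.I * x) := by
    intro m
    induction m with
    | zero => simp
    | succ m ih =>
      rw [iteratedDeriv_succ, ih]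
      ext x
      have h1 : HasDerivAt (fun x : ℝ => Complex.I * (x : ℂ)) Complex.I x := by
        simpa using (Complex.ofRealCLM.hasDerivAt (x := x)).const_mul Complex.I
      rw [(h1.cexp.const_mul (Complex.I ^ m)).deriv]
      ring
  rw [hind, norm_mul, Complex.norm_exp_I_mul_ofReal, norm_pow, Complex.norm_I]
  simp

lemma hasTemperateGrowth_phase {p : Rn n → ℝ} (hp : p.HasTemperateGrowth) (s : ℝ) :
    (fun ξ => Complex.exp (Complex.I * ((s * p ξ : ℝ) : ℂ))).HasTemperateGrowth := by
  have h : (fun ξ => s * p ξ).HasTemperateGrowth := by fun_prop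
  exact hasTemperateGrowth_exp_I_mul.comp h

/-- The one-parameter group `exp(i s p(D))` on Schwartz functions, for a real symbol `p`. -/
noncomputable def phaseGroup (p : Rn n → ℝ) (s : ℝ) : 𝓢(Rn n, ℂ) →L[ℂ] 𝓢(Rn n, ℂ) :=
  fourierMultiplierCLM ℂ fun ξ => Complex.exp (Complex.I * ((s * p ξ : ℝ) : ℂ))

variable {p : Rn n → ℝ}

lemma fourier_phaseGroup (hp : p.HasTemperateGrowth) (s : ℝ) (φ : 𝓢(Rn n, ℂ)) (ξ : Rn n) :
    𝓕 (phaseGroup p s φ) ξ = Complex.exp (Complex.I * ((s * p ξ : ℝ) : ℂ)) * 𝓕 φ ξ :=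
  fourier_fourierMultiplierCLM_apply (hasTemperateGrowth_phase hp s) φ ξ

lemma norm_fourier_phaseGroup (hp : p.HasTemperateGrowth) (s : ℝ) (φ : 𝓢(Rn n, ℂ)) (ξ : Rn n) :
    ‖𝓕 (phaseGroup p s φ) ξ‖ = ‖𝓕 φ ξ‖ := by
  rw [fourier_phaseGroup hp, norm_mul, Complex.norm_exp_I_mul_ofReal, one_mul]

lemma norm_toLp_phaseGroup (hp : p.HasTemperateGrowth) (s : ℝ) (φ : 𝓢(Rn n, ℂ)) :
    ‖(phaseGroup p s φ).toLp 2 volume‖ = ‖φ.toLp 2 volume‖ := by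
  refine le_antisymm ?_ ?_
  · simpa using norm_toLp_two_le_of_norm_fourier_le (C := 1) (φ := phaseGroup p s φ) (ψ := φ)
      fun ξ => by rw [norm_fourier_phaseGroup hp, one_mul]
  · simpa using norm_toLp_two_le_of_norm_fourier_le (C := 1) (ψ := phaseGroup p s φ) (φ := φ)
      fun ξ => by rw [norm_fourier_phaseGroup hp, one_mul]

lemma phaseGroup_zero (hp : p.HasTemperateGrowth) (φ : 𝓢(Rn n, ℂ)) : phaseGroup p 0 φ = φ :=
  ext_of_fourier fun ξ => by rw [fourier_phaseGroup hp]; simp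

lemma phaseGroup_comm {q : Rn n → ℝ} (hp : p.HasTemperateGrowth) (hq : q.HasTemperateGrowth)
    (s t : ℝ) (φ : 𝓢(Rn n, ℂ)) :
    phaseGroup p s (phaseGroup q t φ) = phaseGroup q t (phaseGroup p s φ) :=
  ext_of_fourier fun ξ => by
    rw [fourier_phaseGroup hp, fourier_phaseGroup hq, fourier_phaseGroup hq,
      fourier_phaseGroup hp]
    ring

lemma inner_toLp_phaseGroup (hp : p.HasTemperateGrowth) (s t : ℝ) (φ ψ : 𝓢(Rn n, ℂ)) :
    inner ℂ ((phaseGroup p s φ).toLp 2 volume) ((phaseGroup p t ψ).toLp 2 volume) =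
      inner ℂ ((phaseGroup p (s - t) φ).toLp 2 volume) (ψ.toLp 2 volume) := by
  rw [← inner_fourier_toL2_eq (phaseGroup p s φ), ← inner_fourier_toL2_eq (phaseGroup p (s - t) φ),
    inner_toL2_toL2_eq _ _ volume, inner_toL2_toL2_eq _ _ volume]
  refine integral_congr_ae (Eventually.of_forall fun ξ => ?_)
  simp only [fourier_phaseGroup hp, RCLike.inner_apply, map_mul, ← Complex.exp_conj,
    Complex.conj_I, Complex.conj_ofReal]
  rw [show Complex.exp (-Complex.I * (((s - t) * p ξ : ℝ) : ℂ)) =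
    Complex.exp (-Complex.I * ((s * p ξ : ℝ) : ℂ)) * Complex.exp (Complex.I * ((t * p ξ : ℝ) : ℂ)) by
      rw [← Complex.exp_add]; congr 1; push_cast; ring]
  ring

lemma norm_exp_I_mul_sub_one_sub_le (x : ℝ) :
    ‖Complex.exp (Complex.I * x) - 1 - Complex.I * x‖ ≤ 3 * x ^ 2 := by
  by_cases hx : |x| ≤ 1
  · have h := Complex.norm_exp_sub_one_sub_id_le (x := Complex.I * x) (by simpa using hx)
    have h2 : ‖Complex.I * (x : ℂ)‖ ^ 2 = x ^ 2 := by simp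
    rw [h2] at h
    nlinarith [sq_nonneg x]
  · push Not at hx
    calc _ ≤ ‖Complex.exp (Complex.I * x)‖ + ‖(1 : ℂ)‖ + ‖Complex.I * (x : ℂ)‖ :=
          (norm_sub_le _ _).trans (add_le_add_left (norm_sub_le _ _) _)
      _ = 2 + |x| := by rw [Complex.norm_exp_I_mul_ofReal]; simp; norm_num
      _ ≤ 3 * x ^ 2 := by rw [← sq_abs]; nlinarith

/-- The derivative in `L²` of the group `exp(i s p(D))` is `i p(D) exp(i s p(D))`. -/
lemma hasDerivAt_toLp_phaseGroup (hp : p.HasTemperateGrowth) (φ : 𝓢(Rn n, ℂ)) (s : ℝ) :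
    HasDerivAt (fun s => (phaseGroup p s φ).toLp 2 volume)
      ((fourierMultiplierCLM ℂ (fun ξ => Complex.I * p ξ) (phaseGroup p s φ)).toLp 2 volume) s := by
  have hpc : (fun ξ => Complex.I * (p ξ : ℂ)).HasTemperateGrowth := by fun_prop
  have hp2 : (fun ξ => ((p ξ ^ 2 : ℝ) : ℂ)).HasTemperateGrowth := by fun_prop
  set N := ‖(fourierMultiplierCLM ℂ (fun ξ => ((p ξ ^ 2 : ℝ) : ℂ)) φ).toLp 2 volume‖ with hN
  rw [hasDerivAt_iff_isLittleO_nhds_zero]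
  have hO : (fun h : ℝ => (phaseGroup p (s + h) φ).toLp 2 volume - (phaseGroup p s φ).toLp 2 volume -
      h • ((fourierMultiplierCLM ℂ (fun ξ => Complex.I * p ξ) (phaseGroup p s φ)).toLp 2 volume))
      =O[𝓝 0] fun h : ℝ => h ^ 2 := by
    refine Asymptotics.IsBigO.of_bound (3 * N) (Eventually.of_forall fun h => ?_)
    have e : (phaseGroup p (s + h) φ).toLp 2 volume - (phaseGroup p s φ).toLp 2 volume -
      h • ((fourierMultiplierCLM ℂ (fun ξ => Complex.I * p ξ) (phaseGroup p s φ)).toLp 2 volume) =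
      (phaseGroup p (s + h) φ - phaseGroup p s φ - (h : ℂ) •
        fourierMultiplierCLM ℂ (fun ξ => Complex.I * p ξ) (phaseGroup p s φ)).toLp 2 volume := by
      simp only [← toLpCLM_apply (𝕜 := ℂ), map_sub, map_smul]
      congr 1
    rw [e, mul_right_comm, mul_comm 3, Real.norm_of_nonneg (sq_nonneg h), hN]
    have hfin := norm_toLp_two_le_of_norm_fourier_le (C := h ^ 2 * 3)
      (φ := phaseGroup p (s + h) φ - phaseGroup p s φ - (h : ℂ) •
        fourierMultiplierCLM ℂ (fun ξ => Complex.I * p ξ) (phaseGroup p s φ))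
      (ψ := fourierMultiplierCLM ℂ (fun ξ => ((p ξ ^ 2 : ℝ) : ℂ)) φ) fun ξ => by
        simp only [fourier_sub', FourierTransform.fourier_smul, sub_apply, smul_apply,
          fourier_phaseGroup hp, fourier_fourierMultiplierCLM_apply hpc,
          fourier_fourierMultiplierCLM_apply hp2, smul_eq_mul]
        have e2 : Complex.exp (Complex.I * (((s + h) * p ξ : ℝ) : ℂ)) * 𝓕 φ ξ -
            Complex.exp (Complex.I * ((s * p ξ : ℝ) : ℂ)) * 𝓕 φ ξ -
            (h : ℂ) * (Complex.I * p ξ * (Complex.exp (Complex.I * ((s * p ξ : ℝ) : ℂ)) * 𝓕 φ ξ)) =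
            Complex.exp (Complex.I * ((s * p ξ : ℝ) : ℂ)) *
              (Complex.exp (Complex.I * ((h * p ξ : ℝ) : ℂ)) - 1 - Complex.I * ((h * p ξ : ℝ) : ℂ)) *
              𝓕 φ ξ := by
          rw [show Complex.exp (Complex.I * (((s + h) * p ξ : ℝ) : ℂ)) =
            Complex.exp (Complex.I * ((s * p ξ : ℝ) : ℂ)) *
              Complex.exp (Complex.I * ((h * p ξ : ℝ) : ℂ)) by
            rw [← Complex.exp_add]; congr 1; push_cast; ring]
          push_cast; ring
        rw [e2, norm_mul, norm_mul, Complex.norm_exp_I_mul_ofReal, one_mul, norm_mul,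
          Complex.norm_real, Real.norm_of_nonneg (sq_nonneg _), ← mul_assoc]
        refine mul_le_mul_of_nonneg_right ?_ (norm_nonneg _)
        refine (norm_exp_I_mul_sub_one_sub_le _).trans_eq ?_
        ring
    refine hfin.trans_eq ?_
    ring
  exact hO.trans_isLittleO (by simpa using Asymptotics.isLittleO_pow_id (𝕜 := ℝ) (n := 2) (by norm_num))

lemma continuous_toLp_phaseGroup (hp : p.HasTemperateGrowth) (φ : 𝓢(Rn n, ℂ)) :
    Continuous (fun s => (phaseGroup p s φ).toLp 2 volume) :=
  continuous_iff_continuousAt.2 fun s => (hasDerivAt_toLp_phaseGroup hp φ s).continuousAt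

/-- The symbol `-2π²|ξ|²` of `Δ / 2`. -/
noncomputable def halfLaplacianSymbol (n : ℕ) (ξ : Rn n) : ℝ := -(2 * Real.pi ^ 2) * ‖ξ‖ ^ 2

lemma hasTemperateGrowth_halfLaplacianSymbol : (halfLaplacianSymbol n).HasTemperateGrowth := by
  unfold halfLaplacianSymbol; fun_prop

/-- The free Schrödinger group `exp(i a Δ / 2)` on Schwartz functions. -/
noncomputable def schrodinger (a : ℝ) : 𝓢(Rn n, ℂ) →L[ℂ] 𝓢(Rn n, ℂ) :=
  phaseGroup (halfLaplacianSymbol n) a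

lemma fourier_laplacian_apply (φ : 𝓢(Rn n, ℂ)) (ξ : Rn n) :
    𝓕 (Δ φ) ξ = -((2 * Real.pi * ‖ξ‖) ^ 2 : ℝ) * 𝓕 φ ξ := by
  have hq : (fun ξ : Rn n => ((‖ξ‖ ^ 2 : ℝ) : ℂ)).HasTemperateGrowth := by fun_prop
  have h1 : Δ φ = -((2 * Real.pi : ℝ) : ℂ) ^ 2 • fourierMultiplierCLM ℂ
      (fun ξ : Rn n => ((‖ξ‖ ^ 2 : ℝ) : ℂ)) φ := by
    rw [laplacian_eq_fourierMultiplierCLM, ← fourierMultiplierCLM_ofReal ℂ (by fun_prop)]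
    ext x
    simp [smul_apply]
  rw [h1, FourierTransform.fourier_smul]
  simp only [smul_apply, fourier_fourierMultiplierCLM_apply hq, smul_eq_mul]
  push_cast; ring

lemma fourierMultiplierCLM_I_mul_halfLaplacianSymbol (φ : 𝓢(Rn n, ℂ)) :
    fourierMultiplierCLM ℂ (fun ξ => Complex.I * halfLaplacianSymbol n ξ) φ =
      (Complex.I / 2) • Δ φ := by
  have hpc : (fun ξ : Rn n => Complex.I * (halfLaplacianSymbol n ξ : ℂ)).HasTemperateGrowth := by
    have := hasTemperateGrowth_halfLaplacianSymbol (n := n)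
    fun_prop
  refine ext_of_fourier fun ξ => ?_
  rw [fourier_fourierMultiplierCLM_apply hpc, FourierTransform.fourier_smul, smul_apply,
    fourier_laplacian_apply, halfLaplacianSymbol, smul_eq_mul]
  push_cast; ring

lemma hasDerivAt_toLp_schrodinger (φ : 𝓢(Rn n, ℂ)) (a : ℝ) :
    HasDerivAt (fun a => (schrodinger a φ).toLp 2 volume)
      ((Complex.I / 2) • (Δ (schrodinger a φ)).toLp 2 volume) a := by
  have h := hasDerivAt_toLp_phaseGroup hasTemperateGrowth_halfLaplacianSymbol φ a
  rw [fourierMultiplierCLM_I_mul_halfLaplacianSymbol] at h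
  exact h

/-- The Schrödinger group is symmetric for the bilinear pairing, its symbol being even. -/
lemma integral_schrodinger_mul (a : ℝ) (φ ψ : 𝓢(Rn n, ℂ)) :
    ∫ x, schrodinger a φ x * ψ x = ∫ x, φ x * schrodinger a ψ x :=
  integral_fourierMultiplierCLM_mul
    (hasTemperateGrowth_phase hasTemperateGrowth_halfLaplacianSymbol a)
    (fun ξ => by simp [halfLaplacianSymbol]) φ ψ

/-- The dispersive estimate `L¹ → L^∞`: the kernel of `exp(i a Δ / 2)` is a limit of Gaussians. -/
lemma norm_schrodinger_apply_le {a : ℝ} (ha : a ≠ 0) (φ : 𝓢(Rn n, ℂ)) (x : Rn n) :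
    ‖schrodinger a φ x‖ ≤ |a| ^ (-(n / 2 : ℝ)) * ∫ y, ‖φ y‖ := by
  have ha0 : 0 < |a| := abs_pos.2 ha
  set c : ℝ := 2 * Real.pi ^ 2 * a with hc
  -- the oscillating Gaussian of parameter `c i` is regularized by a real part `1 / (j + 1)`
  set b : ℕ → ℂ := fun j => ((1 / ((j : ℝ) + 1) : ℝ) : ℂ) + (c : ℂ) * Complex.I with hb
  have hbre : ∀ j, 0 < (b j).re := fun j => by
    simp only [hb, Complex.add_re, Complex.ofReal_re, Complex.mul_re, Complex.I_re,
      Complex.ofReal_im, Complex.I_im, mul_zero, zero_mul, sub_zero, add_zero]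
    positivity
  have hbim : ∀ j, (b j).im = c := fun j => by
    simp only [hb, Complex.add_im, Complex.ofReal_re, Complex.mul_im, Complex.I_re,
      Complex.ofReal_im, Complex.I_im, mul_zero, mul_one, zero_add, add_zero]
  have hblim : Tendsto b atTop (𝓝 ((c : ℂ) * Complex.I)) := by
    have h1 : Tendsto (fun j : ℕ => ((1 / ((j : ℝ) + 1) : ℝ) : ℂ)) atTop (𝓝 ((0 : ℝ) : ℂ)) :=
      (Complex.continuous_ofReal.tendsto _).comp tendsto_one_div_add_atTop_nhds_zero_nat
    have h2 := h1.add_const ((c : ℂ) * Complex.I)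
    rwa [Complex.ofReal_zero, zero_add] at h2
  set h : ℕ → Rn n → ℂ := fun j v =>
    Complex.exp (-(b j) * ‖v‖ ^ 2 + 2 * Real.pi * Complex.I * inner ℝ x v) with hh
  have hhint : ∀ j, Integrable (h j) := fun j =>
    GaussianFourier.integrable_cexp_neg_mul_sq_norm_add (hbre j) (2 * Real.pi * Complex.I) x
  have hval : schrodinger a φ x = ∫ v, Complex.exp (-((c : ℂ) * Complex.I) *
      ‖v‖ ^ 2 + 2 * Real.pi * Complex.I * inner ℝ x v) * 𝓕 φ v := by
    have h1 : schrodinger a φ x = 𝓕⁻ (𝓕 (schrodinger a φ)) x := by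
      rw [FourierTransform.fourierInv_fourier_eq]
    rw [h1, fourierInv_coe, Real.fourierInv_eq']
    refine integral_congr_ae (Eventually.of_forall fun v => ?_)
    simp only [schrodinger, fourier_phaseGroup hasTemperateGrowth_halfLaplacianSymbol, smul_eq_mul,
      halfLaplacianSymbol, ← mul_assoc, ← Complex.exp_add]
    congr 2
    rw [real_inner_comm, hc]
    push_cast; ring
  have hlim : Tendsto (fun j => ∫ v, h j v * 𝓕 φ v) atTop (𝓝 (schrodinger a φ x)) := by
    rw [hval]
    refine tendsto_integral_of_dominated_convergence (fun v => ‖𝓕 φ v‖)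
      (fun j => (hhint j).aestronglyMeasurable.mul (𝓕 φ).continuous.aestronglyMeasurable)
      (𝓕 φ).integrable.norm (fun j => Eventually.of_forall fun v => ?_)
      (Eventually.of_forall fun v => ?_)
    · rw [norm_mul, hh, Complex.norm_exp]
      refine mul_le_of_le_one_left (norm_nonneg _) (Real.exp_le_one_iff.2 ?_)
      have e1 : (-(b j) * (‖v‖ : ℂ) ^ 2 + 2 * Real.pi * Complex.I * (inner ℝ x v : ℝ)).re =
          -(b j).re * ‖v‖ ^ 2 := by
        rw [← Complex.ofReal_pow]
        simp only [Complex.add_re, Complex.neg_re, Complex.mul_re, Complex.ofReal_re,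
          Complex.ofReal_im, Complex.I_re, Complex.I_im, Complex.re_ofNat, Complex.im_ofNat,
          Complex.mul_im]
        ring
      rw [e1]
      have := hbre j
      have := sq_nonneg ‖v‖
      nlinarith
    · refine Tendsto.mul_const _ ?_
      refine (Complex.continuous_exp.tendsto _).comp ?_
      exact (hblim.neg.mul_const _).add_const _
  have hbd : ∀ j, ‖∫ v, h j v * 𝓕 φ v‖ ≤ |a| ^ (-(n / 2 : ℝ)) * ∫ y, ‖φ y‖ := by
    intro j
    have hb0 : b j ≠ 0 := fun h0 => by have := hbre j; rw [h0] at this; simp at this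
    have hflip : ∫ v, h j v * 𝓕 φ v = ∫ v, 𝓕 (h j) v * φ v := by
      have := VectorFourier.integral_fourierIntegral_smul_eq_flip (μ := (volume : Measure (Rn n)))
        (ν := (volume : Measure (Rn n))) (L := innerₗ (Rn n)) (e := Real.fourierChar)
        Real.continuous_fourierChar continuous_inner (hhint j) φ.integrable
      rw [flip_innerₗ] at this
      exact this.symm
    rw [hflip, ← integral_const_mul]
    refine norm_integral_le_of_norm_le (φ.integrable.norm.const_mul _)
      (Eventually.of_forall fun w => ?_)
    rw [norm_mul]
    refine mul_le_mul_of_nonneg_right ?_ (norm_nonneg _)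
    rw [hh, fourier_gaussian_innerProductSpace' (hbre j), norm_mul, finrank_euclideanSpace_fin]
    have e1 : ‖Complex.exp (-(Real.pi : ℂ) ^ 2 * (‖x - w‖ : ℂ) ^ 2 / b j)‖ ≤ 1 := by
      rw [Complex.norm_exp, Real.exp_le_one_iff]
      have : (-(Real.pi : ℂ) ^ 2 * (‖x - w‖ : ℂ) ^ 2 / b j).re =
          -(Real.pi ^ 2 * ‖x - w‖ ^ 2) * ((b j)⁻¹).re := by
        rw [div_eq_mul_inv, ← Complex.re_ofReal_mul]
        push_cast; ring_nf
      rw [this, Complex.inv_re]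
      have h1 : 0 ≤ (b j).re / Complex.normSq (b j) :=
        div_nonneg (hbre j).le (Complex.normSq_nonneg _)
      have h2 : 0 ≤ Real.pi ^ 2 * ‖x - w‖ ^ 2 := by positivity
      nlinarith
    have e2 : ‖((Real.pi : ℂ) / b j) ^ ((n : ℂ) / 2)‖ ≤ |a| ^ (-(n / 2 : ℝ)) := by
      rw [show ((n : ℂ) / 2) = ((n / 2 : ℝ) : ℂ) by push_cast; rfl, Complex.norm_cpow_real,
        norm_div, Complex.norm_real, Real.norm_of_nonneg Real.pi_pos.le, Real.rpow_neg ha0.le,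
        ← Real.inv_rpow ha0.le]
      refine Real.rpow_le_rpow (by positivity) ?_ (by positivity)
      rw [div_le_iff₀ (norm_pos_iff.2 hb0)]
      have h3 : |(b j).im| ≤ ‖b j‖ := Complex.abs_im_le_norm _
      rw [hbim, hc, abs_mul, abs_of_nonneg (by positivity : (0 : ℝ) ≤ 2 * Real.pi ^ 2)] at h3
      have h4 : |a|⁻¹ * (2 * Real.pi ^ 2 * |a|) = 2 * Real.pi ^ 2 := by field_simp
      have h5 : |a|⁻¹ * (2 * Real.pi ^ 2 * |a|) ≤ |a|⁻¹ * ‖b j‖ :=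
        mul_le_mul_of_nonneg_left h3 (by positivity)
      rw [h4] at h5
      nlinarith [Real.pi_gt_three]
    calc _ ≤ |a| ^ (-(n / 2 : ℝ)) * 1 := mul_le_mul e2 e1 (norm_nonneg _) (by positivity)
      _ = _ := mul_one _
  exact le_of_tendsto' hlim.norm hbd

/-- The dispersive estimate `L^{r'} → L^r` for the Schrödinger group. -/
theorem eLpNorm_schrodinger_le {r r' : ℝ} (hr : 2 < r) (hrr : r.HolderConjugate r') {a : ℝ}
    (ha : a ≠ 0) (φ : 𝓢(Rn n, ℂ)) :
    eLpNorm (schrodinger a φ) (ENNReal.ofReal r) volume ≤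
      ENNReal.ofReal (|a| ^ (-((n / 2 : ℝ) * (1 - 2 / r)))) *
        eLpNorm φ (ENNReal.ofReal r') volume := by
  have ha0 : 0 < |a| := abs_pos.2 ha
  have h := eLpNorm_le_of_interpolation hr hrr (T := (schrodinger (n := n) a).toLinearMap)
    (A := |a| ^ (-(n / 2 : ℝ)))
    (fun φ => (norm_toLp_phaseGroup hasTemperateGrowth_halfLaplacianSymbol a φ).le)
    (by positivity) (fun φ x => ?_) φ
  · rw [← Real.rpow_mul ha0.le] at h
    convert! h using 4
    ring
  · rw [← ofReal_norm, eLpNorm_one_eq_lintegral_enorm]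
    simp_rw [← ofReal_norm]
    rw [← ofReal_integral_eq_lintegral_ofReal φ.integrable.norm
      (Eventually.of_forall fun _ => norm_nonneg _), ← ENNReal.ofReal_mul (by positivity)]
    exact ENNReal.ofReal_le_ofReal (norm_schrodinger_apply_le ha φ x)

/-- The Fourier transform as a linear map of Schwartz functions. -/
noncomputable def fourierLinear (n : ℕ) : 𝓢(Rn n, ℂ) →ₗ[ℂ] 𝓢(Rn n, ℂ) :=
  (fourierTransformCLM ℂ (V := Rn n) (E := ℂ)).toLinearMap

/-- The Hausdorff–Young inequality for Schwartz functions. -/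
theorem eLpNorm_fourier_le {r r' : ℝ} (hr : 2 < r) (hrr : r.HolderConjugate r') (φ : 𝓢(Rn n, ℂ)) :
    eLpNorm (𝓕 φ : 𝓢(Rn n, ℂ)) (ENNReal.ofReal r) volume ≤ eLpNorm φ (ENNReal.ofReal r') volume := by
  have h := eLpNorm_le_of_interpolation hr hrr (n := n)
    (T := (fourierLinear n)) (A := 1)
    (fun φ => (norm_fourier_toL2_eq φ).le) one_pos (fun φ x => ?_) φ
  · rwa [Real.one_rpow, ENNReal.ofReal_one, one_mul] at h
  · rw [ENNReal.ofReal_one, one_mul, ← ofReal_norm, eLpNorm_one_eq_lintegral_enorm]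
    simp_rw [← ofReal_norm]
    rw [← ofReal_integral_eq_lintegral_ofReal φ.integrable.norm
      (Eventually.of_forall fun _ => norm_nonneg _)]
    refine ENNReal.ofReal_le_ofReal ?_
    have := norm_fourier_apply_le_toLp_one φ x
    rwa [norm_toLp_one] at this

end SchwartzMap

end

section

/-! ### Semiclassical Lebesgue norms and Sobolev inequalities -/

/-- The decay rate `δ = (n / 2) (1 - 2 / r)` of the Schrödinger group from `L^{r'}` to `L^r`. -/
noncomputable def decayRate (n : ℕ) (r : ℝ) : ℝ := (n / 2 : ℝ) * (1 - 2 / r)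

/-- The scale invariant norm `ε^δ ‖f‖_{L^r}`, where `δ = decayRate n r`. -/
noncomputable def scLpNorm {n : ℕ} (r ε : ℝ) (f : Rn n → ℂ) : ℝ≥0∞ :=
  ENNReal.ofReal (ε ^ decayRate n r) * eLpNorm f (ENNReal.ofReal r) volume

/-- The norm `ε^{-δ} ‖f‖_{L^{r'}}` dual to `scLpNorm`. -/
noncomputable def scDualNorm {n : ℕ} (r ε : ℝ) (f : Rn n → ℂ) : ℝ≥0∞ :=
  ENNReal.ofReal (ε ^ (-decayRate n r)) *
    eLpNorm f (ENNReal.ofReal (Real.conjExponent r)) volume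

lemma holderConjugate_conjExponent {r : ℝ} (hr : 2 < r) :
    r.HolderConjugate (Real.conjExponent r) :=
  Real.HolderConjugate.conjExponent (by linarith)

lemma decayRate_pos {n : ℕ} (hn : 1 ≤ n) {r : ℝ} (hr : 2 < r) : 0 < decayRate n r := by
  have h1 : 2 / r < 1 := (div_lt_one (by linarith)).2 hr
  have h2 : (0 : ℝ) < n := by exact_mod_cast hn
  unfold decayRate
  have : 0 < 1 - 2 / r := by linarith
  positivity

lemma decayRate_eq (n : ℕ) (r : ℝ) : decayRate n r = n * (1 / 2 - 1 / r) := by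
  unfold decayRate; ring

lemma ofReal_rpow_mul_ofReal_rpow_neg {ε : ℝ} (hε : 0 < ε) (d : ℝ) :
    ENNReal.ofReal (ε ^ d) * ENNReal.ofReal (ε ^ (-d)) = 1 := by
  rw [← ENNReal.ofReal_mul (by positivity), ← Real.rpow_add hε, add_neg_cancel, Real.rpow_zero,
    ENNReal.ofReal_one]

variable {n : ℕ} {r ε : ℝ}

lemma enorm_integral_mul_le_scNorm (hr : 2 < r) (hε : 0 < ε) {f g : Rn n → ℂ}
    (hf : AEStronglyMeasurable f volume) (hg : AEStronglyMeasurable g volume) :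
    ‖∫ x, f x * g x‖ₑ ≤ scLpNorm r ε f * scDualNorm r ε g := by
  have := holderConjugate_ofReal (holderConjugate_conjExponent hr)
  refine (enorm_integral_mul_le (p := ENNReal.ofReal r)
    (q := ENNReal.ofReal (Real.conjExponent r)) hf hg).trans_eq ?_
  rw [scLpNorm, scDualNorm, mul_mul_mul_comm, ofReal_rpow_mul_ofReal_rpow_neg hε, one_mul]

lemma scLpNorm_le_of_forall_schwartz (hr : 2 < r) (hε : 0 < ε) {h : Rn n → ℂ}
    (hh : LocallyIntegrable h) {C : ℝ≥0∞}
    (H : ∀ φ : 𝓢(Rn n, ℂ), ‖∫ x, h x * φ x‖ₑ ≤ C * scDualNorm r ε φ) : scLpNorm r ε h ≤ C := by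
  have h1 := eLpNorm_le_of_forall_schwartz hr.le (holderConjugate_conjExponent hr) hh
    (C := C * ENNReal.ofReal (ε ^ (-decayRate n r))) fun φ => by
      rw [mul_assoc]; exact H φ
  calc scLpNorm r ε h ≤ ENNReal.ofReal (ε ^ decayRate n r) *
        (C * ENNReal.ofReal (ε ^ (-decayRate n r))) := by unfold scLpNorm; gcongr
    _ = C := by rw [mul_left_comm, ofReal_rpow_mul_ofReal_rpow_neg hε, mul_one]

lemma scLpNorm_lp_le_of_forall_schwartz (hr : 2 < r) (hε : 0 < ε) (h : L2 n) {C : ℝ≥0∞}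
    (H : ∀ φ : 𝓢(Rn n, ℂ), ‖∫ x, h x * φ x‖ₑ ≤ C * scDualNorm r ε φ) : scLpNorm r ε h ≤ C :=
  scLpNorm_le_of_forall_schwartz hr hε
    ((Lp.memLp h).locallyIntegrable (by norm_num)) H

lemma scDualNorm_schwartz_ne_top (φ : 𝓢(Rn n, ℂ)) : scDualNorm r ε φ ≠ ⊤ :=
  ENNReal.mul_ne_top ENNReal.ofReal_ne_top (φ.eLpNorm_lt_top _ volume).ne

lemma scLpNorm_schwartz_ne_top (φ : 𝓢(Rn n, ℂ)) : scLpNorm r ε φ ≠ ⊤ :=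
  ENNReal.mul_ne_top ENNReal.ofReal_ne_top (φ.eLpNorm_lt_top _ volume).ne

lemma scLpNorm_add_le (hr : 2 < r) {f g : Rn n → ℂ} (hf : AEStronglyMeasurable f volume)
    (hg : AEStronglyMeasurable g volume) :
    scLpNorm r ε (f + g) ≤ scLpNorm r ε f + scLpNorm r ε g := by
  unfold scLpNorm
  rw [← mul_add]
  gcongr
  exact eLpNorm_add_le hf hg (by rw [← ENNReal.ofReal_one]; exact ENNReal.ofReal_le_ofReal (by linarith))

lemma scLpNorm_sub_le (hr : 2 < r) {f g : Rn n → ℂ} (hf : AEStronglyMeasurable f volume)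
    (hg : AEStronglyMeasurable g volume) :
    scLpNorm r ε (f - g) ≤ scLpNorm r ε f + scLpNorm r ε g := by
  unfold scLpNorm
  rw [← mul_add]
  gcongr
  exact eLpNorm_sub_le hf hg (by rw [← ENNReal.ofReal_one]; exact ENNReal.ofReal_le_ofReal (by linarith))

lemma scLpNorm_congr_ae {f g : Rn n → ℂ} (h : f =ᵐ[volume] g) : scLpNorm r ε f = scLpNorm r ε g := by
  unfold scLpNorm; rw [eLpNorm_congr_ae h]

/-- The dispersive estimate in semiclassical scaling. -/
lemma scLpNorm_schrodinger_le (hr : 2 < r) (hε : 0 < ε) {s : ℝ} (hs : s ≠ 0) (φ : 𝓢(Rn n, ℂ)) :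
    scLpNorm r ε (SchwartzMap.schrodinger (ε ^ 2 * s) φ) ≤
      rieszKernel (decayRate n r) s * scDualNorm r ε φ := by
  have h := SchwartzMap.eLpNorm_schrodinger_le hr (holderConjugate_conjExponent hr)
    (mul_ne_zero (pow_ne_zero 2 hε.ne') hs) φ
  have hs0 : 0 < |s| := abs_pos.2 hs
  change _ ≤ ENNReal.ofReal (|ε ^ 2 * s| ^ (-decayRate n r)) * _ at h
  unfold scLpNorm scDualNorm rieszKernel
  refine (mul_le_mul_right h _).trans_eq ?_
  rw [← mul_assoc, ← mul_assoc, ← ENNReal.ofReal_mul (by positivity),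
    ← ENNReal.ofReal_mul (by positivity), abs_mul, abs_of_pos (by positivity : 0 < ε ^ 2),
    Real.mul_rpow (by positivity) hs0.le]
  congr 2
  rw [← Real.rpow_natCast ε 2, ← Real.rpow_mul hε.le, mul_comm (|s| ^ (-decayRate n r)), ← mul_assoc,
    ← Real.rpow_add hε]
  congr 2
  push_cast; ring

/-- `g` is the distributional gradient of `f`, tested against Schwartz functions. -/
def HasWeakGradient (f : L2 n) (g : Fin n → L2 n) : Prop :=
  ∀ i, ∀ χ : 𝓢(Rn n, ℂ), ∫ x, g i x * χ x =
    -∫ x, f x * (∂_{(EuclideanSpace.single i (1 : ℝ) : Rn n)} χ) x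

lemma H1.hasWeakGradient (f : H1 n) : HasWeakGradient (H1.fn f) (fun i => H1.grad f i) := by
  intro i χ
  have h := DFunLike.congr_fun (f.2 i) χ
  rw [TemperedDistribution.lineDerivOp_apply_apply, Lp.toTemperedDistribution_apply,
    Lp.toTemperedDistribution_apply] at h
  simp only [smul_eq_mul, neg_apply, neg_mul, integral_neg] at h
  change -∫ x, _ * H1.fn f x = ∫ x, χ x * H1.grad f i x at h
  simp_rw [mul_comm (χ _), mul_comm _ (H1.fn f _)] at h
  exact h.symm

lemma eLpNorm_comp_const_smul {E : Type*} [NormedAddCommGroup E] (f : Rn n → E) {c : ℝ} (hc : 0 < c)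
    {p : ℝ} (hp : 0 < p) : eLpNorm (fun x => f (c • x)) (ENNReal.ofReal p) volume =
      ENNReal.ofReal (c ^ (-(n / p : ℝ))) * eLpNorm f (ENNReal.ofReal p) volume := by
  have h := (MeasurableEquiv.smul₀ c hc.ne' : Rn n ≃ᵐ Rn n).measurableEmbedding.eLpNorm_map_measure
    (g := f) (μ := volume) (p := ENNReal.ofReal p)
  rw [MeasurableEquiv.coe_smul₀, Measure.map_addHaar_smul volume hc.ne',
    eLpNorm_smul_measure_of_ne_top ENNReal.ofReal_ne_top] at h
  refine h.symm.trans ?_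
  rw [smul_eq_mul, finrank_euclideanSpace_fin, abs_of_pos (by positivity), one_div,
    ENNReal.toReal_inv, ENNReal.toReal_ofReal hp.le, ENNReal.ofReal_rpow_of_pos (by positivity),
    Real.inv_rpow (by positivity), ← Real.rpow_natCast, ← Real.rpow_mul hc.le, Real.rpow_neg hc.le,
    div_eq_mul_inv]

lemma hasTemperateGrowth_bracket (c s : ℝ) :
    (fun ξ : Rn n => (1 + ‖c • ξ‖ ^ 2) ^ s).HasTemperateGrowth := by
  have h : (fun ξ : Rn n => c • ξ).HasTemperateGrowth :=
    (c • ContinuousLinearMap.id ℝ (Rn n)).hasTemperateGrowth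
  exact (Function.hasTemperateGrowth_one_add_norm_sq_rpow (Rn n) s).comp h

/-- The `L^κ` norm of `⟨2πεξ⟩^{-(1 + δ) / 2}`, where `1/κ = 1/2 - 1/r`, is a multiple of `ε^{-δ}`. -/
lemma exists_eLpNorm_bracket_eq (hn : 1 ≤ n) (hr : 2 < r) (hδ : decayRate n r < 1) :
    ∃ C : ℝ, 0 ≤ C ∧ ∀ ε : ℝ, 0 < ε →
      eLpNorm (fun ξ : Rn n => (1 + ‖(2 * Real.pi * ε) • ξ‖ ^ 2) ^ (-((1 + decayRate n r) / 4)))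
        (ENNReal.ofReal (1 / 2 - 1 / r)⁻¹) volume ≤ ENNReal.ofReal (C * ε ^ (-decayRate n r)) := by
  set δ := decayRate n r with hδd
  set κ := (1 / 2 - 1 / r)⁻¹ with hκ
  have hr0 : 0 < r := by linarith
  have hpos : 0 < 1 / 2 - 1 / r := by
    rw [sub_pos]; exact one_div_lt_one_div_of_lt (by norm_num) hr
  have hκ0 : 0 < κ := inv_pos.2 hpos
  have hn0 : (0 : ℝ) < n := by exact_mod_cast hn
  have hnκ : (n : ℝ) / κ = δ := by rw [hδd, decayRate_eq, hκ, div_inv_eq_mul]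
  have hmem : MemLp (fun ξ : Rn n => (1 + ‖ξ‖ ^ 2) ^ (-((1 + δ) / 4))) (ENNReal.ofReal κ) volume := by
    have hcont : Continuous (fun ξ : Rn n => (1 + ‖ξ‖ ^ 2) ^ (-((1 + δ) / 4))) :=
      Continuous.rpow_const (by fun_prop) fun ξ => Or.inl (by positivity)
    rw [← integrable_norm_rpow_iff hcont.aestronglyMeasurable (by simpa using hκ0)
      ENNReal.ofReal_ne_top, ENNReal.toReal_ofReal hκ0.le]
    have h := integrable_rpow_neg_one_add_norm_sq (E := Rn n) (μ := volume) (r := (1 + δ) / 2 * κ) (by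
      rw [finrank_euclideanSpace_fin]
      have : (n : ℝ) = δ * κ := by rw [← hnκ]; field_simp
      rw [this]
      exact mul_lt_mul_of_pos_right (by linarith) hκ0)
    refine h.congr (Eventually.of_forall fun ξ => ?_)
    have h0 : 0 ≤ (1 + ‖ξ‖ ^ 2 : ℝ) := by positivity
    simp only
    rw [Real.norm_of_nonneg (Real.rpow_nonneg h0 _), ← Real.rpow_mul h0]
    congr 1; ring
  refine ⟨(2 * Real.pi) ^ (-δ) * (eLpNorm (fun ξ : Rn n => (1 + ‖ξ‖ ^ 2) ^ (-((1 + δ) / 4)))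
    (ENNReal.ofReal κ) volume).toReal, by positivity, fun ε hε => ?_⟩
  rw [eLpNorm_comp_const_smul (fun ξ : Rn n => (1 + ‖ξ‖ ^ 2) ^ (-((1 + δ) / 4)))
    (by positivity : 0 < 2 * Real.pi * ε) hκ0, hnκ, Real.mul_rpow (by positivity) hε.le, mul_right_comm,
    ENNReal.ofReal_mul (by positivity : 0 ≤ (2 * Real.pi) ^ (-δ) * ε ^ (-δ)),
    ENNReal.ofReal_toReal hmem.2.ne]

namespace SchwartzMap

open FourierTransform

lemma norm_fourier_lineDeriv_single (φ : 𝓢(Rn n, ℂ)) (i : Fin n) (ξ : Rn n) :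
    ‖𝓕 (∂_{(EuclideanSpace.single i (1 : ℝ) : Rn n)} φ) ξ‖ ≤ 2 * Real.pi * ‖ξ‖ * ‖𝓕 φ ξ‖ := by
  have h : (inner ℝ · (EuclideanSpace.single i (1 : ℝ) : Rn n) : Rn n → ℝ).HasTemperateGrowth := by
    fun_prop
  rw [fourier_lineDerivOp_eq, smul_apply, smulLeftCLM_apply_apply h, norm_smul, norm_smul]
  have h1 : ‖(2 * Real.pi * Complex.I : ℂ)‖ = 2 * Real.pi := by
    simp [abs_of_pos Real.pi_pos]
  have h2 : ‖inner ℝ ξ (EuclideanSpace.single i (1 : ℝ) : Rn n)‖ ≤ ‖ξ‖ := by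
    refine (norm_inner_le_norm _ _).trans ?_
    simp
  rw [h1, mul_assoc (2 * Real.pi)]
  gcongr

/-- A Fourier multiplier dominated by a weight in `L^κ`, `1 / κ = 1 / 2 - 1 / r`, maps `L^{r'}` to
`L²`, by Plancherel, Hölder and Hausdorff–Young. -/
lemma norm_toLp_two_le_of_eLpNorm {κ : ℝ} (hr : 2 < r) {φ χ : 𝓢(Rn n, ℂ)} {w : Rn n → ℝ}
    (hκ : κ = (1 / 2 - 1 / r)⁻¹) (hw : Continuous w) {B : ℝ}
    (h : ∀ ξ, ‖𝓕 χ ξ‖ ≤ B * (‖w ξ‖ * ‖𝓕 φ ξ‖)) :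
    ENNReal.ofReal ‖χ.toLp 2 volume‖ ≤ ENNReal.ofReal B * (eLpNorm w (ENNReal.ofReal κ) volume *
      eLpNorm φ (ENNReal.ofReal (Real.conjExponent r)) volume) := by
  have hr0 : 0 < r := by linarith
  have hpos : 0 < 1 / 2 - 1 / r := by
    rw [sub_pos]; exact one_div_lt_one_div_of_lt (by norm_num) hr
  have hT : ENNReal.HolderTriple (ENNReal.ofReal κ) (ENNReal.ofReal r) 2 := ⟨by
    rw [hκ, ← ENNReal.ofReal_inv_of_pos (inv_pos.2 hpos), ← ENNReal.ofReal_inv_of_pos hr0, inv_inv,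
      ← ENNReal.ofReal_add hpos.le (by positivity), ← one_div r, sub_add_cancel]
    rw [one_div, ENNReal.ofReal_inv_of_pos (by norm_num)]
    simp⟩
  have h1 : eLpNorm (𝓕 χ : 𝓢(Rn n, ℂ)) 2 volume ≤
      ENNReal.ofReal B * eLpNorm (w • (⇑(𝓕 φ : 𝓢(Rn n, ℂ)))) 2 volume := by
    refine eLpNorm_le_mul_eLpNorm_of_ae_le_mul (Eventually.of_forall fun ξ => ?_) 2
    simpa [norm_smul] using h ξ
  have h2 := eLpNorm_smul_le_mul_eLpNorm (r := 2) (𝓕 φ : 𝓢(Rn n, ℂ)).continuous.aestronglyMeasurable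
    (μ := (volume : Measure (Rn n))) hw.aestronglyMeasurable (hpqr := hT)
  have h3 := eLpNorm_fourier_le hr (holderConjugate_conjExponent hr) φ
  rw [← norm_fourier_toL2_eq χ, ← eLpNorm_toLp_two]
  refine h1.trans ?_
  gcongr
  refine h2.trans ?_
  gcongr

end SchwartzMap

lemma integral_mul_laplacian {f : L2 n} {g : Fin n → L2 n} (hfg : HasWeakGradient f g)
    (ψ : 𝓢(Rn n, ℂ)) : ∫ x, f x * (Δ ψ) x =
      -∑ i, ∫ x, g i x * (∂_{(EuclideanSpace.single i (1 : ℝ) : Rn n)} ψ) x := by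
  set L : 𝓢(Rn n, ℂ) →L[ℂ] ℂ := (l2Pair f).comp (SchwartzMap.toLpCLM ℂ ℂ 2 volume) with hL
  have hLa : ∀ χ : 𝓢(Rn n, ℂ), L χ = ∫ x, f x * χ x := fun χ => l2Pair_toLp f χ
  rw [← hLa, SchwartzMap.laplacian_eq_sum (EuclideanSpace.basisFun (Fin n) ℝ), map_sum,
    ← Finset.sum_neg_distrib]
  refine Finset.sum_congr rfl fun i _ => ?_
  rw [hfg, hLa, neg_neg, EuclideanSpace.basisFun_apply]

/-- The operator `1 - ε² Δ`, integrated by parts once, is bounded by the semiclassical `H¹` norms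
of both functions. -/
lemma norm_integral_sub_laplacian_le {f : L2 n} {g : Fin n → L2 n} (hfg : HasWeakGradient f g)
    {M : ℝ} (hf : ‖f‖ ≤ M) (hε : 0 < ε) (hg : ∀ i, ε * ‖g i‖ ≤ M) (ψ : 𝓢(Rn n, ℂ)) {X : ℝ}
    (hψ : ‖ψ.toLp 2 volume‖ ≤ X)
    (hψ' : ∀ i, ε * ‖(∂_{(EuclideanSpace.single i (1 : ℝ) : Rn n)} ψ).toLp 2 volume‖ ≤ X) :
    ‖∫ x, f x * (ψ - ((ε : ℂ) ^ 2) • Δ ψ) x‖ ≤ (1 + n) * M * X := by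
  have hM : 0 ≤ M := (norm_nonneg _).trans hf
  set L : 𝓢(Rn n, ℂ) →L[ℂ] ℂ := (l2Pair f).comp (SchwartzMap.toLpCLM ℂ ℂ 2 volume) with hL
  have hLa : ∀ χ : 𝓢(Rn n, ℂ), L χ = ∫ x, f x * χ x := fun χ => l2Pair_toLp f χ
  have e1 : L (Δ ψ) = -∑ i, ∫ x, g i x * (∂_{(EuclideanSpace.single i (1 : ℝ) : Rn n)} ψ) x :=
    (hLa _).trans (integral_mul_laplacian hfg ψ)
  rw [← hLa, map_sub, map_smul, e1, smul_neg, sub_neg_eq_add, hLa, smul_eq_mul]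
  refine (norm_add_le _ _).trans ?_
  have h1 : ‖∫ x, f x * ψ x‖ ≤ M * X :=
    (norm_integral_mul_schwartz_le f ψ).trans (mul_le_mul hf hψ (norm_nonneg _) hM)
  have h2 : ‖(ε : ℂ) ^ 2 *
      ∑ i, ∫ x, g i x * (∂_{(EuclideanSpace.single i (1 : ℝ) : Rn n)} ψ) x‖ ≤ n * (M * X) := by
    rw [Finset.mul_sum]
    refine (norm_sum_le _ _).trans ?_
    refine (Finset.sum_le_card_nsmul _ _ (M * X) fun i _ => ?_).trans_eq (by simp)
    rw [norm_mul, norm_pow, Complex.norm_real, Real.norm_of_nonneg hε.le]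
    calc _ ≤ ε ^ 2 * (‖g i‖ *
          ‖(∂_{(EuclideanSpace.single i (1 : ℝ) : Rn n)} ψ).toLp 2 volume‖) := by
          gcongr; exact norm_integral_mul_schwartz_le _ _
      _ = (ε * ‖g i‖) *
          (ε * ‖(∂_{(EuclideanSpace.single i (1 : ℝ) : Rn n)} ψ).toLp 2 volume‖) := by ring
      _ ≤ M * X := mul_le_mul (hg i) (hψ' i) (by positivity) hM
  linarith

/-- Sobolev's inequality in semiclassical form, with a Fourier multiplier of order less than
`(1 - δ) / 2`. -/
theorem exists_norm_integral_mul_multiplier_le (hn : 1 ≤ n) (hr : 2 < r) (hδ : decayRate n r < 1) :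
    ∃ C : ℝ, 0 ≤ C ∧ ∀ ε : ℝ, 0 < ε → ∀ (f : L2 n) (g : Fin n → L2 n), HasWeakGradient f g →
      ∀ M, ‖f‖ ≤ M → (∀ i, ε * ‖g i‖ ≤ M) → ∀ m : Rn n → ℂ, m.HasTemperateGrowth → ∀ B : ℝ, 0 ≤ B →
      (∀ ξ, ‖m ξ‖ ≤ B * (1 + ‖(2 * Real.pi * ε) • ξ‖ ^ 2) ^ ((1 - decayRate n r) / 4)) →
      ∀ φ : 𝓢(Rn n, ℂ), ‖∫ x, f x * SchwartzMap.fourierMultiplierCLM ℂ m φ x‖ₑ ≤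
        ENNReal.ofReal (C * B * M) * scDualNorm r ε φ := by
  obtain ⟨C, hC0, hC⟩ := exists_eLpNorm_bracket_eq hn hr hδ
  refine ⟨(1 + n) * C, by positivity, fun ε hε f g hfg M hf hg m hm B hB hmB φ => ?_⟩
  have hM : 0 ≤ M := (norm_nonneg _).trans hf
  set δ := decayRate n r with hδd
  set J : Rn n → ℝ := fun ξ => 1 + ‖(2 * Real.pi * ε) • ξ‖ ^ 2 with hJ
  have hJ1 : ∀ ξ, 1 ≤ J ξ := fun ξ => by simp only [hJ]; linarith [sq_nonneg ‖(2 * Real.pi * ε) • ξ‖]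
  have hJ0 : ∀ ξ, 0 < J ξ := fun ξ => zero_lt_one.trans_le (hJ1 ξ)
  -- write `m(D) φ = (1 - ε² Δ) ψ` and integrate by parts: `ψ` is controlled in semiclassical `H¹`
  have hJt : (fun ξ => (((J ξ) ^ (-1 : ℝ) : ℝ) : ℂ)).HasTemperateGrowth := by
    have := hasTemperateGrowth_bracket (n := n) (2 * Real.pi * ε) (-1)
    fun_prop
  have hk : (fun ξ => (((J ξ) ^ (-1 : ℝ) : ℝ) : ℂ) * m ξ).HasTemperateGrowth := by fun_prop
  set ψ := SchwartzMap.fourierMultiplierCLM ℂ (fun ξ => (((J ξ) ^ (-1 : ℝ) : ℝ) : ℂ) * m ξ) φ with hψ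
  have hF : ∀ ξ, FourierTransform.fourier ψ ξ =
      (((J ξ) ^ (-1 : ℝ) : ℝ) : ℂ) * m ξ * FourierTransform.fourier φ ξ := fun ξ =>
    SchwartzMap.fourier_fourierMultiplierCLM_apply hk φ ξ
  have e1 : SchwartzMap.fourierMultiplierCLM ℂ m φ = ψ - ((ε : ℂ) ^ 2) • Δ ψ := by
    refine SchwartzMap.ext_of_fourier fun ξ => ?_
    have h0 : ((J ξ : ℝ) : ℂ) ≠ 0 := by exact_mod_cast (hJ0 ξ).ne'
    have h2 : ((J ξ : ℝ) : ℂ) = 1 + (ε : ℂ) ^ 2 * ((2 * Real.pi * ‖ξ‖) ^ 2 : ℝ) := by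
      simp only [hJ, norm_smul, Real.norm_of_nonneg (by positivity : 0 ≤ 2 * Real.pi * ε)]
      push_cast; ring
    rw [SchwartzMap.fourier_sub', FourierTransform.fourier_smul, sub_apply, smul_apply,
      SchwartzMap.fourier_laplacian_apply, hF, SchwartzMap.fourier_fourierMultiplierCLM_apply hm,
      smul_eq_mul, Real.rpow_neg_one]
    push_cast at h2 ⊢
    field_simp
    rw [h2]
    ring
  have hw : Continuous fun ξ : Rn n => (1 + ‖(2 * Real.pi * ε) • ξ‖ ^ 2) ^ (-((1 + δ) / 4)) :=
    Continuous.rpow_const (by fun_prop) fun ξ => Or.inl (by positivity)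
  have hwn : ∀ ξ, ‖(J ξ) ^ (-((1 + δ) / 4))‖ = (J ξ) ^ (-((1 + δ) / 4)) := fun ξ =>
    Real.norm_of_nonneg (Real.rpow_nonneg (hJ0 ξ).le _)
  have hψn : ∀ ξ, ‖FourierTransform.fourier ψ ξ‖ ≤
      B * (J ξ) ^ ((1 - δ) / 4 - 1) * ‖FourierTransform.fourier φ ξ‖ := fun ξ => by
    rw [hF, norm_mul, norm_mul, Complex.norm_real, Real.norm_of_nonneg (Real.rpow_nonneg (hJ0 ξ).le _)]
    refine mul_le_mul_of_nonneg_right ?_ (norm_nonneg _)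
    calc (J ξ) ^ (-1 : ℝ) * ‖m ξ‖ ≤ (J ξ) ^ (-1 : ℝ) * (B * (J ξ) ^ ((1 - δ) / 4)) :=
          mul_le_mul_of_nonneg_left (hmB ξ) (Real.rpow_nonneg (hJ0 ξ).le _)
      _ = _ := by
        rw [show (1 - δ) / 4 - 1 = -1 + (1 - δ) / 4 by ring, Real.rpow_add (hJ0 ξ)]; ring
  set Y := ENNReal.ofReal (C * B) * scDualNorm r ε φ with hY
  have hYt : Y ≠ ⊤ := ENNReal.mul_ne_top ENNReal.ofReal_ne_top (scDualNorm_schwartz_ne_top φ)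
  have hYle : ENNReal.ofReal B * (eLpNorm (fun ξ : Rn n => (J ξ) ^ (-((1 + δ) / 4)))
      (ENNReal.ofReal (1 / 2 - 1 / r)⁻¹) volume *
        eLpNorm φ (ENNReal.ofReal (Real.conjExponent r)) volume) ≤ Y := by
    rw [hY, scDualNorm, ← mul_assoc, ← mul_assoc]
    refine mul_le_mul_left ?_ _
    refine (mul_le_mul_right (hC ε hε) _).trans_eq ?_
    rw [← ENNReal.ofReal_mul hB, ← ENNReal.ofReal_mul (by positivity)]
    congr 1; ring
  have h1 : ‖ψ.toLp 2 volume‖ ≤ Y.toReal := by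
    rw [← ENNReal.ofReal_le_iff_le_toReal hYt]
    refine (SchwartzMap.norm_toLp_two_le_of_eLpNorm hr rfl hw (B := B) (φ := φ) fun ξ => ?_).trans hYle
    refine (hψn ξ).trans ?_
    rw [hwn, ← mul_assoc]
    gcongr
    · exact hJ1 ξ
    · linarith
  have h2 : ∀ i, ε * ‖(∂_{(EuclideanSpace.single i (1 : ℝ) : Rn n)} ψ).toLp 2 volume‖ ≤ Y.toReal := by
    intro i
    rw [← ENNReal.ofReal_le_iff_le_toReal hYt, ENNReal.ofReal_mul hε.le]
    refine le_trans ?_ hYle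
    refine (mul_le_mul_right (SchwartzMap.norm_toLp_two_le_of_eLpNorm hr rfl hw (B := B / ε) (φ := φ)
      fun ξ => ?_) _).trans_eq ?_
    · refine (SchwartzMap.norm_fourier_lineDeriv_single ψ i ξ).trans ?_
      have h3 : 2 * Real.pi * ‖ξ‖ ≤ ε⁻¹ * (J ξ) ^ (1 / 2 : ℝ) := by
        rw [← Real.sqrt_eq_rpow, inv_mul_eq_div, le_div_iff₀ hε]
        refine Real.le_sqrt_of_sq_le ?_
        simp only [hJ, norm_smul, Real.norm_of_nonneg (by positivity : 0 ≤ 2 * Real.pi * ε)]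
        nlinarith
      calc _ ≤ ε⁻¹ * (J ξ) ^ (1 / 2 : ℝ) * (B * (J ξ) ^ ((1 - δ) / 4 - 1) *
            ‖FourierTransform.fourier φ ξ‖) := by
            refine mul_le_mul h3 (hψn ξ) (norm_nonneg _) ?_
            have := hJ0 ξ
            positivity
        _ = B / ε * ((J ξ) ^ (-((1 + δ) / 4)) * ‖FourierTransform.fourier φ ξ‖) := by
            rw [show -((1 + δ) / 4) = 1 / 2 + ((1 - δ) / 4 - 1) by ring, Real.rpow_add (hJ0 ξ)]
            ring
        _ = _ := by rw [hwn]
    · rw [← mul_assoc, ← ENNReal.ofReal_mul hε.le, mul_div_cancel₀ _ hε.ne']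
  rw [e1, ← ofReal_norm]
  refine (ENNReal.ofReal_le_ofReal (norm_integral_sub_laplacian_le hfg hf hε hg ψ h1 h2)).trans_eq ?_
  rw [ENNReal.ofReal_mul (by positivity), ENNReal.ofReal_toReal hYt, hY, ← mul_assoc,
    ← ENNReal.ofReal_mul (by positivity)]
  congr 2; ring

end

section

/-! ### Sobolev embedding and time continuity of the free evolution -/

variable {n : ℕ} {r ε : ℝ}

lemma integral_sub_mul_schwartz (f g : L2 n) (φ : 𝓢(Rn n, ℂ)) :
    ∫ x, (f - g : L2 n) x * φ x = (∫ x, f x * φ x) - ∫ x, g x * φ x := by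
  simp only [← l2Pair_toLp, map_sub, sub_apply]

lemma integral_mul_schwartz_sub (f : L2 n) (φ ψ : 𝓢(Rn n, ℂ)) :
    ∫ x, f x * (φ - ψ) x = (∫ x, f x * φ x) - ∫ x, f x * ψ x := by
  have h : (φ - ψ).toLp 2 volume = φ.toLp 2 volume - ψ.toLp 2 volume :=
    map_sub (SchwartzMap.toLpCLM ℂ ℂ 2 (volume : Measure (Rn n))) φ ψ
  rw [← l2Pair_toLp, h, map_sub, l2Pair_toLp, l2Pair_toLp]

lemma norm_exp_I_mul_sub_one_le_rpow {γ : ℝ} (hγ0 : 0 ≤ γ) (hγ1 : γ ≤ 1) (x : ℝ) :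
    ‖Complex.exp (Complex.I * x) - 1‖ ≤ 2 * |x| ^ γ := by
  rcases le_total |x| 1 with hx | hx
  · have h1 := Real.norm_exp_I_mul_ofReal_sub_one_le (x := x)
    have h2 : |x| ^ (1 : ℝ) ≤ |x| ^ γ := Real.rpow_le_rpow_of_exponent_ge_of_imp (abs_nonneg x) hx hγ1
      (fun h1 h2 => by norm_num at h2)
    rw [Real.rpow_one] at h2
    rw [Real.norm_eq_abs] at h1
    have := abs_nonneg x
    linarith
  · have h1 : ‖Complex.exp (Complex.I * x) - 1‖ ≤ 2 := by
      refine (norm_sub_le _ _).trans ?_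
      rw [Complex.norm_exp_I_mul_ofReal]; norm_num
    have h2 : 1 ≤ |x| ^ γ := Real.one_le_rpow hx hγ0
    linarith

/-- The Sobolev embedding `H¹ ⊂ L^r`, and the Hölder continuity in time of the free Schrödinger
evolution of `H¹` data with values in `L^r`, both in semiclassical scaling. -/
theorem exists_scLpNorm_le (hn : 1 ≤ n) (hr : 2 < r) (hδ : decayRate n r < 1) :
    ∃ C : ℝ, 0 ≤ C ∧ ∀ ε : ℝ, 0 < ε → ∀ (f : L2 n) (g : Fin n → L2 n), HasWeakGradient f g →
      ∀ M, ‖f‖ ≤ M → (∀ i, ε * ‖g i‖ ≤ M) → scLpNorm r ε f ≤ ENNReal.ofReal (C * M) ∧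
        ∀ (s : ℝ) (f' : L2 n), (∀ φ : 𝓢(Rn n, ℂ), ∫ x, f' x * φ x =
            ∫ x, f x * SchwartzMap.schrodinger (ε ^ 2 * s) φ x) →
          scLpNorm r ε (f' - f : L2 n) ≤
            ENNReal.ofReal (C * M * |s| ^ ((1 - decayRate n r) / 4)) := by
  obtain ⟨C, hC0, hC⟩ := exists_norm_integral_mul_multiplier_le hn hr hδ
  have hδ0 := decayRate_pos hn hr
  set γ := (1 - decayRate n r) / 4 with hγ
  have hγ0 : 0 ≤ γ := by rw [hγ]; linarith
  have hγ1 : γ ≤ 1 := by rw [hγ]; linarith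
  refine ⟨2 * C, by positivity, fun ε hε f g hfg M hf hg => ⟨?_, fun s f' hf' => ?_⟩⟩
  · refine scLpNorm_lp_le_of_forall_schwartz hr hε f fun φ => ?_
    have h := hC ε hε f g hfg M hf hg (fun _ => 1) (by fun_prop) 1 zero_le_one (fun ξ => by
      rw [norm_one, one_mul]
      exact Real.one_le_rpow (by linarith [sq_nonneg ‖(2 * Real.pi * ε) • ξ‖]) hγ0) φ
    rw [SchwartzMap.fourierMultiplierCLM_const, one_smul] at h
    refine h.trans ?_
    have hM : 0 ≤ M := (norm_nonneg _).trans hf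
    gcongr ENNReal.ofReal ?_ * _
    nlinarith [mul_nonneg hC0 hM]
  · refine scLpNorm_lp_le_of_forall_schwartz hr hε _ fun φ => ?_
    set m : Rn n → ℂ := fun ξ => Complex.exp (Complex.I *
      ((ε ^ 2 * s * SchwartzMap.halfLaplacianSymbol n ξ : ℝ) : ℂ)) - 1 with hm
    have hexp := SchwartzMap.hasTemperateGrowth_phase
      (SchwartzMap.hasTemperateGrowth_halfLaplacianSymbol (n := n)) (ε ^ 2 * s)
    have hmt : m.HasTemperateGrowth := by fun_prop
    have e1 : SchwartzMap.schrodinger (ε ^ 2 * s) φ - φ = SchwartzMap.fourierMultiplierCLM ℂ m φ := by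
      refine SchwartzMap.ext_of_fourier fun ξ => ?_
      rw [SchwartzMap.fourier_sub', sub_apply, SchwartzMap.fourier_fourierMultiplierCLM_apply hmt,
        SchwartzMap.schrodinger,
        SchwartzMap.fourier_phaseGroup SchwartzMap.hasTemperateGrowth_halfLaplacianSymbol, hm]
      ring
    have h := hC ε hε f g hfg M hf hg m hmt (2 * |s| ^ γ) (by positivity) (fun ξ => by
      refine (norm_exp_I_mul_sub_one_le_rpow hγ0 hγ1 _).trans ?_
      rw [mul_assoc 2, ← Real.mul_rpow (abs_nonneg _) (by positivity)]
      refine mul_le_mul_of_nonneg_left (Real.rpow_le_rpow (abs_nonneg _) ?_ hγ0) (by norm_num)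
      rw [mul_comm (ε ^ 2), mul_assoc, abs_mul]
      refine mul_le_mul_of_nonneg_left ?_ (abs_nonneg _)
      rw [SchwartzMap.halfLaplacianSymbol, norm_smul,
        Real.norm_of_nonneg (by positivity : 0 ≤ 2 * Real.pi * ε), neg_mul, mul_neg, abs_neg,
        abs_of_nonneg (by positivity)]
      have : 0 ≤ Real.pi ^ 2 * ε ^ 2 * ‖ξ‖ ^ 2 := by positivity
      nlinarith) φ
    rw [integral_sub_mul_schwartz, hf', ← integral_mul_schwartz_sub, e1]
    refine h.trans_eq ?_
    congr 2
    ring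

lemma hasWeakGradient_toLp (φ : 𝓢(Rn n, ℂ)) : HasWeakGradient (φ.toLp 2 volume)
    (fun i => (∂_{(EuclideanSpace.single i (1 : ℝ) : Rn n)} φ).toLp 2 volume) := by
  intro i χ
  rw [integral_toLp_mul, integral_toLp_mul,
    SchwartzMap.integral_mul_lineDerivOp_right_eq_neg_left, neg_neg]

end

section

/-! ### Strichartz estimates -/

/-- The square of the norm of an integral in a Hilbert space, as a double integral: the `TT*`
method. -/
lemma enorm_integral_sq_le {α H : Type*} [MeasurableSpace α] {μ : Measure α}
    [NormedAddCommGroup H] [InnerProductSpace ℂ H] [CompleteSpace H] {Γ : α → H}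
    (hΓ : Integrable Γ μ) :
    ‖∫ s, Γ s ∂μ‖ₑ ^ 2 ≤ ∫⁻ s, ∫⁻ t, ‖inner ℂ (Γ s) (Γ t)‖ₑ ∂μ ∂μ := by
  set G := ∫ s, Γ s ∂μ with hG
  have h1 : ‖G‖ₑ ^ 2 = ‖inner ℂ G G‖ₑ := by
    rw [inner_self_eq_norm_sq_to_K, enorm_pow]
    congr 1
    rw [← ofReal_norm, ← ofReal_norm]
    simp
  have h2 : inner ℂ G G = ∫ s, inner ℂ G (Γ s) ∂μ := by
    rw [integral_inner hΓ]
  rw [h1, h2]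
  refine (enorm_integral_le_lintegral_enorm _).trans (lintegral_mono fun s => ?_)
  have h3 : ‖inner ℂ G (Γ s)‖ₑ = ‖∫ t, inner ℂ (Γ s) (Γ t) ∂μ‖ₑ := by
    rw [integral_inner hΓ, ← ofReal_norm, ← ofReal_norm, norm_inner_symm]
  rw [h3]
  exact enorm_integral_le_lintegral_enorm _

/-- A measurable choice of the index of the largest among finitely many functions. -/
lemma exists_measurable_argmax {a : ℕ → ℝ → ℂ} (ha : ∀ j, Measurable (a j)) (J : ℕ) :
    ∃ k : ℝ → ℕ, Measurable k ∧ (∀ s, k s ≤ J) ∧ ∀ i ≤ J, ∀ s, ‖a i s‖ ≤ ‖a (k s) s‖ := by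
  induction J with
  | zero => exact ⟨fun _ => 0, measurable_const, fun _ => le_rfl, fun i hi s => by
      rw [Nat.le_zero.1 hi]⟩
  | succ J ih =>
    obtain ⟨k, hk, hkJ, hmax⟩ := ih
    have hu : Measurable fun p : ℕ × ℝ => a p.1 p.2 := measurable_from_prod_countable_right ha
    have hm : Measurable fun s => a (k s) s := hu.comp (hk.prodMk measurable_id)
    refine ⟨fun s => if ‖a (k s) s‖ < ‖a (J + 1) s‖ then J + 1 else k s,
      Measurable.ite (measurableSet_lt hm.norm (ha _).norm) measurable_const hk, fun s => ?_,
      fun i hi s => ?_⟩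
    · dsimp only; split_ifs
      · exact le_rfl
      · exact (hkJ s).trans (Nat.le_succ J)
    · dsimp only
      rcases Nat.le_succ_iff.1 hi with h | h
      · split_ifs with h1
        · exact (hmax i h s).trans h1.le
        · exact hmax i h s
      · split_ifs with h1
        · rw [h]
        · rw [h]; exact not_lt.1 h1

/-- The duality (`TT*`) argument behind the Strichartz estimate, for a measurable choice `k` among
finitely many curves `Φ j` in a Hilbert space. -/
lemma strichartz_of_measurable_choice {H : Type*} [NormedAddCommGroup H] [InnerProductSpace ℂ H]
    [CompleteSpace H] {δ : ℝ} (hδ0 : 0 < δ) (hδ : δ < 1)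
    {C : ℝ≥0∞} (hC : ∀ f g : ℝ → ℝ≥0∞, Measurable f → Measurable g →
      ∫⁻ s, f s * ∫⁻ t, g t * rieszKernel δ (t - s) ≤
        C * ((∫⁻ s, f s ^ (Real.conjExponent (2 / δ))) ^ (1 / Real.conjExponent (2 / δ)) *
         (∫⁻ s, g s ^ (Real.conjExponent (2 / δ))) ^ (1 / Real.conjExponent (2 / δ))))
    (L : H →L[ℂ] ℂ) {Φ : ℕ → ℝ → H} (hΦc : ∀ j, Continuous (Φ j)) {K' : ℕ → ℝ}
    (hΦn : ∀ j s, ‖Φ j s‖ ≤ K' j)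
    (hΦΦ : ∀ i j s t, t ≠ s → ‖inner ℂ (Φ i s) (Φ j t)‖ₑ ≤ rieszKernel δ (t - s))
    {k : ℝ → ℕ} (hk : Measurable k) {J : ℕ} (hkJ : ∀ s, k s ≤ J) (R : ℝ) :
    (∫⁻ s in Icc (-R) R, ‖L (Φ (k s) s)‖ₑ ^ (2 / δ)) ^ (1 / (2 / δ)) ≤ C ^ (1 / 2 : ℝ) * ‖L‖ₑ := by
  have hK' : ∀ j, 0 ≤ K' j := fun j => (norm_nonneg _).trans (hΦn j 0)
  set q := 2 / δ with hq
  have hq2 : 2 < q := by rw [hq, lt_div_iff₀ hδ0]; linarith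
  have hqq : q.HolderConjugate (Real.conjExponent q) := holderConjugate_conjExponent hq2
  set q' := Real.conjExponent q with hq'
  have hq'0 : 0 < q' := hqq.symm.pos
  set I := Icc (-R) R with hI
  set a : ℝ → ℂ := fun s => L (Φ (k s) s) with ha
  have ham : Measurable a := by
    have hu : Measurable fun p : ℕ × ℝ => L (Φ p.1 p.2) :=
      measurable_from_prod_countable_right fun j => ((L).continuous.comp (hΦc j)).measurable
    exact hu.comp (hk.prodMk measurable_id)
  set K := ∑ j ∈ Finset.range (J + 1), K' j with hK
  have hK0 : 0 ≤ K := Finset.sum_nonneg fun j _ => hK' j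
  have hΦK : ∀ s, ‖Φ (k s) s‖ ≤ K := fun s => by
    refine (hΦn _ _).trans ?_
    exact Finset.single_le_sum (f := fun j => K' j) (fun j _ => hK' j)
      (Finset.mem_range.2 (Nat.lt_succ_of_le (hkJ s)))
  have haK : ∀ s, ‖a s‖ ≤ ‖L‖ * K := fun s =>
    (L.le_opNorm _).trans (mul_le_mul_of_nonneg_left (hΦK s) (norm_nonneg _))
  -- the extremal coefficient, for which `c a = |a|^q`
  set c : ℝ → ℂ := fun s => starRingEnd ℂ (a s) * ((‖a s‖ ^ (q - 2) : ℝ) : ℂ) with hc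
  have hcm : Measurable c := by
    have h1 : Measurable fun s => starRingEnd ℂ (a s) := Complex.continuous_conj.measurable.comp ham
    exact h1.mul (Complex.measurable_ofReal.comp (ham.norm.pow_const _))
  have hcn : ∀ s, ‖c s‖ = ‖a s‖ ^ (q - 1) := fun s => by
    rw [hc]
    simp only [norm_mul, RCLike.norm_conj, Complex.norm_real,
      Real.norm_of_nonneg (Real.rpow_nonneg (norm_nonneg (a s)) _)]
    rcases eq_or_ne ‖a s‖ 0 with h0 | h0
    · rw [h0, zero_mul, Real.zero_rpow (by linarith)]
    · rw [show q - 1 = 1 + (q - 2) by ring, Real.rpow_add (lt_of_le_of_ne (norm_nonneg _) h0.symm),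
        Real.rpow_one]
  have hca : ∀ s, c s * a s = ((‖a s‖ ^ q : ℝ) : ℂ) := fun s => by
    rw [hc]
    simp only
    rw [mul_right_comm, mul_comm (starRingEnd ℂ (a s)), Complex.mul_conj, Complex.normSq_eq_norm_sq,
      ← Complex.ofReal_mul]
    congr 1
    rcases eq_or_ne ‖a s‖ 0 with h0 | h0
    · rw [h0, Real.zero_rpow (by linarith : q ≠ 0)]; simp
    · rw [show q = 2 + (q - 2) by ring, Real.rpow_add (lt_of_le_of_ne (norm_nonneg _) h0.symm)]
      simp
  have hcb : ∀ s, ‖c s‖ ≤ (‖L‖ * K) ^ (q - 1) := fun s => by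
    rw [hcn]; exact Real.rpow_le_rpow (norm_nonneg _) (haK s) (by linarith)
  set Γ : ℝ → H := fun s => c s • Φ (k s) s with hΓ
  have hΓm : AEStronglyMeasurable Γ volume := by
    have h1 : Γ = fun s => ∑ j ∈ Finset.range (J + 1),
        (k ⁻¹' {j}).indicator (fun s => c s • Φ j s) s := by
      ext1 s
      rw [Finset.sum_eq_single (k s)]
      · rw [indicator_of_mem (by simp)]
      · intro j _ hj
        exact indicator_of_notMem (by simpa using hj.symm) _
      · intro h
        exact absurd (Finset.mem_range.2 (Nat.lt_succ_of_le (hkJ s))) h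
    rw [h1]
    refine Finset.aestronglyMeasurable_fun_sum _ fun j _ => ?_
    exact (hcm.aestronglyMeasurable.smul (hΦc j).aestronglyMeasurable).indicator (hk (measurableSet_singleton j))
  have hΓi : Integrable Γ (volume.restrict I) := by
    refine Measure.integrableOn_of_bounded (M := (‖L‖ * K) ^ (q - 1) * K)
      (by rw [hI, Real.volume_Icc]; exact ENNReal.ofReal_ne_top) hΓm (Eventually.of_forall fun s => ?_)
    rw [hΓ, norm_smul]
    exact mul_le_mul (hcb s) (hΦK s) (norm_nonneg _) (by positivity)
  set X := ∫⁻ s in I, ‖a s‖ₑ ^ q with hX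
  have hXt : X ≠ ⊤ := by
    refine ne_top_of_le_ne_top ?_ (lintegral_mono (g := fun _ => ENNReal.ofReal ((‖L‖ * K) ^ q)) fun s => ?_)
    · rw [lintegral_const, Measure.restrict_apply_univ, hI, Real.volume_Icc]
      finiteness
    · dsimp only
      rw [← ofReal_norm, ENNReal.ofReal_rpow_of_nonneg (norm_nonneg _) (by linarith)]
      exact ENNReal.ofReal_le_ofReal (Real.rpow_le_rpow (norm_nonneg _) (haK s) (by linarith))
  have hX1 : X = ‖L (∫ s in I, Γ s)‖ₑ := by
    rw [← ContinuousLinearMap.integral_comp_comm _ hΓi]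
    have h1 : ∀ s, L (Γ s) = ((‖a s‖ ^ q : ℝ) : ℂ) := fun s => by
      rw [hΓ, map_smul, smul_eq_mul]; exact hca s
    simp_rw [h1]
    rw [integral_complex_ofReal, ← ofReal_norm, Complex.norm_real,
      Real.norm_of_nonneg (integral_nonneg fun s => by positivity),
      ofReal_integral_eq_lintegral_ofReal]
    · refine lintegral_congr fun s => ?_
      rw [← ofReal_norm, ENNReal.ofReal_rpow_of_nonneg (norm_nonneg _) (by linarith)]
    · refine Measure.integrableOn_of_bounded (M := (‖L‖ * K) ^ q)
        (by rw [hI, Real.volume_Icc]; exact ENNReal.ofReal_ne_top)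
        (ham.norm.pow_const q).aestronglyMeasurable (Eventually.of_forall fun s => ?_)
      rw [Real.norm_of_nonneg (by positivity)]
      exact Real.rpow_le_rpow (norm_nonneg _) (haK s) (by linarith)
    · exact Eventually.of_forall fun s => by positivity
  have hG : ‖∫ s in I, Γ s‖ₑ ^ 2 ≤ C * (X ^ (1 / q') * X ^ (1 / q')) := by
    refine (enorm_integral_sq_le hΓi).trans ?_
    set h : ℝ → ℝ≥0∞ := I.indicator fun s => ‖c s‖ₑ with hh
    have hhm : Measurable h := hcm.enorm.indicator measurableSet_Icc
    have h1 := hC h h hhm hhm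
    have h2 : ∫⁻ s, h s ^ q' = X := by
      rw [hX, ← lintegral_indicator measurableSet_Icc]
      refine lintegral_congr fun s => ?_
      by_cases hs : s ∈ I
      · rw [hh, indicator_of_mem hs, indicator_of_mem hs, ← ofReal_norm, hcn, ← ofReal_norm,
          ENNReal.ofReal_rpow_of_nonneg (norm_nonneg _) (by linarith),
          ENNReal.ofReal_rpow_of_nonneg (by positivity) hq'0.le, ← Real.rpow_mul (norm_nonneg _),
          hqq.sub_one_mul_conj]
      · rw [hh, indicator_of_notMem hs, indicator_of_notMem hs, ENNReal.zero_rpow_of_pos hq'0]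
    rw [h2] at h1
    refine le_trans ?_ h1
    rw [← lintegral_indicator measurableSet_Icc]
    refine lintegral_mono fun s => ?_
    by_cases hs : s ∈ I
    · rw [indicator_of_mem hs, hh, indicator_of_mem hs, ← lintegral_const_mul' _ _ enorm_ne_top,
        ← lintegral_indicator measurableSet_Icc]
      refine lintegral_mono_ae ?_
      have hne : ∀ᵐ t : ℝ, t ≠ s := by simp [ae_iff, measure_singleton]
      filter_upwards [hne] with t ht
      by_cases htI : t ∈ I
      · rw [indicator_of_mem htI, indicator_of_mem htI, hΓ]
        simp only
        rw [inner_smul_left, inner_smul_right, enorm_mul, enorm_mul, RCLike.enorm_conj]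
        gcongr
        exact hΦΦ _ _ _ _ ht
      · rw [indicator_of_notMem htI]; exact bot_le
    · rw [indicator_of_notMem hs]; exact bot_le
  have hfin : X ≤ ‖L‖ₑ * (C ^ (1 / 2 : ℝ) * X ^ (1 / q')) := by
    calc X = ‖L (∫ s in I, Γ s)‖ₑ := hX1
      _ ≤ ‖L‖ₑ * ‖∫ s in I, Γ s‖ₑ := by
        rw [← ofReal_norm, ← ofReal_norm, ← ofReal_norm, ← ENNReal.ofReal_mul (norm_nonneg _)]
        exact ENNReal.ofReal_le_ofReal (L.le_opNorm _)
      _ = ‖L‖ₑ * (‖∫ s in I, Γ s‖ₑ ^ 2) ^ (1 / 2 : ℝ) := by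
        rw [← ENNReal.rpow_natCast, ← ENNReal.rpow_mul]; norm_num
      _ ≤ ‖L‖ₑ * (C * (X ^ (1 / q') * X ^ (1 / q'))) ^ (1 / 2 : ℝ) := by gcongr
      _ = _ := by
        rw [ENNReal.mul_rpow_of_nonneg _ _ (by norm_num), ← sq, ← ENNReal.rpow_natCast (X ^ (1 / q')),
          ← ENNReal.rpow_mul (X ^ (1 / q'))]
        norm_num
  rcases eq_or_ne X 0 with h0 | h0
  · rw [h0, ENNReal.zero_rpow_of_pos (by have := hqq.pos; positivity)]; exact bot_le
  · have hsum : 1 / q = 1 + -(1 / q') := by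
      have := hqq.inv_add_inv_eq_one
      rw [one_div, one_div]; linarith
    rw [hsum, ENNReal.rpow_add _ _ h0 hXt, ENNReal.rpow_one, ENNReal.rpow_neg]
    have hX0 : X ^ (1 / q') ≠ 0 := by simp [ENNReal.rpow_eq_zero_iff, h0, hXt]
    have hXt' : X ^ (1 / q') ≠ ⊤ := ENNReal.rpow_ne_top_of_nonneg (by positivity) hXt
    rw [← div_eq_mul_inv]
    refine ENNReal.div_le_of_le_mul ?_
    rw [mul_comm (C ^ _), mul_assoc]
    exact hfin

namespace SchwartzMap

variable {n : ℕ} {r ε : ℝ}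

/-- The dispersive estimate in rescaled time: two normalized test functions, transported to times
`s` and `t`, have inner product at most `|t - s|^{-δ}`. -/
lemma enorm_inner_schrodinger_le (hr : 2 < r) (hε : 0 < ε) {s t : ℝ} (hst : t ≠ s)
    {φ ψ : 𝓢(Rn n, ℂ)} (hφ : scDualNorm r ε φ ≤ 1) (hψ : scDualNorm r ε ψ ≤ 1) :
    ‖inner ℂ ((schrodinger (ε ^ 2 * s) φ).toLp 2 volume)
      ((schrodinger (ε ^ 2 * t) ψ).toLp 2 volume)‖ₑ ≤ rieszKernel (decayRate n r) (t - s) := by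
  have h1 := inner_toLp_phaseGroup (hasTemperateGrowth_halfLaplacianSymbol (n := n)) (ε ^ 2 * s)
    (ε ^ 2 * t) φ ψ
  rw [← mul_sub] at h1
  unfold schrodinger
  rw [h1, inner_toL2_toL2_eq _ _ volume]
  have h2 := enorm_integral_mul_le_scNorm hr hε (f := fun x => starRingEnd ℂ (schrodinger (ε ^ 2 * (s - t)) φ x))
    (g := ψ) (Complex.continuous_conj.comp (schrodinger (ε ^ 2 * (s - t)) φ).continuous).aestronglyMeasurable
    ψ.continuous.aestronglyMeasurable
  have h3 : scLpNorm r ε (fun x => starRingEnd ℂ (schrodinger (ε ^ 2 * (s - t)) φ x)) =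
      scLpNorm r ε (schrodinger (ε ^ 2 * (s - t)) φ) := by
    unfold scLpNorm
    rw [eLpNorm_congr_norm_ae (g := schrodinger (ε ^ 2 * (s - t)) φ)
      (Eventually.of_forall fun x => by simp)]
  rw [h3] at h2
  have h4 := scLpNorm_schrodinger_le hr hε (sub_ne_zero.2 hst.symm) φ
  calc _ = ‖∫ x, starRingEnd ℂ (schrodinger (ε ^ 2 * (s - t)) φ x) * ψ x‖ₑ := by
        congr 1
        refine integral_congr_ae (Eventually.of_forall fun x => ?_)
        simp only [RCLike.inner_apply]
        rw [mul_comm]; rfl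
    _ ≤ rieszKernel (decayRate n r) (s - t) * 1 * 1 :=
        h2.trans (mul_le_mul' (h4.trans (mul_le_mul_right hφ _)) hψ)
    _ = _ := by rw [mul_one, mul_one, ← rieszKernel_neg, neg_sub]

lemma continuous_l2Pair_schrodinger (f : L2 n) (ε : ℝ) (φ : 𝓢(Rn n, ℂ)) :
    Continuous fun s : ℝ => l2Pair f ((schrodinger (ε ^ 2 * s) φ).toLp 2 volume) :=
  (l2Pair f).continuous.comp ((continuous_toLp_phaseGroup hasTemperateGrowth_halfLaplacianSymbol φ).comp
    (by fun_prop))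

/-- Countably many Schwartz functions suffice to compute dual norms. -/
lemma exists_seq_dense_scDualNorm_le_one (hr : 2 < r) (hε : 0 < ε) :
    ∃ ψ : ℕ → 𝓢(Rn n, ℂ), (∀ j, scDualNorm r ε (ψ j) ≤ 1) ∧
      ∀ (L : L2 n → ℝ≥0∞), Continuous L → (∀ (c : ℂ) f, L (c • f) = ‖c‖ₑ * L f) →
        ∀ φ : 𝓢(Rn n, ℂ), L (φ.toLp 2 volume) ≤
          (⨆ j, L ((ψ j).toLp 2 volume)) * scDualNorm r ε φ := by
  set S : Set (L2 n) := {x | ∃ φ : 𝓢(Rn n, ℂ), scDualNorm r ε φ ≤ 1 ∧ φ.toLp 2 volume = x} with hS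
  have hne : Nonempty S := ⟨⟨_, 0, by
    have : scDualNorm r ε (0 : 𝓢(Rn n, ℂ)) = 0 := by simp [scDualNorm]
    rw [this]; exact zero_le_one, rfl⟩⟩
  have hfact : Fact ((2 : ℝ≥0∞) ≠ ⊤) := ⟨ENNReal.ofNat_ne_top⟩
  have hd := TopologicalSpace.denseRange_denseSeq S
  choose ψ hψ1 hψ2 using fun j => (TopologicalSpace.denseSeq S j).2
  refine ⟨ψ, hψ1, fun L hL hLc φ => ?_⟩
  set Y := ⨆ j, L ((ψ j).toLp 2 volume) with hY
  have hYS : ∀ x : S, L x ≤ Y := by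
    intro x
    refine hd.induction_on (p := fun x : S => L x ≤ Y) x ?_ fun j => ?_
    · exact isClosed_le (hL.comp continuous_subtype_val) continuous_const
    · rw [← hψ2]; exact le_iSup (fun j => L ((ψ j).toLp 2 volume)) j
  have hsmul : ∀ (c : ℂ) (χ : 𝓢(Rn n, ℂ)), scDualNorm r ε (c • χ) = ‖c‖ₑ * scDualNorm r ε χ := by
    intro c χ
    unfold scDualNorm
    rw [show (⇑(c • χ) : Rn n → ℂ) = c • ⇑χ from rfl, eLpNorm_const_smul, mul_left_comm]
  have htoLp : ∀ (c : ℂ) (χ : 𝓢(Rn n, ℂ)), (c • χ).toLp 2 volume = c • χ.toLp 2 volume := fun c χ =>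
    map_smul (toLpCLM ℂ ℂ 2 (volume : Measure (Rn n))) c χ
  have key : ∀ c : ℂ, ‖c‖ₑ * scDualNorm r ε φ ≤ 1 → ‖c‖ₑ * L (φ.toLp 2 volume) ≤ Y := by
    intro c hcφ
    rw [← hLc, ← htoLp]
    exact hYS ⟨_, c • φ, by rwa [hsmul], rfl⟩
  have ht := scDualNorm_schwartz_ne_top (r := r) (ε := ε) φ
  rcases eq_or_ne (scDualNorm r ε φ) 0 with h0 | h0
  · have h1 : φ.toLp 2 volume = 0 := by
      have h3 : eLpNorm φ (ENNReal.ofReal (Real.conjExponent r)) volume = 0 := by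
        refine (mul_eq_zero.1 h0).resolve_left ?_
        simp only [ENNReal.ofReal_eq_zero, not_le]
        positivity
      rw [eLpNorm_eq_zero_iff φ.continuous.aestronglyMeasurable
        (by simpa using (holderConjugate_conjExponent hr).symm.pos)] at h3
      rw [Lp.eq_zero_iff_ae_eq_zero]
      exact (φ.coeFn_toLp 2 volume).trans h3
    have h2 := hLc 0 0
    simp only [smul_zero, enorm_zero, zero_mul] at h2
    rw [h1, h2]; exact bot_le
  · have h1 := key (((scDualNorm r ε φ).toReal⁻¹ : ℝ) : ℂ) (by
      rw [← ofReal_norm, Complex.norm_real, Real.norm_of_nonneg (by positivity),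
        ENNReal.ofReal_inv_of_pos (ENNReal.toReal_pos h0 ht), ENNReal.ofReal_toReal ht,
        ENNReal.inv_mul_cancel h0 ht])
    rw [← ofReal_norm, Complex.norm_real, Real.norm_of_nonneg (by positivity),
        ENNReal.ofReal_inv_of_pos (ENNReal.toReal_pos h0 ht), ENNReal.ofReal_toReal ht,
        mul_comm, ← div_eq_mul_inv] at h1
    exact (ENNReal.div_le_iff h0 ht).1 h1

/-- The Strichartz estimate `‖U(ε² s) f‖_{L^q(ds; L^r)} ≤ C ε^{-δ} ‖f‖_{L²}`, `q = 2 / δ`. The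
function `W` dominates the `L^r` norms, which are expressed by duality. -/
theorem exists_strichartz (hn : 1 ≤ n) (hr : 2 < r) (hδ : decayRate n r < 1) :
    ∃ C : ℝ≥0∞, C ≠ ⊤ ∧ ∀ ε : ℝ, 0 < ε → ∀ f : L2 n, ∃ W : ℝ → ℝ≥0∞, Measurable W ∧
      (∀ s (φ : 𝓢(Rn n, ℂ)), ‖∫ x, f x * schrodinger (ε ^ 2 * s) φ x‖ₑ ≤ W s * scDualNorm r ε φ) ∧
      (∫⁻ s, W s ^ (2 / decayRate n r)) ^ (1 / (2 / decayRate n r)) ≤ C * ‖f‖ₑ := by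
  have hδ0 := decayRate_pos hn hr
  set δ := decayRate n r with hδd
  have hq2 : 2 < 2 / δ := by rw [lt_div_iff₀ hδ0]; linarith
  have hqq : (2 / δ).HolderConjugate (Real.conjExponent (2 / δ)) := holderConjugate_conjExponent hq2
  obtain ⟨C, hCt, hC⟩ := hardy_littlewood_sobolev hδ0 hδ hqq.symm.lt hqq.symm.lt (by
    have := hqq.inv_add_inv_eq_one
    rw [inv_div] at this
    rw [one_div]; linarith)
  refine ⟨C ^ (1 / 2 : ℝ), ENNReal.rpow_ne_top_of_nonneg (by norm_num) hCt, fun ε hε f => ?_⟩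
  obtain ⟨ψ, hψ1, hψ⟩ := exists_seq_dense_scDualNorm_le_one (n := n) hr hε
  set a : ℕ → ℝ → ℂ := fun j s => l2Pair f ((schrodinger (ε ^ 2 * s) (ψ j)).toLp 2 volume) with ha
  have hac : ∀ j, Continuous (a j) := fun j => continuous_l2Pair_schrodinger f ε (ψ j)
  -- a supremum over countably many test functions, which is measurable
  refine ⟨fun s => ⨆ j, ‖a j s‖ₑ, Measurable.iSup fun j => (hac j).measurable.enorm, fun s φ => ?_, ?_⟩
  · have hT : ∀ χ : 𝓢(Rn n, ℂ), ‖((schrodinger (n := n) (ε ^ 2 * s)).toLinearMap χ).toLp 2 volume‖ ≤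
        ‖χ.toLp 2 volume‖ := fun χ =>
      (norm_toLp_phaseGroup hasTemperateGrowth_halfLaplacianSymbol _ χ).le
    have h := hψ (fun x => ‖l2Pair f (l2Extend (schrodinger (n := n) (ε ^ 2 * s)).toLinearMap x)‖ₑ)
      (((l2Pair f).continuous.comp (ContinuousLinearMap.continuous _)).enorm)
      (fun c x => by simp only [map_smul, smul_eq_mul, enorm_mul]) φ
    simp only [l2Extend_toLp hT] at h
    rw [← l2Pair_toLp]
    exact h
  · set q := 2 / δ with hq
    have hq0 : 0 < q := by linarith
    set F : ℕ → ℝ → ℝ≥0∞ := fun J => (Icc (-(J : ℝ)) J).indicator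
      fun s => (partialSups (fun j => ‖a j s‖ₑ) J) ^ q with hF
    have hFm : ∀ J, Measurable (F J) := fun J => by
      refine Measurable.indicator (Measurable.pow_const ?_ q) measurableSet_Icc
      simp only [partialSups_eq_biSup]
      exact Measurable.biSup _ (to_countable _) fun j _ => (hac j).measurable.enorm
    have hFmono : Monotone F := by
      intro J J' hJ s
      have hJ' : (J : ℝ) ≤ J' := by exact_mod_cast hJ
      by_cases hs : s ∈ Icc (-(J : ℝ)) J
      · have hs' : s ∈ Icc (-(J' : ℝ)) J' := ⟨by linarith [hs.1], by linarith [hs.2]⟩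
        simp only [hF, indicator_of_mem hs, indicator_of_mem hs']
        exact ENNReal.rpow_le_rpow ((partialSups fun j => ‖a j s‖ₑ).monotone hJ) hq0.le
      · simp only [hF, indicator_of_notMem hs]; exact bot_le
    have hW : ∀ s, (⨆ j, ‖a j s‖ₑ) ^ q ≤ ⨆ J, F J s := fun s => by
      rw [← ENNReal.le_rpow_inv_iff hq0]
      refine iSup_le fun j => ?_
      rw [ENNReal.le_rpow_inv_iff hq0]
      obtain ⟨N, hN⟩ := exists_nat_ge |s|
      have hs : s ∈ Icc (-((max j N : ℕ) : ℝ)) (max j N : ℕ) := by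
        have h1 : (N : ℝ) ≤ (max j N : ℕ) := by exact_mod_cast le_max_right j N
        have h2 := abs_le.1 (hN.trans h1)
        exact h2
      refine le_trans ?_ (le_iSup _ (max j N))
      simp only [hF, indicator_of_mem hs]
      exact ENNReal.rpow_le_rpow (le_partialSups_of_le (fun j => ‖a j s‖ₑ) (le_max_left j N)) hq0.le
    have hint : ∀ J, (∫⁻ s, F J s) ≤ (C ^ (1 / 2 : ℝ) * ‖f‖ₑ) ^ q := fun J => by
      obtain ⟨k, hk, hkJ, hmax⟩ := exists_measurable_argmax (fun j => (hac j).measurable) J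
      have h := strichartz_of_measurable_choice hδ0 hδ hC (l2Pair f)
        (Φ := fun j s => (schrodinger (ε ^ 2 * s) (ψ j)).toLp 2 volume)
        (fun j => (continuous_toLp_phaseGroup hasTemperateGrowth_halfLaplacianSymbol (ψ j)).comp
          (by fun_prop)) (K' := fun j => ‖(ψ j).toLp 2 volume‖)
        (fun j s => (norm_toLp_phaseGroup hasTemperateGrowth_halfLaplacianSymbol _ _).le)
        (fun i j s t hts => enorm_inner_schrodinger_le hr hε hts (hψ1 i) (hψ1 j)) hk hkJ J
      have hL : ‖l2Pair f‖ₑ ≤ ‖f‖ₑ := by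
        rw [← ofReal_norm, ← ofReal_norm]
        exact ENNReal.ofReal_le_ofReal
          (ContinuousLinearMap.opNorm_le_bound _ (norm_nonneg _) fun g => norm_l2Pair_le f g)
      rw [one_div, ENNReal.rpow_inv_le_iff hq0] at h
      rw [hF, lintegral_indicator measurableSet_Icc]
      refine (lintegral_mono fun s => ?_).trans (h.trans (by gcongr))
      refine ENNReal.rpow_le_rpow (partialSups_le _ _ _ fun i hi => ?_) hq0.le
      have := hmax i hi s
      rw [← ofReal_norm, ← ofReal_norm]
      exact ENNReal.ofReal_le_ofReal this
    rw [one_div, ENNReal.rpow_inv_le_iff hq0]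
    refine (lintegral_mono hW).trans ?_
    rw [lintegral_iSup hFm hFmono]
    exact iSup_le hint

end SchwartzMap

end

section

/-! ### Duhamel's formula -/

lemma map_real_smul' {E : Type*} [NormedAddCommGroup E] [NormedSpace ℂ E] (L : E →L[ℂ] ℂ) (c : ℝ)
    (x : E) : L (c • x) = c • L x := by
  rw [← Complex.coe_smul, map_smul, Complex.coe_smul]

/-- A product rule in which `w` is only continuous, and differentiable when tested against `Ψ s`.
-/
lemma hasDerivWithinAt_bilinear_apply {E : Type*} [NormedAddCommGroup E] [NormedSpace ℂ E]
    (B : E →L[ℂ] E →L[ℂ] ℂ) {w Ψ : ℝ → E} {A : Set ℝ} {s : ℝ} {d : ℂ} {Ψ' : E}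
    (hw : ContinuousWithinAt w A s) (hd : HasDerivWithinAt (fun t => B (w t) (Ψ s)) d A s)
    (hΨ : HasDerivWithinAt Ψ Ψ' A s) :
    HasDerivWithinAt (fun t => B (w t) (Ψ t)) (d + B (w s) Ψ') A s := by
  rw [hasDerivWithinAt_iff_tendsto_slope] at hd hΨ ⊢
  have h1 : Tendsto w (𝓝[A \ {s}] s) (𝓝 (w s)) := hw.mono_left (nhdsWithin_mono _ sdiff_subset)
  refine (hd.add (tendsto_bilinear_apply B h1 hΨ)).congr fun t => ?_
  simp only [slope_def_module, map_real_smul', map_sub]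
  rw [← smul_add]
  congr 1
  ring

namespace SchwartzMap

variable {n : ℕ} {ε : ℝ}

/-- `w` solves `i ∂ₛ w + (ε² / 2) Δ w = F` on `[0, ∞)` in the sense of distributions. -/
structure IsForcedSchrodinger (ε : ℝ) (w : ℝ → L2 n) (F : ℝ → Rn n → ℂ) : Prop where
  continuousOn : ContinuousOn w (Ici 0)
  hasDerivWithinAt : ∀ φ : 𝓢(Rn n, ℂ), ∀ s ∈ Ici (0 : ℝ),
    HasDerivWithinAt (fun t => ∫ x, w t x * φ x)
      (-Complex.I * (∫ x, F s x * φ x) + Complex.I / 2 * (ε : ℂ) ^ 2 * ∫ x, w s x * (Δ φ) x) (Ici 0) s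

variable {w : ℝ → L2 n} {F : ℝ → Rn n → ℂ}

/-- Testing against a function transported by the free flow cancels the linear part of the
equation. -/
lemma IsForcedSchrodinger.hasDerivWithinAt_schrodinger (h : IsForcedSchrodinger ε w F) (s₁ : ℝ)
    (φ : 𝓢(Rn n, ℂ)) {s : ℝ} (hs : 0 ≤ s) :
    HasDerivWithinAt (fun t => ∫ x, w t x * schrodinger (ε ^ 2 * (s₁ - t)) φ x)
      (-Complex.I * ∫ x, F s x * schrodinger (ε ^ 2 * (s₁ - s)) φ x) (Ici 0) s := by
  have hΨ : HasDerivAt (fun t => (schrodinger (ε ^ 2 * (s₁ - t)) φ).toLp 2 volume)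
      (((-ε ^ 2 : ℝ) : ℂ) • (Complex.I / 2) • (Δ (schrodinger (ε ^ 2 * (s₁ - s)) φ)).toLp 2 volume) s := by
    have h1 : HasDerivAt (fun t : ℝ => ε ^ 2 * (s₁ - t)) (-ε ^ 2) s := by
      have := ((hasDerivAt_id s).const_sub s₁).const_mul (ε ^ 2)
      simpa using this
    refine ((hasDerivAt_toLp_schrodinger φ (ε ^ 2 * (s₁ - s))).scomp s h1).congr_deriv ?_
    exact (algebraMap_smul ℂ (-ε ^ 2) _).symm
  have h2 := h.hasDerivWithinAt (schrodinger (ε ^ 2 * (s₁ - s)) φ) s hs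
  simp only [← l2Pair_toLp] at h2 ⊢
  have h3 := hasDerivWithinAt_bilinear_apply l2Pair (h.continuousOn s hs) h2 hΨ.hasDerivWithinAt
  refine h3.congr_deriv ?_
  rw [map_smul, map_smul, smul_eq_mul, smul_eq_mul]
  push_cast
  ring

/-- Duhamel's formula, as an inequality. -/
lemma IsForcedSchrodinger.enorm_sub_le (h : IsForcedSchrodinger ε w F) {s₀ s₁ : ℝ} (h0 : 0 ≤ s₀)
    (h01 : s₀ ≤ s₁) (φ : 𝓢(Rn n, ℂ)) {K : ℝ}
    (hK : ∀ s ∈ Icc s₀ s₁, ‖∫ x, F s x * schrodinger (ε ^ 2 * (s₁ - s)) φ x‖ ≤ K) :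
    ‖(∫ x, w s₁ x * φ x) - ∫ x, w s₀ x * schrodinger (ε ^ 2 * (s₁ - s₀)) φ x‖ₑ ≤
      ∫⁻ s in Icc s₀ s₁, ‖∫ x, F s x * schrodinger (ε ^ 2 * (s₁ - s)) φ x‖ₑ := by
  set G : ℝ → ℂ := fun t => ∫ x, w t x * schrodinger (ε ^ 2 * (s₁ - t)) φ x with hG
  set f : ℝ → ℂ := fun s => ∫ x, F s x * schrodinger (ε ^ 2 * (s₁ - s)) φ x with hf
  have hd : ∀ s, 0 ≤ s → HasDerivWithinAt G (-Complex.I * f s) (Ici 0) s := fun s hs =>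
    h.hasDerivWithinAt_schrodinger s₁ φ hs
  have hdI : ∀ s, 0 ≤ s → HasDerivWithinAt G (-Complex.I * f s) (Ioi s) s := fun s hs =>
    (hd s hs).mono fun t ht => hs.trans (le_of_lt ht)
  have hmeas : AEStronglyMeasurable (fun s => -Complex.I * f s) (volume.restrict (Ioc s₀ s₁)) := by
    refine AEStronglyMeasurable.congr
      (measurable_derivWithin_Ioi G).aestronglyMeasurable ?_
    filter_upwards [ae_restrict_mem measurableSet_Ioc] with s hs
    exact (hdI s (h0.trans hs.1.le)).derivWithin (uniqueDiffWithinAt_Ioi s)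
  have hint : IntervalIntegrable (fun s => -Complex.I * f s) volume s₀ s₁ := by
    rw [intervalIntegrable_iff_integrableOn_Ioc_of_le h01]
    refine ⟨hmeas, HasFiniteIntegral.of_bounded (C := K) ?_⟩
    filter_upwards [ae_restrict_mem measurableSet_Ioc] with s hs
    rw [norm_mul, norm_neg, Complex.norm_I, one_mul]
    exact hK s ⟨hs.1.le, hs.2⟩
  have hftc := intervalIntegral.integral_eq_sub_of_hasDeriv_right_of_le h01
    (fun s hs => ((hd s (h0.trans hs.1)).continuousWithinAt).mono fun t ht => h0.trans ht.1)
    (fun s hs => hdI s (h0.trans hs.1.le)) hint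
  have hG1 : G s₁ = ∫ x, w s₁ x * φ x := by
    simp only [hG, sub_self, mul_zero, schrodinger,
      phaseGroup_zero hasTemperateGrowth_halfLaplacianSymbol]
  rw [← hG1]
  change ‖G s₁ - G s₀‖ₑ ≤ _
  rw [← hftc, intervalIntegral.integral_of_le h01]
  refine (enorm_integral_le_lintegral_enorm _).trans ?_
  rw [Measure.restrict_congr_set Ioc_ae_eq_Icc]
  refine lintegral_mono fun s => ?_
  rw [enorm_mul, enorm_neg, ← ofReal_norm Complex.I, Complex.norm_I, ENNReal.ofReal_one, one_mul]

/-- Without forcing the solution is the free evolution. -/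
lemma IsForcedSchrodinger.eq_of_free (h : IsForcedSchrodinger ε w 0) {s₀ s₁ : ℝ} (h0 : 0 ≤ s₀)
    (h01 : 0 ≤ s₁) (φ : 𝓢(Rn n, ℂ)) :
    ∫ x, w s₁ x * φ x = ∫ x, w s₀ x * schrodinger (ε ^ 2 * (s₁ - s₀)) φ x := by
  set G : ℝ → ℂ := fun t => ∫ x, w t x * schrodinger (ε ^ 2 * (s₁ - t)) φ x with hG
  have hd : ∀ s, 0 ≤ s → HasDerivWithinAt G 0 (Ici 0) s := fun s hs => by
    have := h.hasDerivWithinAt_schrodinger s₁ φ hs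
    simpa using this
  have hc : G s₁ = G s₀ := by
    refine (convex_Ici (0 : ℝ)).is_const_of_fderivWithin_eq_zero (𝕜 := ℝ) (f := G)
      (fun s hs => (hd s hs).differentiableWithinAt) (fun s hs => ?_) h01 h0
    have h1 := (hd s hs).hasFDerivWithinAt.fderivWithin ((uniqueDiffOn_Ici 0) s hs)
    rw [h1]; ext; simp
  have hG1 : G s₁ = ∫ x, w s₁ x * φ x := by
    simp only [hG, sub_self, mul_zero, schrodinger,
      phaseGroup_zero hasTemperateGrowth_halfLaplacianSymbol]
  rw [← hG1, hc]

end SchwartzMap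

open SchwartzMap in
/-- The equation in the time variable `s = t / ε`, in which its linear part is
`i ∂ₛ + (ε² / 2) Δ`. -/
lemma SolvesSchrodinger.isForcedSchrodinger {n : ℕ} {ε : ℝ} (hε : 0 < ε) {N : H1 n → Rn n → ℂ}
    {u₀ : H1 n} {u : ℝ → H1 n} (h : SolvesSchrodinger ε N u₀ u) :
    IsForcedSchrodinger ε (fun s => H1.fn (u (ε * s))) (fun s => N (u (ε * s))) where
  continuousOn := by
    have h1 : Continuous (H1.fn : H1 n → L2 n) := continuous_fst.comp continuous_subtype_val
    refine h1.comp_continuousOn (h.1.comp (by fun_prop) fun s hs => ?_)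
    exact mul_nonneg hε.le hs
  hasDerivWithinAt := fun φ s hs => by
    have h1 := h.2.2 φ (ε * s) (mul_nonneg hε.le hs)
    have h2 : HasDerivWithinAt (fun s : ℝ => ε * s) ε (Ici 0) s := by
      simpa using ((hasDerivAt_id s).const_mul ε).hasDerivWithinAt
    have h3 := (h1.scomp s h2 fun t ht => mul_nonneg hε.le ht).const_mul (-Complex.I / ε)
    have hε' : (ε : ℂ) ≠ 0 := by exact_mod_cast hε.ne'
    refine (h3.congr_deriv ?_).congr (fun t _ => ?_) ?_
    · rw [Complex.real_smul]; field_simp; ring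
    · simp only [Function.comp_apply]
      rw [show ∀ z : ℂ, -Complex.I / ε * (Complex.I * ε * z) = z from fun z => by
        field_simp; rw [Complex.I_sq]; ring]
    · simp only [Function.comp_apply]
      rw [show ∀ z : ℂ, -Complex.I / ε * (Complex.I * ε * z) = z from fun z => by
        field_simp; rw [Complex.I_sq]; ring]

/-! ### The power nonlinearity -/

section Nonlinearity

variable {n : ℕ} {σ ε : ℝ}

/-- The nonlinearity `ε^{nσ} |f|^{2σ} f`. -/
noncomputable def powerNonlinearity (σ ε : ℝ) (f : Rn n → ℂ) (x : Rn n) : ℂ :=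
  ((ε ^ ((n : ℝ) * σ) * ‖f x‖ ^ (2 * σ) : ℝ) : ℂ) * f x

lemma aestronglyMeasurable_powerNonlinearity {f : Rn n → ℂ} (hf : AEStronglyMeasurable f volume) :
    AEStronglyMeasurable (powerNonlinearity σ ε f) volume := by
  unfold powerNonlinearity
  exact (Complex.measurable_ofReal.comp_aemeasurable
    ((hf.norm.aemeasurable.pow_const _).const_mul _)).aestronglyMeasurable.mul hf

lemma norm_powerNonlinearity (hε : 0 < ε) (f : Rn n → ℂ) (x : Rn n) :
    ‖powerNonlinearity σ ε f x‖ = ε ^ ((n : ℝ) * σ) * (‖f x‖ ^ (2 * σ) * ‖f x‖) := by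
  rw [powerNonlinearity, norm_mul, Complex.norm_real, Real.norm_of_nonneg (by positivity), mul_assoc]

/-- The scaling of the potential energy is that of the norm `scLpNorm (2σ + 2)`. -/
lemma decayRate_mul (hσ : 0 < σ) : decayRate n (2 * σ + 2) * (2 * σ + 2) = n * σ := by
  unfold decayRate; field_simp; ring

lemma conjExponent_eq (σ : ℝ) : Real.conjExponent (2 * σ + 2) = (2 * σ + 2) / (2 * σ + 1) := by
  unfold Real.conjExponent; congr 1; ring

/-- A substitute for the mean value theorem, valid for all `s ≥ 0`: the factor `B` compensates for
the singularity of the derivative at `0` when `s < 1`. -/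
lemma rpow_sub_rpow_mul_le {s A B : ℝ} (hs : 0 ≤ s) (hB : 0 ≤ B) (hAB : B ≤ A) :
    (A ^ s - B ^ s) * B ≤ s * (A ^ s * (A - B)) := by
  rcases hB.eq_or_lt with h0 | hB0
  · rw [← h0, mul_zero, sub_zero]
    have : 0 ≤ A := hB.trans hAB
    positivity
  have hA0 : 0 < A := hB0.trans_le hAB
  have h1 : A ^ s * (1 - s * (A / B - 1)) ≤ B ^ s := by
    have h2 : B ^ s = A ^ s * Real.exp (-(s * Real.log (A / B))) := by
      rw [Real.log_div hA0.ne' hB0.ne', Real.rpow_def_of_pos hA0, Real.rpow_def_of_pos hB0,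
        ← Real.exp_add]
      congr 1; ring
    rw [h2]
    refine mul_le_mul_of_nonneg_left ?_ (by positivity)
    have h3 := Real.log_le_sub_one_of_pos (div_pos hA0 hB0)
    have h4 := Real.add_one_le_exp (-(s * Real.log (A / B)))
    nlinarith
  have h5 : s * (A ^ s * (A - B)) = A ^ s * (s * (A / B - 1)) * B := by field_simp
  rw [h5]
  refine mul_le_mul_of_nonneg_right ?_ hB
  linarith

/-- The map `z ↦ |z| ^ s z` is locally Lipschitz. -/
lemma norm_rpow_mul_sub_le {s : ℝ} (hs : 0 ≤ s) (a b : ℂ) :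
    ‖((‖a‖ ^ s : ℝ) : ℂ) * a - ((‖b‖ ^ s : ℝ) : ℂ) * b‖ ≤
      (s + 1) * ((‖a‖ + ‖b‖) ^ s * ‖a - b‖) := by
  wlog hab : ‖b‖ ≤ ‖a‖ generalizing a b
  · have h := this b a (le_of_not_ge hab)
    rwa [norm_sub_rev, norm_sub_rev b, add_comm ‖b‖] at h
  have h1 : ((‖a‖ ^ s : ℝ) : ℂ) * a - ((‖b‖ ^ s : ℝ) : ℂ) * b =
      ((‖a‖ ^ s : ℝ) : ℂ) * (a - b) + ((‖a‖ ^ s - ‖b‖ ^ s : ℝ) : ℂ) * b := by push_cast; ring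
  have h2 : ‖b‖ ^ s ≤ ‖a‖ ^ s := Real.rpow_le_rpow (norm_nonneg _) hab hs
  have h3 : ‖a‖ ^ s ≤ (‖a‖ + ‖b‖) ^ s :=
    Real.rpow_le_rpow (norm_nonneg _) (le_add_of_nonneg_right (norm_nonneg _)) hs
  have h4 := rpow_sub_rpow_mul_le hs (norm_nonneg b) hab
  have h5 : ‖a‖ - ‖b‖ ≤ ‖a - b‖ := norm_sub_norm_le a b
  have h6 : 0 ≤ ‖a‖ ^ s := by positivity
  rw [h1]
  refine (norm_add_le _ _).trans ?_
  rw [norm_mul, norm_mul, Complex.norm_real, Complex.norm_real, Real.norm_of_nonneg h6,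
    Real.norm_of_nonneg (sub_nonneg.2 h2)]
  calc ‖a‖ ^ s * ‖a - b‖ + (‖a‖ ^ s - ‖b‖ ^ s) * ‖b‖
      ≤ ‖a‖ ^ s * ‖a - b‖ + s * (‖a‖ ^ s * ‖a - b‖) := by
        have := mul_le_mul_of_nonneg_left (mul_le_mul_of_nonneg_left h5 h6) hs
        linarith
    _ = (s + 1) * (‖a‖ ^ s * ‖a - b‖) := by ring
    _ ≤ _ := by gcongr

/-- Hölder's inequality for products of the size of the nonlinearity, in scale invariant norms. -/
lemma scDualNorm_le_of_norm_le (hσ : 0 < σ) (hε : 0 < ε) {g d h : Rn n → ℂ}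
    (hg : AEStronglyMeasurable g volume) (hd : AEStronglyMeasurable d volume) {K : ℝ} (hK : 0 ≤ K)
    (hh : ∀ x, ‖h x‖ ≤ K * (ε ^ ((n : ℝ) * σ) * (‖g x‖ ^ (2 * σ) * ‖d x‖))) :
    scDualNorm (2 * σ + 2) ε h ≤ ENNReal.ofReal K *
      (scLpNorm (2 * σ + 2) ε g ^ (2 * σ) * scLpNorm (2 * σ + 2) ε d) := by
  set r := 2 * σ + 2 with hr
  have hT : ENNReal.HolderTriple (ENNReal.ofReal (r / (2 * σ))) (ENNReal.ofReal r)
      (ENNReal.ofReal (Real.conjExponent r)) := ⟨by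
    rw [hr, conjExponent_eq, ← ENNReal.ofReal_inv_of_pos (by positivity),
      ← ENNReal.ofReal_inv_of_pos (by positivity), ← ENNReal.ofReal_inv_of_pos (by positivity),
      ← ENNReal.ofReal_add (by positivity) (by positivity)]
    congr 1
    field_simp⟩
  have h1 : eLpNorm h (ENNReal.ofReal (Real.conjExponent r)) volume ≤
      ENNReal.ofReal (K * ε ^ ((n : ℝ) * σ)) *
        eLpNorm ((fun x => ‖g x‖ ^ (2 * σ)) • d) (ENNReal.ofReal (Real.conjExponent r)) volume := by
    refine eLpNorm_le_mul_eLpNorm_of_ae_le_mul (Eventually.of_forall fun x => ?_) _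
    rw [Pi.smul_apply', norm_smul, Real.norm_of_nonneg (by positivity), mul_assoc]
    exact hh x
  have h2 := eLpNorm_smul_le_mul_eLpNorm (r := ENNReal.ofReal (Real.conjExponent r)) hd
    (φ := fun x => ‖g x‖ ^ (2 * σ))
    (hg.norm.aemeasurable.pow_const _).aestronglyMeasurable (hpqr := hT)
  have h3 : eLpNorm (fun x => ‖g x‖ ^ (2 * σ)) (ENNReal.ofReal (r / (2 * σ))) volume =
      eLpNorm g (ENNReal.ofReal r) volume ^ (2 * σ) := by
    rw [eLpNorm_norm_rpow g (by positivity), ← ENNReal.ofReal_mul (by positivity)]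
    congr 3
    field_simp
  rw [h3] at h2
  unfold scDualNorm scLpNorm
  refine (mul_le_mul_right (h1.trans (mul_le_mul_right h2 _)) _).trans_eq ?_
  have h4 : ENNReal.ofReal (ε ^ (-decayRate n r)) * ENNReal.ofReal (K * ε ^ ((n : ℝ) * σ)) =
      ENNReal.ofReal K * (ENNReal.ofReal (ε ^ decayRate n r) ^ (2 * σ) *
        ENNReal.ofReal (ε ^ decayRate n r)) := by
    rw [ENNReal.ofReal_rpow_of_nonneg (by positivity) (by positivity),
      ← ENNReal.ofReal_mul (by positivity), ← ENNReal.ofReal_mul (by positivity),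
      ← ENNReal.ofReal_mul hK, mul_left_comm, ← Real.rpow_mul hε.le, ← Real.rpow_add hε,
      ← Real.rpow_add hε]
    congr 3
    have := decayRate_mul (n := n) hσ
    rw [← hr] at this
    rw [← this, hr]; ring
  rw [← mul_assoc, h4, ENNReal.mul_rpow_of_nonneg _ _ (by positivity)]
  ring

lemma scDualNorm_powerNonlinearity_le (hσ : 0 < σ) (hε : 0 < ε) {f : Rn n → ℂ}
    (hf : AEStronglyMeasurable f volume) : scDualNorm (2 * σ + 2) ε (powerNonlinearity σ ε f) ≤
      scLpNorm (2 * σ + 2) ε f ^ (2 * σ) * scLpNorm (2 * σ + 2) ε f := by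
  have h := scDualNorm_le_of_norm_le hσ hε hf hf zero_le_one (h := powerNonlinearity σ ε f)
    fun x => by rw [one_mul, norm_powerNonlinearity hε]
  rwa [ENNReal.ofReal_one, one_mul] at h

/-- The nonlinearity is locally Lipschitz from `L^r` to its dual, with constants independent of
`ε`. -/
lemma scDualNorm_powerNonlinearity_sub_le (hσ : 0 < σ) (hε : 0 < ε) {f g : Rn n → ℂ}
    (hf : AEStronglyMeasurable f volume) (hg : AEStronglyMeasurable g volume) :
    scDualNorm (2 * σ + 2) ε (powerNonlinearity σ ε f - powerNonlinearity σ ε g) ≤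
      ENNReal.ofReal (2 * σ + 1) * ((scLpNorm (2 * σ + 2) ε f + scLpNorm (2 * σ + 2) ε g) ^ (2 * σ) *
        scLpNorm (2 * σ + 2) ε (f - g)) := by
  have hm : ∀ {f : Rn n → ℂ}, AEStronglyMeasurable f volume →
      AEStronglyMeasurable (fun x => ((‖f x‖ : ℝ) : ℂ)) volume := fun hf =>
    Complex.continuous_ofReal.comp_aestronglyMeasurable hf.norm
  have hN : ∀ {f : Rn n → ℂ}, scLpNorm (2 * σ + 2) ε (fun x => ((‖f x‖ : ℝ) : ℂ)) =
      scLpNorm (2 * σ + 2) ε f := fun {f} => by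
    unfold scLpNorm
    rw [eLpNorm_congr_norm_ae (g := f) (Eventually.of_forall fun x => by simp)]
  have h := scDualNorm_le_of_norm_le hσ hε ((hm hf).add (hm hg)) (hf.sub hg) (K := 2 * σ + 1)
    (by positivity) (h := powerNonlinearity σ ε f - powerNonlinearity σ ε g) fun x => by
      have h1 := norm_rpow_mul_sub_le (s := 2 * σ) (by positivity) (f x) (g x)
      have h2 : (powerNonlinearity σ ε f - powerNonlinearity σ ε g) x = ((ε ^ ((n : ℝ) * σ) : ℝ) : ℂ) *
          (((‖f x‖ ^ (2 * σ) : ℝ) : ℂ) * f x - ((‖g x‖ ^ (2 * σ) : ℝ) : ℂ) * g x) := by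
        simp only [Pi.sub_apply, powerNonlinearity]; push_cast; ring
      rw [h2, norm_mul, Complex.norm_real, Real.norm_of_nonneg (by positivity), mul_left_comm]
      refine mul_le_mul_of_nonneg_left (h1.trans_eq ?_) (by positivity)
      rw [Pi.add_apply, ← Complex.ofReal_add, Complex.norm_real,
        Real.norm_of_nonneg (by positivity), Pi.sub_apply]
  refine h.trans ?_
  gcongr
  refine (scLpNorm_add_le (by linarith) (hm hf) (hm hg)).trans_eq ?_
  rw [hN, hN]

lemma scPotential_eq (hσ : 0 < σ) (hε : 0 < ε) (f : H1 n) :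
    H1.scPotential σ ε f = scLpNorm (2 * σ + 2) ε (H1.fn f) ^ (2 * σ + 2) := by
  rw [H1.scPotential, scLpNorm, ENNReal.mul_rpow_of_nonneg _ _ (by positivity),
    ENNReal.ofReal_rpow_of_nonneg (by positivity) (by positivity), ← Real.rpow_mul hε.le,
    decayRate_mul hσ]

end Nonlinearity

end

section

/-! ### Integral inequalities with a fractional kernel -/

section IntegralInequalities

variable {σ δ : ℝ}

/-- The Hardy–Littlewood–Sobolev relation between the exponents `k = 2σ / (1 - δ)` and `k / (2σ +
1)`. -/
lemma one_div_sub_one_div_critical (hσ : 0 < σ) (hδ1 : δ < 1) :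
    1 / (2 * σ / (1 - δ) / (2 * σ + 1)) - 1 / (2 * σ / (1 - δ)) = 1 - δ := by
  have h1 : 1 - δ ≠ 0 := by linarith
  field_simp
  ring

lemma one_lt_critical (hσ : 0 < σ) (hδ1 : δ < 1) (hδσ : 1 < δ * (2 * σ + 1)) :
    1 < 2 * σ / (1 - δ) / (2 * σ + 1) := by
  have h1 : 0 < 1 - δ := by linarith
  rw [lt_div_iff₀ (by positivity), lt_div_iff₀ h1]
  nlinarith

/-- Small solutions of `y ≤ z + |t|^{-δ} * y^{2σ+1}` are controlled by `z` in the scale invariant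
space `L^k`, `k = 2σ / (1 - δ)`. -/
lemma exists_lintegral_rpow_le_of_le_add_convolution (hσ : 0 < σ) (hδ0 : 0 < δ) (hδ1 : δ < 1)
    (hδσ : 1 < δ * (2 * σ + 1)) : ∃ A₀ : ℝ, 0 < A₀ ∧ ∀ (S : ℝ) (y z : ℝ → ℝ≥0∞), 0 ≤ S →
      Continuous y → (∀ s, y s ≠ ⊤) → Measurable z →
      (∀ s ∈ Icc 0 S, y s ≤ z s + ∫⁻ t in Icc 0 s, y t ^ (2 * σ + 1) * rieszKernel δ (t - s)) →
      ∀ A, 0 < A → A ≤ A₀ →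
      (∫⁻ s in Icc 0 S, z s ^ (2 * σ / (1 - δ))) ^ (1 / (2 * σ / (1 - δ))) ≤ ENNReal.ofReal A →
      (∫⁻ s in Icc 0 S, y s ^ (2 * σ / (1 - δ))) ^ (1 / (2 * σ / (1 - δ))) ≤
        ENNReal.ofReal (2 * A) := by
  have hm1 := one_lt_critical hσ hδ1 hδσ
  have hmk := one_div_sub_one_div_critical hσ hδ1
  set k := 2 * σ / (1 - δ) with hk
  set m := k / (2 * σ + 1) with hm
  have hkm : k = m * (2 * σ + 1) := by rw [hm]; field_simp
  have hk1 : 1 < k := by rw [hkm]; nlinarith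
  have hk0 : 0 < k := by linarith
  have hm0 : 0 < m := by linarith
  obtain ⟨C, hCt, hC⟩ := hardy_littlewood_sobolev_convolution hδ0 hδ1 hk1 hm1 hmk
  set c := C.toReal with hc
  have hc0 : 0 ≤ c := ENNReal.toReal_nonneg
  refine ⟨(2 ^ (2 * σ + 1) * (c + 1) * 2)⁻¹ ^ (1 / (2 * σ)), by positivity,
    fun S y z hS hy hyt hz hyz A hA hAA hzA => ?_⟩
  have hsmall : c * (2 * A) ^ (2 * σ + 1) < A := by
    have h1 : A ^ (2 * σ) ≤ (2 ^ (2 * σ + 1) * (c + 1) * 2)⁻¹ := by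
      refine (Real.rpow_le_rpow hA.le hAA (by positivity)).trans_eq ?_
      rw [← Real.rpow_mul (by positivity), one_div, inv_mul_cancel₀ (by positivity), Real.rpow_one]
    rw [Real.mul_rpow (by norm_num) hA.le, Real.rpow_add hA, Real.rpow_one]
    have h2 : c * (2 ^ (2 * σ + 1) * A ^ (2 * σ)) < 1 := by
      have h3 : (0 : ℝ) < 2 ^ (2 * σ + 1) := by positivity
      calc c * (2 ^ (2 * σ + 1) * A ^ (2 * σ)) ≤
            c * (2 ^ (2 * σ + 1) * (2 ^ (2 * σ + 1) * (c + 1) * 2)⁻¹) := by gcongr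
        _ = c / ((c + 1) * 2) := by field_simp
        _ < 1 := by rw [div_lt_one (by positivity)]; linarith
    calc _ = c * (2 ^ (2 * σ + 1) * A ^ (2 * σ)) * A := by ring
      _ < 1 * A := mul_lt_mul_of_pos_right h2 hA
      _ = A := one_mul A
  set Y : ℝ → ℝ≥0∞ := fun τ => (∫⁻ s in Icc 0 τ, y s ^ k) ^ (1 / k) with hY
  have key : ∀ τ ∈ Icc 0 S, Y τ ≤ ENNReal.ofReal A + C * Y τ ^ (2 * σ + 1) := by
    intro τ hτ
    set g : ℝ → ℝ≥0∞ := (Icc 0 τ).indicator fun t => y t ^ (2 * σ + 1) with hg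
    have hgm : Measurable g := (hy.measurable.pow_const _).indicator measurableSet_Icc
    set G : ℝ → ℝ≥0∞ := fun s => ∫⁻ t, g t * rieszKernel δ (t - s) with hG
    have hGm : Measurable G := by
      refine Measurable.lintegral_prod_right' (f := fun p : ℝ × ℝ => g p.2 * rieszKernel δ (p.2 - p.1)) ?_
      exact (hgm.comp measurable_snd).mul ((measurable_rieszKernel δ).comp (by fun_prop))
    have hgint : (∫⁻ s, g s ^ m) ^ (1 / m) = Y τ ^ (2 * σ + 1) := by
      have h1 : ∀ s, g s ^ m = (Icc 0 τ).indicator (fun t => y t ^ k) s := fun s => by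
        by_cases hs : s ∈ Icc 0 τ
        · rw [hg, indicator_of_mem hs, indicator_of_mem hs, ← ENNReal.rpow_mul, hkm, mul_comm]
        · rw [hg, indicator_of_notMem hs, indicator_of_notMem hs, ENNReal.zero_rpow_of_pos hm0]
      simp_rw [h1]
      rw [lintegral_indicator measurableSet_Icc, hY, ← ENNReal.rpow_mul, hkm]
      congr 1
      field_simp
    have hle : ∀ s ∈ Icc 0 τ, y s ≤ (z + G) s := fun s hs => by
      refine (hyz s ⟨hs.1, hs.2.trans hτ.2⟩).trans (add_le_add le_rfl ?_)
      rw [hG, ← lintegral_indicator measurableSet_Icc]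
      refine lintegral_mono fun t => ?_
      by_cases ht : t ∈ Icc 0 s
      · have ht' : t ∈ Icc 0 τ := ⟨ht.1, ht.2.trans hs.2⟩
        rw [indicator_of_mem ht, hg, indicator_of_mem ht']
      · rw [indicator_of_notMem ht]; exact bot_le
    calc Y τ ≤ (∫⁻ s in Icc 0 τ, (z + G) s ^ k) ^ (1 / k) := by
          refine ENNReal.rpow_le_rpow (setLIntegral_mono' measurableSet_Icc fun s hs => ?_) (by positivity)
          exact ENNReal.rpow_le_rpow (hle s hs) hk0.le
      _ ≤ (∫⁻ s in Icc 0 τ, z s ^ k) ^ (1 / k) + (∫⁻ s in Icc 0 τ, G s ^ k) ^ (1 / k) :=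
          ENNReal.lintegral_Lp_add_le hz.aemeasurable hGm.aemeasurable hk1.le
      _ ≤ (∫⁻ s in Icc 0 S, z s ^ k) ^ (1 / k) + (∫⁻ s, G s ^ k) ^ (1 / k) := by
          gcongr
          · exact hτ.2
          · exact Measure.restrict_le_self
      _ ≤ ENNReal.ofReal A + C * Y τ ^ (2 * σ + 1) := by
          rw [← hgint]
          exact add_le_add hzA (hC g hgm)
  by_contra hcon
  push Not at hcon
  -- the continuous function `τ ↦ Y τ ^ k` cannot jump over the value `(2 A) ^ k`
  set yr : ℝ → ℝ := fun s => (y s).toReal ^ k with hyr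
  have hyrc : Continuous yr := by
    have h1 : Continuous fun s => (y s).toReal := by
      rw [continuous_iff_continuousAt]
      exact fun s => (ENNReal.tendsto_toReal (hyt s)).comp hy.continuousAt
    exact h1.rpow_const fun _ => Or.inr hk0.le
  set Φ : ℝ → ℝ := fun τ => ∫ s in (0 : ℝ)..τ, yr s with hΦ
  have hΦc : Continuous Φ := intervalIntegral.continuous_primitive
    (fun a b => hyrc.intervalIntegrable a b) 0
  have hΦY : ∀ τ, 0 ≤ τ → Y τ = ENNReal.ofReal (Φ τ) ^ (1 / k) := fun τ hτ => by
    have h0 : ∀ s, 0 ≤ yr s := fun s => by positivity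
    simp only [hΦ, hY]
    rw [intervalIntegral.integral_of_le hτ, ← integral_Icc_eq_integral_Ioc,
      ofReal_integral_eq_lintegral_ofReal (hyrc.integrableOn_Icc)
        (Eventually.of_forall h0)]
    congr 1
    refine lintegral_congr fun s => ?_
    rw [hyr, ← ENNReal.ofReal_rpow_of_nonneg ENNReal.toReal_nonneg hk0.le, ENNReal.ofReal_toReal (hyt s)]
  have hΦ0 : Φ 0 = 0 := intervalIntegral.integral_same
  have hΦS : (2 * A) ^ k < Φ S := by
    have h1 : ENNReal.ofReal (2 * A) < ENNReal.ofReal (Φ S) ^ (1 / k) := hcon.trans_eq (hΦY S hS)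
    rw [one_div, ENNReal.lt_rpow_inv_iff hk0,
      ENNReal.ofReal_rpow_of_nonneg (by positivity) hk0.le] at h1
    exact (ENNReal.ofReal_lt_ofReal_iff_of_nonneg (by positivity)).1 h1
  obtain ⟨τ, hτ, hτA⟩ := intermediate_value_Icc hS hΦc.continuousOn
    (show (2 * A) ^ k ∈ Icc (Φ 0) (Φ S) from ⟨by rw [hΦ0]; positivity, hΦS.le⟩)
  have hYτ : Y τ = ENNReal.ofReal (2 * A) := by
    rw [hΦY τ hτ.1, hτA, ENNReal.ofReal_rpow_of_nonneg (by positivity) (by positivity),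
      ← Real.rpow_mul (by positivity), mul_one_div_cancel hk0.ne', Real.rpow_one]
  have h1 := key τ hτ
  rw [hYτ, ← ENNReal.ofReal_toReal hCt, ENNReal.ofReal_rpow_of_nonneg (by positivity) (by positivity),
    ← ENNReal.ofReal_mul hc0, ← ENNReal.ofReal_add hA.le (by positivity),
    ENNReal.ofReal_le_ofReal_iff (by positivity)] at h1
  linarith

/-- Hölder's inequality for the exponents `1 / q' = (1 - δ) + 1 / q`, where `q = 2 / δ`. -/
lemma lintegral_rpow_mul_rpow_le (σ : ℝ) {δ : ℝ} (hδ0 : 0 < δ) (hδ1 : δ < 1) (I : Set ℝ)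
    {y d : ℝ → ℝ≥0∞} (hy : Measurable y) (hd : Measurable d) :
    (∫⁻ s in I, (y s ^ (2 * σ) * d s) ^ (Real.conjExponent (2 / δ))) ^
        (1 / Real.conjExponent (2 / δ)) ≤
      (∫⁻ s in I, y s ^ (2 * σ / (1 - δ))) ^ (1 - δ) * (∫⁻ s in I, d s ^ (2 / δ)) ^ (1 / (2 / δ)) := by
  have hδ' : 0 < 1 - δ := by linarith
  have hq2 : 2 < 2 / δ := by rw [lt_div_iff₀ hδ0]; linarith
  have hqq : (2 / δ).HolderConjugate (Real.conjExponent (2 / δ)) := holderConjugate_conjExponent hq2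
  have hinv : 1 / Real.conjExponent (2 / δ) = 1 / (1 / (1 - δ)) + 1 / (2 / δ) := by
    have := hqq.inv_add_inv_eq_one
    rw [inv_div] at this
    rw [one_div_one_div, one_div_div, one_div]; linarith
  have hlt : Real.conjExponent (2 / δ) < 1 / (1 - δ) := by
    rw [← one_div_lt_one_div (by positivity) hqq.symm.pos, hinv]
    have : 0 < 1 / (2 / δ) := by positivity
    linarith
  have h := ENNReal.lintegral_Lp_mul_le_Lq_mul_Lr hqq.symm.pos hlt hinv (volume.restrict I)
    (f := fun s => y s ^ (2 * σ)) (g := d) (hy.pow_const _).aemeasurable hd.aemeasurable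
  simp only [Pi.mul_apply, ← ENNReal.rpow_mul, mul_one_div, one_div_one_div] at h
  exact h

/-- If `y` is small in `L^k`, then the fractional integral term in `d ≤ d₀ + |t|^{-δ} * (y^{2σ}
d)` is absorbed, and `d` is controlled by `d₀` in the Strichartz space `L^q`, `q = 2 / δ`. -/
lemma exists_lintegral_rpow_le_of_le_add_mul_convolution (σ : ℝ) {δ : ℝ} (hδ0 : 0 < δ) (hδ1 : δ < 1) :
    ∃ C : ℝ≥0∞, C ≠ ⊤ ∧ ∀ (S : ℝ) (y d d₀ : ℝ → ℝ≥0∞) (K : ℝ≥0∞), Measurable y → Measurable d →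
      Measurable d₀ → (∀ s ∈ Icc 0 S, d s ≤ d₀ s +
        ∫⁻ t in Icc 0 s, K * (y t ^ (2 * σ) * d t) * rieszKernel δ (t - s)) →
      ∫⁻ s in Icc 0 S, d s ^ (2 / δ) ≠ ⊤ →
      C * K * (∫⁻ s in Icc 0 S, y s ^ (2 * σ / (1 - δ))) ^ (1 - δ) ≤ 2⁻¹ →
      (∫⁻ s in Icc 0 S, d s ^ (2 / δ)) ^ (1 / (2 / δ)) ≤
        2 * (∫⁻ s in Icc 0 S, d₀ s ^ (2 / δ)) ^ (1 / (2 / δ)) := by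
  have hq2 : 2 < 2 / δ := by rw [lt_div_iff₀ hδ0]; linarith
  have hqq : (2 / δ).HolderConjugate (Real.conjExponent (2 / δ)) := holderConjugate_conjExponent hq2
  have hinv : 1 / Real.conjExponent (2 / δ) - 1 / (2 / δ) = 1 - δ := by
    have := hqq.inv_add_inv_eq_one
    rw [inv_div] at this
    rw [one_div_div, one_div]; linarith
  have hhold := fun I y d => lintegral_rpow_mul_rpow_le (y := y) (d := d) σ hδ0 hδ1 I
  set q := 2 / δ with hq
  set q' := Real.conjExponent q with hq'
  have hq0 : 0 < q := by linarith
  have hq'0 : 0 < q' := hqq.symm.pos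
  obtain ⟨C, hCt, hC⟩ := hardy_littlewood_sobolev_convolution hδ0 hδ1 hqq.lt hqq.symm.lt hinv
  refine ⟨C, hCt, fun S y d d₀ K hy hd hd₀ hle hfin hsmall => ?_⟩
  set g : ℝ → ℝ≥0∞ := (Icc 0 S).indicator fun t => K * (y t ^ (2 * σ) * d t) with hg
  have hgm : Measurable g :=
    (((hy.pow_const _).mul hd).const_mul K).indicator measurableSet_Icc
  set G : ℝ → ℝ≥0∞ := fun s => ∫⁻ t, g t * rieszKernel δ (t - s) with hG
  have hGm : Measurable G := by
    refine Measurable.lintegral_prod_right' (f := fun p : ℝ × ℝ => g p.2 * rieszKernel δ (p.2 - p.1)) ?_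
    exact (hgm.comp measurable_snd).mul ((measurable_rieszKernel δ).comp (by fun_prop))
  set Y := (∫⁻ s in Icc 0 S, y s ^ (2 * σ / (1 - δ))) ^ (1 - δ) with hY
  set D := (∫⁻ s in Icc 0 S, d s ^ q) ^ (1 / q) with hD
  have hDt : D ≠ ⊤ := ENNReal.rpow_ne_top_of_nonneg (by positivity) hfin
  have hgint : (∫⁻ s, g s ^ q') ^ (1 / q') ≤ K * (Y * D) := by
    have h1 : ∀ s, g s ^ q' = (Icc 0 S).indicator (fun t => K ^ q' * (y t ^ (2 * σ) * d t) ^ q') s := fun s => by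
      by_cases hs : s ∈ Icc 0 S
      · rw [hg, indicator_of_mem hs, indicator_of_mem hs, ENNReal.mul_rpow_of_nonneg _ _ hq'0.le]
      · rw [hg, indicator_of_notMem hs, indicator_of_notMem hs, ENNReal.zero_rpow_of_pos hq'0]
    have hydm : Measurable fun t => y t ^ (2 * σ) * d t := (hy.pow_const _).mul hd
    simp_rw [h1]
    rw [lintegral_indicator measurableSet_Icc, lintegral_const_mul _ (hydm.pow_const q'),
      ENNReal.mul_rpow_of_nonneg _ _ (by positivity), ← ENNReal.rpow_mul, mul_one_div_cancel hq'0.ne',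
      ENNReal.rpow_one]
    gcongr
    exact hhold _ _ _ hy hd
  have hle' : ∀ s ∈ Icc 0 S, d s ≤ (d₀ + G) s := fun s hs => by
    refine (hle s hs).trans (add_le_add le_rfl ?_)
    rw [hG, ← lintegral_indicator measurableSet_Icc]
    refine lintegral_mono fun t => ?_
    by_cases ht : t ∈ Icc 0 s
    · have ht' : t ∈ Icc 0 S := ⟨ht.1, ht.2.trans hs.2⟩
      rw [indicator_of_mem ht, hg, indicator_of_mem ht']
    · rw [indicator_of_notMem ht]; exact bot_le
  have hmain : D ≤ (∫⁻ s in Icc 0 S, d₀ s ^ q) ^ (1 / q) + 2⁻¹ * D := by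
    calc D ≤ (∫⁻ s in Icc 0 S, (d₀ + G) s ^ q) ^ (1 / q) := by
          refine ENNReal.rpow_le_rpow (setLIntegral_mono' measurableSet_Icc fun s hs => ?_) (by positivity)
          exact ENNReal.rpow_le_rpow (hle' s hs) hq0.le
      _ ≤ (∫⁻ s in Icc 0 S, d₀ s ^ q) ^ (1 / q) + (∫⁻ s in Icc 0 S, G s ^ q) ^ (1 / q) :=
          ENNReal.lintegral_Lp_add_le hd₀.aemeasurable hGm.aemeasurable hqq.lt.le
      _ ≤ (∫⁻ s in Icc 0 S, d₀ s ^ q) ^ (1 / q) + (∫⁻ s, G s ^ q) ^ (1 / q) := by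
          gcongr
          exact Measure.restrict_le_self
      _ ≤ _ := by
          refine add_le_add le_rfl (((hC g hgm).trans (mul_le_mul_right hgint C)).trans ?_)
          calc C * (K * (Y * D)) = C * K * Y * D := by ring
            _ ≤ 2⁻¹ * D := by gcongr
  have h2 : D = 2⁻¹ * D + 2⁻¹ * D := by
    rw [← add_mul, ENNReal.inv_two_add_inv_two, one_mul]
  have hhalf : 2⁻¹ * D ≤ (∫⁻ s in Icc 0 S, d₀ s ^ q) ^ (1 / q) := by
    have h3 : 2⁻¹ * D ≠ ⊤ := ENNReal.mul_ne_top (by simp) hDt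
    refine (ENNReal.add_le_add_iff_right h3).1 ?_
    rw [← h2]; exact hmain
  calc D = 2 * (2⁻¹ * D) := by
        rw [← mul_assoc, ENNReal.mul_inv_cancel two_ne_zero ENNReal.ofNat_ne_top, one_mul]
    _ ≤ _ := by gcongr

end IntegralInequalities

end

section

/-! ### Stability of the nonlinear flow for small nonfocusing free evolutions -/

open SchwartzMap

variable {n : ℕ} {r σ ε : ℝ}

lemma SchwartzMap.IsForcedSchrodinger.congr {w w' : ℝ → L2 n} {F F' : ℝ → Rn n → ℂ}
    (h : IsForcedSchrodinger ε w F) (hw : ∀ s, 0 ≤ s → w' s = w s) (hF : ∀ s, 0 ≤ s → F' s = F s) :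
    IsForcedSchrodinger ε w' F' where
  continuousOn := h.continuousOn.congr fun s hs => hw s hs
  hasDerivWithinAt := fun φ s hs => by
    rw [hF s hs, hw s hs]
    exact (h.hasDerivWithinAt φ s hs).congr (fun t ht => by rw [hw t ht]) (by rw [hw s hs])

/-- The `L²` norm, computed by testing against Schwartz functions. -/
lemma norm_le_of_forall_schwartz {f : L2 n} {D : ℝ} (hD : 0 ≤ D)
    (h : ∀ φ : 𝓢(Rn n, ℂ), ‖∫ x, f x * φ x‖ ≤ D * ‖φ.toLp 2 volume‖) : ‖f‖ ≤ D := by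
  have h2 : Real.HolderConjugate 2 2 := Real.HolderConjugate.two_two
  have h1 := eLpNorm_le_of_forall_schwartz (n := n) (r := 2) le_rfl h2 (h := f) (C := ENNReal.ofReal D)
    ((Lp.memLp f).locallyIntegrable (by norm_num)) fun φ => by
      rw [ENNReal.ofReal_ofNat, eLpNorm_toLp_two, ← ENNReal.ofReal_mul hD, ← ofReal_norm]
      exact ENNReal.ofReal_le_ofReal (h φ)
  rw [ENNReal.ofReal_ofNat, ← Lp.enorm_def, ← ofReal_norm, ENNReal.ofReal_le_ofReal_iff hD] at h1
  exact h1

lemma norm_grad_le_scNorm (hε : 0 < ε) (f : H1 n) (i : Fin n) : ε * ‖H1.grad f i‖ ≤ H1.scNorm ε f := by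
  have h1 : ‖H1.grad f i‖ ≤ ‖H1.grad f‖ := PiLp.norm_apply_le _ _
  rw [H1.scNorm, norm_smul, Real.norm_of_nonneg hε.le]
  have := mul_le_mul_of_nonneg_left h1 hε.le
  linarith [norm_nonneg (H1.fn f)]

lemma norm_fn_le_scNorm (f : H1 n) : ‖H1.fn f‖ ≤ H1.scNorm ε f := by
  rw [H1.scNorm]
  linarith [norm_nonneg (ε • H1.grad f)]

/-- Semiclassical Sobolev inequality for elements of `H¹`. -/
lemma exists_scLpNorm_fn_le (hn : 1 ≤ n) (hr : 2 < r) (hδ : decayRate n r < 1) :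
    ∃ C : ℝ, 0 ≤ C ∧ ∀ ε : ℝ, 0 < ε → ∀ f : H1 n,
      scLpNorm r ε (H1.fn f) ≤ ENNReal.ofReal (C * H1.scNorm ε f) := by
  obtain ⟨C, hC0, hC⟩ := exists_scLpNorm_le hn hr hδ
  exact ⟨C, hC0, fun ε hε f => (hC ε hε _ _ (H1.hasWeakGradient f) _ (norm_fn_le_scNorm f)
    (norm_grad_le_scNorm hε f)).1⟩

lemma scLpNorm_fn_ne_top (hn : 1 ≤ n) (hr : 2 < r) (hδ : decayRate n r < 1) (hε : 0 < ε) (f : H1 n) :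
    scLpNorm r ε (H1.fn f) ≠ ⊤ := by
  obtain ⟨C, -, hC⟩ := exists_scLpNorm_fn_le hn hr hδ
  exact ne_top_of_le_ne_top ENNReal.ofReal_ne_top (hC ε hε f)

/-- A pair of adjoint operators commuting with the Schrödinger group, for which the nonlinearity
satisfies a Lipschitz bound: the identity, or the difference of a translation and the identity. -/
structure IsFlowSymmetry (σ K : ℝ) (A : L2 n →L[ℂ] L2 n) (B : 𝓢(Rn n, ℂ) → 𝓢(Rn n, ℂ)) : Prop where
  integral_mul : ∀ (f : L2 n) (φ : 𝓢(Rn n, ℂ)), ∫ x, A f x * φ x = ∫ x, f x * B φ x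
  comm : ∀ (a : ℝ) (φ : 𝓢(Rn n, ℂ)), B (schrodinger a φ) = schrodinger a (B φ)
  scLpNorm_le : ∀ (ε : ℝ) (f : L2 n), scLpNorm (2 * σ + 2) ε (A f) ≤ 2 * scLpNorm (2 * σ + 2) ε f
  nonlinearity_le : ∀ ε : ℝ, 0 < ε → ∀ f : L2 n, scLpNorm (2 * σ + 2) ε f ≠ ⊤ →
    ∀ χ : 𝓢(Rn n, ℂ), ‖∫ x, powerNonlinearity σ ε f x * B χ x‖ₑ ≤
      ENNReal.ofReal K * (scLpNorm (2 * σ + 2) ε f ^ (2 * σ) * scLpNorm (2 * σ + 2) ε (A f)) *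
        scLpNorm (2 * σ + 2) ε χ

variable {K : ℝ} {A : L2 n →L[ℂ] L2 n} {B : 𝓢(Rn n, ℂ) → 𝓢(Rn n, ℂ)}

lemma isFlowSymmetry_id (hσ : 0 < σ) :
    IsFlowSymmetry (n := n) σ 1 (ContinuousLinearMap.id ℂ (L2 n)) id where
  integral_mul _ _ := rfl
  comm _ _ := rfl
  scLpNorm_le ε f := by
    exact le_mul_of_one_le_left (bot_le : 0 ≤ scLpNorm (2 * σ + 2) ε f) one_le_two
  nonlinearity_le ε hε f _ χ := by
    have hf := Lp.aestronglyMeasurable f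
    rw [ENNReal.ofReal_one, one_mul]
    simp_rw [mul_comm (powerNonlinearity σ ε f _)]
    refine (enorm_integral_mul_le_scNorm (by linarith : (2 : ℝ) < 2 * σ + 2) hε
      χ.continuous.aestronglyMeasurable (aestronglyMeasurable_powerNonlinearity hf)).trans ?_
    rw [mul_comm]
    exact mul_le_mul_left (scDualNorm_powerNonlinearity_le hσ hε hf) _

lemma scLpNorm_coe_add_le (hr : 2 < r) (f g : L2 n) :
    scLpNorm r ε (f + g : L2 n) ≤ scLpNorm r ε f + scLpNorm r ε g := by
  rw [scLpNorm_congr_ae (Lp.coeFn_add f g)]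
  exact scLpNorm_add_le hr (Lp.aestronglyMeasurable f) (Lp.aestronglyMeasurable g)

/-- By the Sobolev embedding, the `L^r` norm is continuous along curves in `H¹`. -/
lemma continuous_scLpNorm_fn (hn : 1 ≤ n) (hσ : 0 < σ) (hδ : decayRate n (2 * σ + 2) < 1) (hε : 0 < ε)
    (hA : ∀ f : L2 n, scLpNorm (2 * σ + 2) ε (A f) ≤ 2 * scLpNorm (2 * σ + 2) ε f) {U : ℝ → H1 n}
    (hU : Continuous U) : Continuous fun s => scLpNorm (2 * σ + 2) ε (A (H1.fn (U s))) := by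
  have hr : (2 : ℝ) < 2 * σ + 2 := by linarith
  obtain ⟨C, hC0, hC⟩ := exists_scLpNorm_fn_le hn hr hδ
  have ht : ∀ f : H1 n, scLpNorm (2 * σ + 2) ε (A (H1.fn f)) ≠ ⊤ := fun f =>
    ne_top_of_le_ne_top (ENNReal.mul_ne_top ENNReal.ofNat_ne_top (scLpNorm_fn_ne_top hn hr hδ hε f))
      (hA _)
  have hsc : ∀ f : H1 n, H1.scNorm ε f ≤ (1 + ε) * ‖f‖ := fun f => by
    have h1 : ‖H1.fn f‖ ≤ ‖f‖ := norm_fst_le (f : L2 n × L2Vec n)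
    have h2 : ‖H1.grad f‖ ≤ ‖f‖ := norm_snd_le (f : L2 n × L2Vec n)
    rw [H1.scNorm, norm_smul, Real.norm_of_nonneg hε.le]
    nlinarith
  have hle : ∀ f g : H1 n, scLpNorm (2 * σ + 2) ε (A (H1.fn f)) ≤
      scLpNorm (2 * σ + 2) ε (A (H1.fn g)) + ENNReal.ofReal (2 * (C * ((1 + ε) * ‖f - g‖))) := fun f g => by
    have h1 : A (H1.fn f) = A (H1.fn g) + A (H1.fn (f - g)) := by
      rw [← map_add]; congr 1
      change H1.fn f = H1.fn g + (H1.fn f - H1.fn g)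
      abel
    rw [h1]
    refine (scLpNorm_coe_add_le hr _ _).trans (add_le_add le_rfl ((hA _).trans ?_))
    rw [ENNReal.ofReal_mul (by norm_num), ENNReal.ofReal_ofNat]
    gcongr
    refine (hC ε hε _).trans (ENNReal.ofReal_le_ofReal ?_)
    gcongr
    exact hsc _
  have hlip : LipschitzWith (Real.toNNReal (2 * (C * (1 + ε))))
      fun f : H1 n => (scLpNorm (2 * σ + 2) ε (A (H1.fn f))).toReal := by
    refine LipschitzWith.of_le_add_mul _ fun f g => ?_
    rw [Real.coe_toNNReal _ (by positivity), dist_eq_norm]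
    have h1 := ENNReal.toReal_mono (by finiteness [ht g]) (hle f g)
    rw [ENNReal.toReal_add (ht g) ENNReal.ofReal_ne_top, ENNReal.toReal_ofReal (by positivity)] at h1
    refine h1.trans_eq ?_
    ring
  have h2 : (fun s => scLpNorm (2 * σ + 2) ε (A (H1.fn (U s)))) =
      fun s => ENNReal.ofReal (scLpNorm (2 * σ + 2) ε (A (H1.fn (U s)))).toReal := by
    ext s; rw [ENNReal.ofReal_toReal (ht _)]
  rw [h2]
  exact ENNReal.continuous_ofReal.comp (hlip.continuous.comp hU)

/-- The free evolution of a Schwartz function is bounded in `L^r` on bounded time intervals, by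
Sobolev embedding rather than dispersion, which is singular at time `0`. -/
lemma exists_scLpNorm_schrodinger_le (hn : 1 ≤ n) (hr : 2 < r) (hδ : decayRate n r < 1) (hε : 0 < ε)
    (φ : 𝓢(Rn n, ℂ)) (s₁ : ℝ) : ∃ D : ℝ, ∀ s, |s| ≤ s₁ →
      scLpNorm r ε (schrodinger (ε ^ 2 * s) φ) ≤ ENNReal.ofReal D := by
  obtain ⟨C, hC0, hC⟩ := exists_scLpNorm_le hn hr hδ
  set M := ‖φ.toLp 2 volume‖ + ∑ i : Fin n,
    ε * ‖(∂_{(EuclideanSpace.single i (1 : ℝ) : Rn n)} φ).toLp 2 volume‖ with hM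
  have h0 : ∀ i : Fin n, 0 ≤ ε * ‖(∂_{(EuclideanSpace.single i (1 : ℝ) : Rn n)} φ).toLp 2 volume‖ :=
    fun i => by positivity
  have hM0 : 0 ≤ M := add_nonneg (norm_nonneg _) (Finset.sum_nonneg fun i _ => h0 i)
  obtain ⟨h1, h2⟩ := hC ε hε _ _ (hasWeakGradient_toLp φ) M
    (le_add_of_nonneg_right (Finset.sum_nonneg fun i _ => h0 i))
    (fun i => (Finset.single_le_sum (fun i _ => h0 i) (Finset.mem_univ i)).trans
      (le_add_of_nonneg_left (norm_nonneg _)))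
  have hδ0 := decayRate_pos hn hr
  refine ⟨C * M * |s₁| ^ ((1 - decayRate n r) / 4) + C * M, fun s hs => ?_⟩
  have h3 := h2 s ((schrodinger (ε ^ 2 * s) φ).toLp 2 volume) fun χ => by
    rw [integral_toLp_mul, integral_toLp_mul, integral_schrodinger_mul]
  have h4 := scLpNorm_coe_add_le (ε := ε) hr ((schrodinger (ε ^ 2 * s) φ).toLp 2 volume - φ.toLp 2 volume)
    (φ.toLp 2 volume)
  rw [sub_add_cancel, scLpNorm_congr_ae (coeFn_toLp _ 2 volume)] at h4
  refine h4.trans ?_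
  rw [ENNReal.ofReal_add (by positivity) (by positivity)]
  refine add_le_add (h3.trans (ENNReal.ofReal_le_ofReal ?_)) h1
  exact mul_le_mul_of_nonneg_left (Real.rpow_le_rpow (abs_nonneg _) (hs.trans (le_abs_self _))
    (by linarith)) (by positivity)

end

section

open SchwartzMap

section Stability

variable {n : ℕ} {σ ε K : ℝ} {A : L2 n →L[ℂ] L2 n} {B : 𝓢(Rn n, ℂ) → 𝓢(Rn n, ℂ)} {U : ℝ → H1 n}

/-- Duhamel's formula tested against `B φ`, with the Lipschitz bound on the nonlinearity. -/
lemma enorm_integral_sub_free_le (hn : 1 ≤ n) (hσ : 0 < σ) (hδ : decayRate n (2 * σ + 2) < 1)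
    (hε : 0 < ε) (hAB : IsFlowSymmetry σ K A B) (hUc : Continuous U)
    (hU : IsForcedSchrodinger ε (fun s => H1.fn (U s))
      (fun s => powerNonlinearity σ ε (H1.fn (U s)))) {s : ℝ} (hs : 0 ≤ s) (φ : 𝓢(Rn n, ℂ)) :
    ‖(∫ x, A (H1.fn (U s)) x * φ x) -
        ∫ x, A (H1.fn (U 0)) x * schrodinger (ε ^ 2 * s) φ x‖ₑ ≤
      ∫⁻ t in Icc 0 s, ENNReal.ofReal K * (scLpNorm (2 * σ + 2) ε (H1.fn (U t)) ^ (2 * σ) *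
        scLpNorm (2 * σ + 2) ε (A (H1.fn (U t)))) *
          scLpNorm (2 * σ + 2) ε (schrodinger (ε ^ 2 * (s - t)) φ) := by
  have hr : (2 : ℝ) < 2 * σ + 2 := by linarith
  have hpt : ∀ t, ‖∫ x, powerNonlinearity σ ε (H1.fn (U t)) x * schrodinger (ε ^ 2 * (s - t)) (B φ) x‖ₑ ≤
      ENNReal.ofReal K * (scLpNorm (2 * σ + 2) ε (H1.fn (U t)) ^ (2 * σ) *
        scLpNorm (2 * σ + 2) ε (A (H1.fn (U t)))) *
          scLpNorm (2 * σ + 2) ε (schrodinger (ε ^ 2 * (s - t)) φ) := fun t => by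
    rw [← hAB.comm]
    exact hAB.nonlinearity_le ε hε _ (scLpNorm_fn_ne_top hn hr hδ hε _) _
  obtain ⟨D, hD⟩ := exists_scLpNorm_schrodinger_le hn hr hδ hε φ s
  set y : ℝ → ℝ≥0∞ := fun t => scLpNorm (2 * σ + 2) ε (H1.fn (U t)) with hy
  set d : ℝ → ℝ≥0∞ := fun t => scLpNorm (2 * σ + 2) ε (A (H1.fn (U t))) with hd
  have hyc : Continuous y := continuous_scLpNorm_fn hn hσ hδ hε (A := ContinuousLinearMap.id ℂ (L2 n))
    ((isFlowSymmetry_id hσ).scLpNorm_le ε) hUc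
  have hdc : Continuous d := continuous_scLpNorm_fn hn hσ hδ hε (hAB.scLpNorm_le ε) hUc
  have hyt : ∀ t, y t ≠ ⊤ := fun t => scLpNorm_fn_ne_top hn hr hδ hε _
  have hdt : ∀ t, d t ≠ ⊤ := fun t =>
    ne_top_of_le_ne_top (ENNReal.mul_ne_top ENNReal.ofNat_ne_top (hyt t)) (hAB.scLpNorm_le ε _)
  obtain ⟨t₁, -, ht₁⟩ := isCompact_Icc.exists_isMaxOn (nonempty_Icc.2 hs) hyc.continuousOn
  obtain ⟨t₂, -, ht₂⟩ := isCompact_Icc.exists_isMaxOn (nonempty_Icc.2 hs) hdc.continuousOn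
  set bd : ℝ≥0∞ := ENNReal.ofReal K * (y t₁ ^ (2 * σ) * d t₂) * ENNReal.ofReal D with hbd
  have hbdt : bd ≠ ⊤ := by
    have h1 : y t₁ ^ (2 * σ) ≠ ⊤ := ENNReal.rpow_ne_top_of_nonneg (by positivity) (hyt t₁)
    exact ENNReal.mul_ne_top (ENNReal.mul_ne_top ENNReal.ofReal_ne_top (ENNReal.mul_ne_top h1 (hdt t₂)))
      ENNReal.ofReal_ne_top
  have h := hU.enorm_sub_le le_rfl hs (B φ) (K := bd.toReal) fun t ht => by
    rw [← ENNReal.ofReal_le_iff_le_toReal hbdt, ofReal_norm]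
    refine (hpt t).trans ?_
    have h1 : y t ≤ y t₁ := ht₁ ht
    have h2 : d t ≤ d t₂ := ht₂ ht
    refine mul_le_mul' (mul_le_mul_right (mul_le_mul' (ENNReal.rpow_le_rpow h1 (by positivity)) h2) _)
      (hD _ ?_)
    rw [abs_le]
    constructor <;> linarith [ht.1, ht.2]
  rw [hAB.integral_mul, hAB.integral_mul, hAB.comm]
  rw [sub_zero] at h
  exact h.trans (lintegral_mono hpt)

/-- The integral inequality satisfied by `N(A u)`, where `d₀` dominates the free part. -/
lemma scLpNorm_le_add_convolution (hn : 1 ≤ n) (hσ : 0 < σ) (hδ : decayRate n (2 * σ + 2) < 1)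
    (hε : 0 < ε) (hAB : IsFlowSymmetry σ K A B) (hUc : Continuous U)
    (hU : IsForcedSchrodinger ε (fun s => H1.fn (U s))
      (fun s => powerNonlinearity σ ε (H1.fn (U s)))) {s : ℝ} (hs : 0 ≤ s) {d₀ : ℝ≥0∞}
    (hd₀ : ∀ φ : 𝓢(Rn n, ℂ), ‖∫ x, A (H1.fn (U 0)) x * schrodinger (ε ^ 2 * s) φ x‖ₑ ≤
      d₀ * scDualNorm (2 * σ + 2) ε φ) :
    scLpNorm (2 * σ + 2) ε (A (H1.fn (U s))) ≤ d₀ + ∫⁻ t in Icc 0 s,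
      ENNReal.ofReal K * (scLpNorm (2 * σ + 2) ε (H1.fn (U t)) ^ (2 * σ) *
        scLpNorm (2 * σ + 2) ε (A (H1.fn (U t)))) * rieszKernel (decayRate n (2 * σ + 2)) (t - s) := by
  have hr : (2 : ℝ) < 2 * σ + 2 := by linarith
  refine scLpNorm_lp_le_of_forall_schwartz hr hε _ fun φ => ?_
  have h := enorm_integral_sub_free_le hn hσ hδ hε hAB hUc hU hs φ
  set a := ∫ x, A (H1.fn (U s)) x * φ x with ha
  set b := ∫ x, A (H1.fn (U 0)) x * schrodinger (ε ^ 2 * s) φ x with hb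
  have h1 : ‖a‖ₑ ≤ ‖b‖ₑ + ‖a - b‖ₑ := by
    have := enorm_add_le b (a - b)
    rwa [add_sub_cancel] at this
  refine h1.trans ?_
  rw [add_mul]
  refine add_le_add (hd₀ φ) (h.trans ?_)
  rw [← lintegral_mul_const' _ _ (scDualNorm_schwartz_ne_top φ)]
  refine lintegral_mono_ae ?_
  have hne : ∀ᵐ t : ℝ ∂(volume.restrict (Icc 0 s)), t ≠ s :=
    ae_restrict_of_ae (by simp [ae_iff, measure_singleton])
  filter_upwards [hne] with t ht
  rw [mul_assoc _ (rieszKernel _ _)]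
  refine mul_le_mul_right ?_ _
  have h2 := scLpNorm_schrodinger_le hr hε (sub_ne_zero.2 ht.symm) φ
  rwa [← rieszKernel_neg, neg_sub] at h2

/-- If the free evolution is small in the scale invariant norm, then the nonlinear evolution stays
close to it in `L²`, together with its finite differences. -/
theorem exists_norm_apply_sub_le (hn : 1 ≤ n) (hσ : 0 < σ) (hδ : decayRate n (2 * σ + 2) < 1)
    (hδσ : 1 < decayRate n (2 * σ + 2) * (2 * σ + 1)) (hK : 0 ≤ K) :
    ∃ C a₀ : ℝ, 0 ≤ C ∧ 0 < a₀ ∧ ∀ ε : ℝ, 0 < ε → ∀ U V : ℝ → H1 n, Continuous U →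
      Continuous V →
      IsForcedSchrodinger ε (fun s => H1.fn (U s)) (fun s => powerNonlinearity σ ε (H1.fn (U s))) →
      IsForcedSchrodinger ε (fun s => H1.fn (V s)) 0 → H1.fn (U 0) = H1.fn (V 0) →
      ∀ S a : ℝ, 0 ≤ S → 0 < a → a ≤ a₀ →
      (∫⁻ s in Icc 0 S, scLpNorm (2 * σ + 2) ε (H1.fn (V s)) ^
        (2 * σ / (1 - decayRate n (2 * σ + 2)))) ^ (1 / (2 * σ / (1 - decayRate n (2 * σ + 2)))) ≤
          ENNReal.ofReal a →
      ∀ A B, IsFlowSymmetry σ K A B → ∀ s ∈ Icc 0 S,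
        ‖A (H1.fn (U s) - H1.fn (V s))‖ ≤ C * a ^ (2 * σ) * ‖A (H1.fn (U 0))‖ := by
  have hr : (2 : ℝ) < 2 * σ + 2 := by linarith
  have hδ0 := decayRate_pos hn hr
  obtain ⟨a₁, ha₁, hboot⟩ := exists_lintegral_rpow_le_of_le_add_convolution hσ hδ0 hδ hδσ
  obtain ⟨C₂, hC₂t, hlin⟩ := exists_lintegral_rpow_le_of_le_add_mul_convolution σ hδ0 hδ
  obtain ⟨C₃, hC₃t, hstr⟩ := exists_strichartz hn hr hδ
  have hhold := fun I y d => lintegral_rpow_mul_rpow_le (y := y) (d := d) σ hδ0 hδ I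
  set δ := decayRate n (2 * σ + 2) with hδd
  have hq2 : 2 < 2 / δ := by rw [lt_div_iff₀ hδ0]; linarith
  have hqq : (2 / δ).HolderConjugate (Real.conjExponent (2 / δ)) := holderConjugate_conjExponent hq2
  have h1δ : 0 < 1 - δ := by linarith
  set k := 2 * σ / (1 - δ) with hk
  have hk0 : 0 < k := by positivity
  have hkσ : k * (1 - δ) = 2 * σ := by rw [hk]; field_simp
  set c₂ := C₂.toReal with hc₂
  have hc₂0 : 0 ≤ c₂ := ENNReal.toReal_nonneg
  set c₃ := C₃.toReal with hc₃
  have hc₃0 : 0 ≤ c₃ := ENNReal.toReal_nonneg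
  set a₂ : ℝ := (2 ^ (2 * σ) * (c₂ * K + 1) * 2)⁻¹ ^ (1 / (2 * σ)) with ha₂
  refine ⟨K * 2 ^ (2 * σ) * (2 * c₃) * c₃, min a₁ a₂, by positivity, lt_min ha₁ (by positivity), ?_⟩
  intro ε hε U V hUc hVc hU hV hUV S a hS ha haa hVa A B hAB s hs
  set y : ℝ → ℝ≥0∞ := fun t => scLpNorm (2 * σ + 2) ε (H1.fn (U t)) with hy
  set d : ℝ → ℝ≥0∞ := fun t => scLpNorm (2 * σ + 2) ε (A (H1.fn (U t))) with hd
  set z : ℝ → ℝ≥0∞ := fun t => scLpNorm (2 * σ + 2) ε (H1.fn (V t)) with hz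
  have hid := isFlowSymmetry_id (n := n) hσ
  have hyc : Continuous y := continuous_scLpNorm_fn hn hσ hδ hε (A := ContinuousLinearMap.id ℂ (L2 n))
    (hid.scLpNorm_le ε) hUc
  have hzc : Continuous z := continuous_scLpNorm_fn hn hσ hδ hε (A := ContinuousLinearMap.id ℂ (L2 n))
    (hid.scLpNorm_le ε) hVc
  have hdc : Continuous d := continuous_scLpNorm_fn hn hσ hδ hε (hAB.scLpNorm_le ε) hUc
  have hyt : ∀ t, y t ≠ ⊤ := fun t => scLpNorm_fn_ne_top hn hr hδ hε _
  have hdt : ∀ t, d t ≠ ⊤ := fun t =>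
    ne_top_of_le_ne_top (ENNReal.mul_ne_top ENNReal.ofNat_ne_top (hyt t)) (hAB.scLpNorm_le ε _)
  have hfree : ∀ t, 0 ≤ t → ∀ φ : 𝓢(Rn n, ℂ), ∫ x, H1.fn (V t) x * φ x =
      ∫ x, H1.fn (U 0) x * schrodinger (ε ^ 2 * t) φ x := fun t ht φ => by
    rw [hUV, hV.eq_of_free le_rfl ht φ, sub_zero]
  -- the nonlinear evolution is small in the scale invariant norm
  have hy1 : (∫⁻ t in Icc 0 S, y t ^ k) ^ (1 / k) ≤ ENNReal.ofReal (2 * a) := by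
    refine hboot S y z hS hyc hyt hzc.measurable (fun t ht => ?_) a ha (haa.trans (min_le_left _ _)) hVa
    have h1 := scLpNorm_le_add_convolution hn hσ hδ hε hid hUc hU ht.1 (d₀ := z t) fun φ => by
      change ‖∫ x, H1.fn (U 0) x * _‖ₑ ≤ _
      rw [← hfree t ht.1]
      exact enorm_integral_mul_le_scNorm hr hε (Lp.aestronglyMeasurable _)
        φ.continuous.aestronglyMeasurable
    refine h1.trans (add_le_add le_rfl (lintegral_mono fun τ => ?_))
    dsimp only
    rw [ENNReal.ofReal_one, one_mul, ENNReal.rpow_add_of_nonneg _ _ (by positivity) zero_le_one,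
      ENNReal.rpow_one]
    exact le_rfl
  have hy2 : (∫⁻ t in Icc 0 S, y t ^ k) ^ (1 - δ) ≤ ENNReal.ofReal (2 ^ (2 * σ) * a ^ (2 * σ)) := by
    have h1 := ENNReal.rpow_le_rpow hy1 (z := 2 * σ) (by positivity)
    rw [← ENNReal.rpow_mul, ENNReal.ofReal_rpow_of_nonneg (by positivity) (by positivity),
      Real.mul_rpow (by norm_num) ha.le] at h1
    rwa [show 1 / k * (2 * σ) = 1 - δ by rw [← hkσ]; field_simp] at h1
  have hsmall : C₂ * ENNReal.ofReal K * (∫⁻ t in Icc 0 S, y t ^ k) ^ (1 - δ) ≤ 2⁻¹ := by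
    have h1 : a ^ (2 * σ) ≤ (2 ^ (2 * σ) * (c₂ * K + 1) * 2)⁻¹ := by
      refine (Real.rpow_le_rpow ha.le (haa.trans (min_le_right _ _)) (by positivity)).trans_eq ?_
      rw [ha₂, ← Real.rpow_mul (by positivity), one_div, inv_mul_cancel₀ (by positivity), Real.rpow_one]
    have h3 : c₂ * K * (2 ^ (2 * σ) * a ^ (2 * σ)) ≤ 1 / 2 := by
      calc c₂ * K * (2 ^ (2 * σ) * a ^ (2 * σ)) ≤
            c₂ * K * (2 ^ (2 * σ) * (2 ^ (2 * σ) * (c₂ * K + 1) * 2)⁻¹) := by gcongr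
        _ = c₂ * K / (c₂ * K + 1) * (1 / 2) := by
            have : c₂ * K + 1 ≠ 0 := by positivity
            field_simp
        _ ≤ 1 * (1 / 2) := by
            gcongr
            rw [div_le_one (by positivity)]; linarith
        _ = 1 / 2 := one_mul _
    calc _ ≤ C₂ * ENNReal.ofReal K * ENNReal.ofReal (2 ^ (2 * σ) * a ^ (2 * σ)) := by gcongr
      _ = ENNReal.ofReal (c₂ * K * (2 ^ (2 * σ) * a ^ (2 * σ))) := by
        rw [← ENNReal.ofReal_toReal hC₂t, ← ENNReal.ofReal_mul hc₂0, ← ENNReal.ofReal_mul (by positivity)]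
      _ ≤ ENNReal.ofReal (1 / 2) := ENNReal.ofReal_le_ofReal h3
      _ = 2⁻¹ := by rw [one_div, ENNReal.ofReal_inv_of_pos two_pos, ENNReal.ofReal_ofNat]
  obtain ⟨W, hWm, hWle, hWint⟩ := hstr ε hε (A (H1.fn (U 0)))
  have hd1 : (∫⁻ t in Icc 0 S, d t ^ (2 / δ)) ^ (1 / (2 / δ)) ≤ 2 * (C₃ * ‖A (H1.fn (U 0))‖ₑ) := by
    refine (hlin S y d W (ENNReal.ofReal K) hyc.measurable hdc.measurable hWm (fun t ht => ?_) ?_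
      hsmall).trans ?_
    · exact scLpNorm_le_add_convolution hn hσ hδ hε hAB hUc hU ht.1 (hWle t)
    · obtain ⟨t₂, -, ht₂⟩ := isCompact_Icc.exists_isMaxOn (nonempty_Icc.2 hS) hdc.continuousOn
      refine ne_top_of_le_ne_top ?_ (setLIntegral_mono' measurableSet_Icc
        (g := fun _ => d t₂ ^ (2 / δ)) fun t ht => ENNReal.rpow_le_rpow (ht₂ ht) (by positivity))
      rw [lintegral_const, Measure.restrict_apply_univ, Real.volume_Icc]
      exact ENNReal.mul_ne_top (ENNReal.rpow_ne_top_of_nonneg (by positivity) (hdt t₂))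
        ENNReal.ofReal_ne_top
    · gcongr
      refine le_trans ?_ hWint
      gcongr
      exact Measure.restrict_le_self
  -- conclusion by duality
  refine norm_le_of_forall_schwartz (by positivity) fun φ => ?_
  obtain ⟨Wφ, hWφm, hWφle, hWφint⟩ := hstr ε hε (φ.toLp 2 volume)
  have hWN : ∀ t, scLpNorm (2 * σ + 2) ε (schrodinger (ε ^ 2 * t) φ) ≤ Wφ t := fun t => by
    rw [← scLpNorm_congr_ae (coeFn_toLp _ 2 volume)]
    refine scLpNorm_lp_le_of_forall_schwartz hr hε _ fun χ => ?_
    have := hWφle t χ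
    rwa [integral_toLp_mul, ← integral_schrodinger_mul, ← integral_toLp_mul] at this
  have hpair : ∫ x, A (H1.fn (U s) - H1.fn (V s)) x * φ x = (∫ x, A (H1.fn (U s)) x * φ x) -
      ∫ x, A (H1.fn (U 0)) x * schrodinger (ε ^ 2 * s) φ x := by
    rw [hAB.integral_mul, integral_sub_mul_schwartz, hfree s hs.1, hAB.integral_mul, hAB.integral_mul,
      hAB.comm]
  have hfin : ‖∫ x, A (H1.fn (U s) - H1.fn (V s)) x * φ x‖ₑ ≤
      ENNReal.ofReal (K * 2 ^ (2 * σ) * (2 * c₃) * c₃ * a ^ (2 * σ) * ‖A (H1.fn (U 0))‖ *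
        ‖φ.toLp 2 volume‖) := by
    rw [hpair]
    refine (enorm_integral_sub_free_le hn hσ hδ hε hAB hUc hU hs.1 φ).trans ?_
    have hydm : Measurable fun t => y t ^ (2 * σ) * d t :=
      (hyc.measurable.pow_const _).mul hdc.measurable
    have hWs : Measurable fun t => Wφ (s - t) := hWφm.comp (by fun_prop)
    calc _ ≤ ∫⁻ t in Icc 0 s, ENNReal.ofReal K * ((fun t => y t ^ (2 * σ) * d t) * fun t => Wφ (s - t)) t := by
          refine lintegral_mono fun t => ?_
          rw [Pi.mul_apply, mul_assoc]
          exact mul_le_mul_right (mul_le_mul_right (hWN _) _) _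
      _ = ENNReal.ofReal K * ∫⁻ t in Icc 0 s, ((fun t => y t ^ (2 * σ) * d t) * fun t => Wφ (s - t)) t :=
          lintegral_const_mul _ (hydm.mul hWs)
      _ ≤ ENNReal.ofReal K * ((∫⁻ t in Icc 0 S, (y t ^ (2 * σ) * d t) ^ Real.conjExponent (2 / δ)) ^
            (1 / Real.conjExponent (2 / δ)) * (C₃ * ‖φ.toLp 2 volume‖ₑ)) := by
          refine mul_le_mul_right ((lintegral_mono_set (Icc_subset_Icc_right hs.2)).trans
            ((ENNReal.lintegral_mul_le_Lp_mul_Lq _ hqq.symm hydm.aemeasurable hWs.aemeasurable).trans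
            (mul_le_mul_right ?_ _))) _
          refine le_trans (ENNReal.rpow_le_rpow (lintegral_mono' Measure.restrict_le_self le_rfl)
            (by positivity)) ?_
          rw [lintegral_sub_left_eq_self (fun t => Wφ t ^ (2 / δ)) s]
          exact hWφint
      _ ≤ ENNReal.ofReal K * ((ENNReal.ofReal (2 ^ (2 * σ) * a ^ (2 * σ)) *
            (2 * (C₃ * ‖A (H1.fn (U 0))‖ₑ))) * (C₃ * ‖φ.toLp 2 volume‖ₑ)) := by
          refine mul_le_mul_right (mul_le_mul_left ((hhold _ _ _ hyc.measurable hdc.measurable).trans ?_) _) _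
          exact mul_le_mul' hy2 hd1
      _ = _ := by
          have hN := norm_nonneg (φ.toLp 2 volume)
          have hN' := norm_nonneg (A (H1.fn (U 0)))
          rw [← ENNReal.ofReal_toReal hC₃t, ← ofReal_norm, ← ofReal_norm]
          generalize ‖φ.toLp 2 volume‖ = N at hN
          generalize ‖A (H1.fn (U 0))‖ = N' at hN'
          rw [show (2 : ℝ≥0∞) = ENNReal.ofReal 2 by simp, ← ENNReal.ofReal_mul hc₃0,
            ← ENNReal.ofReal_mul hc₃0, ← ENNReal.ofReal_mul (by norm_num),
            ← ENNReal.ofReal_mul (by positivity), ← ENNReal.ofReal_mul (by positivity),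
            ← ENNReal.ofReal_mul hK]
          congr 1; ring
  rw [← ofReal_norm, ENNReal.ofReal_le_ofReal_iff (by positivity)] at hfin
  exact hfin

end Stability

end

section

/-! ### Finite differences -/

open SchwartzMap

section Translation

variable {n : ℕ} {σ ε : ℝ}

/-- The symbol `2π ⟨ξ, e⟩` of `-i ∂ₑ`, which generates the translations in the direction `e`. -/
noncomputable def translationSymbol (e ξ : Rn n) : ℝ := 2 * Real.pi * inner ℝ ξ e

lemma hasTemperateGrowth_translationSymbol (e : Rn n) :
    (translationSymbol e).HasTemperateGrowth := by
  unfold translationSymbol; fun_prop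

open scoped FourierTransform in
/-- The group generated by the symbol of `∂_e` is the group of translations. -/
lemma phaseGroup_translationSymbol_apply (e : Rn n) (h : ℝ) (φ : 𝓢(Rn n, ℂ)) (x : Rn n) :
    phaseGroup (translationSymbol e) h φ x = φ (x + h • e) := by
  have h1 : ∀ (ψ : 𝓢(Rn n, ℂ)) y, ψ y = ∫ v, Complex.exp (((2 * Real.pi * inner ℝ v y : ℝ) : ℂ) *
      Complex.I) • 𝓕 ψ v := fun ψ y => by
    rw [← Real.fourierInv_eq', ← fourierInv_coe, FourierTransform.fourierInv_fourier_eq]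
  rw [h1, h1 φ]
  refine integral_congr_ae (Eventually.of_forall fun ξ => ?_)
  simp only [fourier_phaseGroup (hasTemperateGrowth_translationSymbol e), smul_eq_mul, ← mul_assoc,
    ← Complex.exp_add, translationSymbol, inner_add_right, inner_smul_right]
  congr 2
  push_cast; ring

lemma fourierMultiplierCLM_I_mul_translationSymbol (e : Rn n) (φ : 𝓢(Rn n, ℂ)) :
    fourierMultiplierCLM ℂ (fun ξ => Complex.I * translationSymbol e ξ) φ = ∂_{e} φ := by
  have hp := hasTemperateGrowth_translationSymbol e
  have hpc : (fun ξ => Complex.I * (translationSymbol e ξ : ℂ)).HasTemperateGrowth := by fun_prop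
  refine ext_of_fourier fun ξ => ?_
  have h : (inner ℝ · e : Rn n → ℝ).HasTemperateGrowth := by fun_prop
  rw [fourier_fourierMultiplierCLM_apply hpc, fourier_lineDerivOp_eq, smul_apply,
    smulLeftCLM_apply_apply h, translationSymbol, Complex.real_smul, smul_eq_mul]
  push_cast; ring

lemma hasDerivAt_integral_mul_translation (f : L2 n) (e : Rn n) (φ : 𝓢(Rn n, ℂ)) (h : ℝ) :
    HasDerivAt (fun h => ∫ x, f x * phaseGroup (translationSymbol e) h φ x)
      (∫ x, f x * (∂_{e} (phaseGroup (translationSymbol e) h φ)) x) h := by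
  have h1 := hasDerivAt_toLp_phaseGroup (hasTemperateGrowth_translationSymbol e) φ h
  rw [fourierMultiplierCLM_I_mul_translationSymbol] at h1
  have h2 := ((l2Pair f).restrictScalars ℝ).hasFDerivAt.comp_hasDerivAt h h1
  simp only [Function.comp_def, ContinuousLinearMap.coe_restrictScalars', l2Pair_toLp] at h2
  exact h2

/-- The operator `f ↦ f(· - h e) - f` on `L²`. -/
noncomputable def translationDiff (e : Rn n) (h : ℝ) : L2 n →L[ℂ] L2 n :=
  (Lp.compMeasurePreservingₗᵢ ℂ (fun x : Rn n => x - h • e)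
    (measurePreserving_sub_right volume _)).toContinuousLinearMap - ContinuousLinearMap.id ℂ (L2 n)

lemma coeFn_translationDiff (e : Rn n) (h : ℝ) (f : L2 n) :
    translationDiff e h f =ᵐ[volume] (fun x => f (x - h • e)) - f := by
  have h1 := Lp.coeFn_compMeasurePreserving f (measurePreserving_sub_right volume (h • e))
  refine (Lp.coeFn_sub _ f).trans ?_
  exact h1.sub (ae_eq_refl _)

lemma integral_translationDiff_mul (e : Rn n) (h : ℝ) (f : L2 n) (φ : 𝓢(Rn n, ℂ)) :
    ∫ x, translationDiff e h f x * φ x =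
      ∫ x, f x * (phaseGroup (translationSymbol e) h φ - φ) x := by
  rw [integral_mul_schwartz_sub]
  change ∫ x, (Lp.compMeasurePreserving (fun x : Rn n => x - h • e)
    (measurePreserving_sub_right volume _) f - f : L2 n) x * φ x = _
  rw [integral_sub_mul_schwartz]
  congr 1
  have h1 := Lp.coeFn_compMeasurePreserving f (measurePreserving_sub_right volume (h • e))
  rw [← integral_sub_right_eq_self (fun x => f x * phaseGroup (translationSymbol e) h φ x) (h • e)]
  refine integral_congr_ae ?_
  filter_upwards [h1] with x hx
  rw [hx, phaseGroup_translationSymbol_apply, sub_add_cancel]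
  rfl

/-- A weak derivative bounds the difference quotients. -/
lemma norm_translationDiff_le {f : L2 n} {g : Fin n → L2 n} (hfg : HasWeakGradient f g) (i : Fin n)
    (h : ℝ) : ‖translationDiff (EuclideanSpace.single i 1) h f‖ ≤ |h| * ‖g i‖ := by
  set e : Rn n := EuclideanSpace.single i 1
  refine norm_le_of_forall_schwartz (by positivity) fun φ => ?_
  rw [integral_translationDiff_mul, integral_mul_schwartz_sub]
  have h1 := Convex.norm_image_sub_le_of_norm_hasDerivWithin_le (s := univ) (x := 0) (y := h)
    (C := ‖g i‖ * ‖φ.toLp 2 volume‖)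
    (fun t _ => (hasDerivAt_integral_mul_translation f e φ t).hasDerivWithinAt) (fun t _ => ?_)
    convex_univ (mem_univ _) (mem_univ _)
  · rw [phaseGroup_zero (hasTemperateGrowth_translationSymbol e), sub_zero, Real.norm_eq_abs] at h1
    linarith
  · have h2 := hfg i (phaseGroup (translationSymbol e) t φ)
    rw [← norm_neg, ← h2, ← l2Pair_toLp,
      ← norm_toLp_phaseGroup (hasTemperateGrowth_translationSymbol e) t φ]
    exact norm_l2Pair_le _ _

/-- Bounds on difference quotients bound the weak derivative. -/
lemma norm_le_of_norm_translationDiff_le {f : L2 n} {g : Fin n → L2 n} (hfg : HasWeakGradient f g)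
    (i : Fin n) {D : ℝ} (hD : 0 ≤ D)
    (h : ∀ h, ‖translationDiff (EuclideanSpace.single i 1) h f‖ ≤ D * |h|) : ‖g i‖ ≤ D := by
  set e : Rn n := EuclideanSpace.single i 1
  refine norm_le_of_forall_schwartz hD fun φ => ?_
  have h1 := hasDerivAt_integral_mul_translation f e φ 0
  rw [phaseGroup_zero (hasTemperateGrowth_translationSymbol e)] at h1
  rw [hfg i φ, norm_neg]
  refine h1.le_of_lip' (by positivity) (Eventually.of_forall fun t => ?_)
  rw [phaseGroup_zero (hasTemperateGrowth_translationSymbol e), ← integral_mul_schwartz_sub,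
    ← integral_translationDiff_mul, ← l2Pair_toLp, sub_zero, Real.norm_eq_abs]
  refine (norm_l2Pair_le _ _).trans ?_
  rw [mul_right_comm]
  exact mul_le_mul_of_nonneg_right (h t) (norm_nonneg _)

lemma scLpNorm_comp_sub (r : ℝ) {f : Rn n → ℂ} (hf : AEStronglyMeasurable f volume) (y : Rn n) :
    scLpNorm r ε (fun x => f (x - y)) = scLpNorm r ε f := by
  unfold scLpNorm
  congr 1
  exact eLpNorm_comp_measurePreserving hf (measurePreserving_sub_right volume y)

lemma integrable_powerNonlinearity_mul (hσ : 0 < σ) (hε : 0 < ε) {f χ : Rn n → ℂ}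
    (hfm : AEStronglyMeasurable f volume) (hf : scLpNorm (2 * σ + 2) ε f ≠ ⊤)
    (hχm : AEStronglyMeasurable χ volume) (hχ : scLpNorm (2 * σ + 2) ε χ ≠ ⊤) :
    Integrable (fun x => powerNonlinearity σ ε f x * χ x) := by
  have h1 : scDualNorm (2 * σ + 2) ε (powerNonlinearity σ ε f) ≠ ⊤ :=
    ne_top_of_le_ne_top (ENNReal.mul_ne_top (ENNReal.rpow_ne_top_of_nonneg (by positivity) hf) hf)
      (scDualNorm_powerNonlinearity_le hσ hε hfm)
  have hr : (2 : ℝ) < 2 * σ + 2 := by linarith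
  have := holderConjugate_ofReal (holderConjugate_conjExponent hr)
  have h2 : MemLp (powerNonlinearity σ ε f) (ENNReal.ofReal (Real.conjExponent (2 * σ + 2))) volume := by
    refine ⟨aestronglyMeasurable_powerNonlinearity hfm, lt_top_iff_ne_top.2 fun h => h1 ?_⟩
    rw [scDualNorm, h, ENNReal.mul_top]
    rw [ne_eq, ENNReal.ofReal_eq_zero, not_le]; positivity
  have h3 : MemLp χ (ENNReal.ofReal (2 * σ + 2)) volume := by
    refine ⟨hχm, lt_top_iff_ne_top.2 fun h => hχ ?_⟩
    rw [scLpNorm, h, ENNReal.mul_top]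
    rw [ne_eq, ENNReal.ofReal_eq_zero, not_le]; positivity
  exact MemLp.integrable_mul (p := ENNReal.ofReal (Real.conjExponent (2 * σ + 2)))
    (q := ENNReal.ofReal (2 * σ + 2)) h2 h3

/-- The difference of a translation and the identity: the nonlinearity, taken at a function and at
its translate, differs by the local Lipschitz bound. -/
lemma isFlowSymmetry_translationDiff (hσ : 0 < σ) (e : Rn n) (h : ℝ) :
    IsFlowSymmetry (n := n) σ ((2 * σ + 1) * 2 ^ (2 * σ)) (translationDiff e h)
      (fun φ => phaseGroup (translationSymbol e) h φ - φ) where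
  integral_mul f φ := integral_translationDiff_mul e h f φ
  comm a φ := by
    rw [schrodinger, map_sub, phaseGroup_comm (hasTemperateGrowth_translationSymbol e)
      hasTemperateGrowth_halfLaplacianSymbol]
  scLpNorm_le ε f := by
    have hf := Lp.aestronglyMeasurable f
    have hf' : AEStronglyMeasurable (fun x => f (x - h • e)) volume :=
      hf.comp_measurePreserving (measurePreserving_sub_right volume _)
    rw [scLpNorm_congr_ae (coeFn_translationDiff e h f)]
    refine (scLpNorm_sub_le (by linarith) hf' hf).trans_eq ?_
    rw [scLpNorm_comp_sub _ hf, ← two_mul]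
  nonlinearity_le ε hε f hft χ := by
    have hr : (2 : ℝ) < 2 * σ + 2 := by linarith
    have hf := Lp.aestronglyMeasurable f
    have hf' : AEStronglyMeasurable (fun x => f (x - h • e)) volume :=
      hf.comp_measurePreserving (measurePreserving_sub_right volume _)
    set τχ := phaseGroup (translationSymbol e) h χ with hτ
    have hi1 := integrable_powerNonlinearity_mul hσ hε hf hft
      τχ.continuous.aestronglyMeasurable (scLpNorm_schwartz_ne_top τχ)
    have hi2 := integrable_powerNonlinearity_mul hσ hε hf hft
      χ.continuous.aestronglyMeasurable (scLpNorm_schwartz_ne_top χ)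
    have e1 : ∫ x, powerNonlinearity σ ε f x * (τχ - χ) x = ∫ x, χ x *
        (powerNonlinearity σ ε (fun x => f (x - h • e)) - powerNonlinearity σ ε f : Rn n → ℂ) x := by
      have hi1' := hi1.comp_sub_right (h • e)
      have h3 : (fun x => powerNonlinearity σ ε f (x - h • e) * τχ (x - h • e)) =
          fun x => powerNonlinearity σ ε (fun x => f (x - h • e)) x * χ x := by
        ext x
        rw [hτ, phaseGroup_translationSymbol_apply, sub_add_cancel]; rfl
      calc _ = (∫ x, powerNonlinearity σ ε f x * τχ x) - ∫ x, powerNonlinearity σ ε f x * χ x := by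
            rw [← integral_sub hi1 hi2]
            simp only [sub_apply, mul_sub]
        _ = (∫ x, powerNonlinearity σ ε (fun x => f (x - h • e)) x * χ x) -
              ∫ x, powerNonlinearity σ ε f x * χ x := by
            rw [← integral_sub_right_eq_self (fun x => powerNonlinearity σ ε f x * τχ x) (h • e), h3]
        _ = _ := by
            rw [h3] at hi1'
            rw [← integral_sub hi1' hi2]
            refine integral_congr_ae (Eventually.of_forall fun x => ?_)
            simp only [Pi.sub_apply]; ring
    rw [e1]
    refine (enorm_integral_mul_le_scNorm hr hε χ.continuous.aestronglyMeasurable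
      ((aestronglyMeasurable_powerNonlinearity hf').sub
        (aestronglyMeasurable_powerNonlinearity hf))).trans ?_
    rw [mul_comm]
    refine mul_le_mul_left ((scDualNorm_powerNonlinearity_sub_le hσ hε hf' hf).trans_eq ?_) _
    rw [scLpNorm_comp_sub _ hf, scLpNorm_congr_ae (coeFn_translationDiff e h f),
      ENNReal.ofReal_mul (by positivity), ← ENNReal.ofReal_rpow_of_nonneg (by norm_num) (by positivity),
      ENNReal.ofReal_ofNat, ← two_mul (scLpNorm _ _ _), ENNReal.mul_rpow_of_nonneg _ _ (by positivity)]
    simp only [mul_assoc]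

end Translation

end

section

/-! ### Nonfocusing free evolutions: the nonlinearity is negligible -/

open SchwartzMap

section Nonfocusing

variable {n : ℕ} {σ ε : ℝ}

/-- If the free evolution is small in the scale invariant space-time norm, then the nonlinear
evolution stays close to it in the semiclassical `H¹` norm. -/
theorem exists_scNorm_sub_le (hn : 1 ≤ n) (hσ : 0 < σ) (hδ : decayRate n (2 * σ + 2) < 1)
    (hδσ : 1 < decayRate n (2 * σ + 2) * (2 * σ + 1)) :
    ∃ C a₀ : ℝ, 0 ≤ C ∧ 0 < a₀ ∧ ∀ ε : ℝ, 0 < ε → ∀ U V : ℝ → H1 n, Continuous U →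
      Continuous V →
      IsForcedSchrodinger ε (fun s => H1.fn (U s)) (fun s => powerNonlinearity σ ε (H1.fn (U s))) →
      IsForcedSchrodinger ε (fun s => H1.fn (V s)) 0 → U 0 = V 0 →
      ∀ S a : ℝ, 0 ≤ S → 0 < a → a ≤ a₀ →
      (∫⁻ s in Icc 0 S, scLpNorm (2 * σ + 2) ε (H1.fn (V s)) ^
        (2 * σ / (1 - decayRate n (2 * σ + 2)))) ^ (1 / (2 * σ / (1 - decayRate n (2 * σ + 2)))) ≤
          ENNReal.ofReal a →
      ∀ s ∈ Icc 0 S, H1.scNorm ε (U s - V s) ≤ C * a ^ (2 * σ) * H1.scNorm ε (U 0) := by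
  obtain ⟨C₁, a₁, hC₁, ha₁, h₁⟩ := exists_norm_apply_sub_le hn hσ hδ hδσ (K := 1) zero_le_one
  obtain ⟨C₂, a₂, hC₂, ha₂, h₂⟩ := exists_norm_apply_sub_le hn hσ hδ hδσ
    (K := (2 * σ + 1) * 2 ^ (2 * σ)) (by positivity)
  refine ⟨max C₁ C₂, min a₁ a₂, le_max_of_le_left hC₁, lt_min ha₁ ha₂, ?_⟩
  intro ε hε U V hUc hVc hU hV hUV S a hS ha haa hVa s hs
  have hfn : ‖H1.fn (U s - V s)‖ ≤ max C₁ C₂ * a ^ (2 * σ) * ‖H1.fn (U 0)‖ := by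
    refine (h₁ ε hε U V hUc hVc hU hV (by rw [hUV]) S a hS ha (haa.trans (min_le_left _ _)) hVa
      (ContinuousLinearMap.id ℂ (L2 n)) id (isFlowSymmetry_id hσ) s hs).trans ?_
    have := le_max_left C₁ C₂
    gcongr
    exact le_rfl
  have hgi : ∀ i, ‖H1.grad (U s - V s) i‖ ≤ max C₁ C₂ * a ^ (2 * σ) * ‖H1.grad (U 0) i‖ := fun i => by
    refine norm_le_of_norm_translationDiff_le (H1.hasWeakGradient (U s - V s)) i (by positivity)
      fun h => ?_
    refine (h₂ ε hε U V hUc hVc hU hV (by rw [hUV]) S a hS ha (haa.trans (min_le_right _ _)) hVa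
      _ _ (isFlowSymmetry_translationDiff hσ (EuclideanSpace.single i 1) h) s hs).trans ?_
    have h3 := norm_translationDiff_le (H1.hasWeakGradient (U 0)) i h
    have h4 := le_max_right C₁ C₂
    calc _ ≤ max C₁ C₂ * a ^ (2 * σ) * (|h| * ‖H1.grad (U 0) i‖) := by gcongr
      _ = _ := by ring
  have hg : ‖H1.grad (U s - V s)‖ ≤ max C₁ C₂ * a ^ (2 * σ) * ‖H1.grad (U 0)‖ := by
    have h0 : 0 ≤ max C₁ C₂ * a ^ (2 * σ) := by positivity
    rw [PiLp.norm_eq_of_L2, PiLp.norm_eq_of_L2, ← Real.sqrt_sq h0, ← Real.sqrt_mul (sq_nonneg _),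
      Finset.mul_sum]
    refine Real.sqrt_le_sqrt (Finset.sum_le_sum fun i _ => ?_)
    rw [← mul_pow]
    exact pow_le_pow_left₀ (norm_nonneg _) (hgi i) 2
  rw [H1.scNorm, H1.scNorm, norm_smul, norm_smul, mul_add]
  refine add_le_add hfn ?_
  calc _ ≤ ‖ε‖ * (max C₁ C₂ * a ^ (2 * σ) * ‖H1.grad (U 0)‖) := by gcongr
    _ = _ := by ring

/-- Interpolation between the Strichartz estimate and a bound which is uniform in time. The Strichartz
exponent `2 / δ` is smaller than `2σ / (1 - δ)` exactly when `δ (σ + 1) > 1`, that is `σ > 2 / n`. -/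
theorem exists_lintegral_scLpNorm_rpow_le (hn : 1 ≤ n) (hσ : 0 < σ)
    (hδ : decayRate n (2 * σ + 2) < 1) (hδσ : 1 < decayRate n (2 * σ + 2) * (σ + 1)) :
    ∃ C θ : ℝ, 0 ≤ C ∧ 0 < θ ∧ θ < 1 ∧ ∀ ε : ℝ, 0 < ε → ∀ V : ℝ → H1 n,
      IsForcedSchrodinger ε (fun s => H1.fn (V s)) 0 → ∀ S η : ℝ, 0 < η →
      (∀ s ∈ Icc 0 S, scLpNorm (2 * σ + 2) ε (H1.fn (V s)) ≤ ENNReal.ofReal η) →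
      (∫⁻ s in Icc 0 S, scLpNorm (2 * σ + 2) ε (H1.fn (V s)) ^
        (2 * σ / (1 - decayRate n (2 * σ + 2)))) ^ (1 / (2 * σ / (1 - decayRate n (2 * σ + 2)))) ≤
          ENNReal.ofReal (η ^ θ * (C * ‖H1.fn (V 0)‖) ^ (1 - θ)) := by
  have hr : (2 : ℝ) < 2 * σ + 2 := by linarith
  have hδ0 := decayRate_pos hn hr
  obtain ⟨C₃, hC₃t, hstr⟩ := exists_strichartz hn hr hδ
  set δ := decayRate n (2 * σ + 2) with hδd
  have h1δ : 0 < 1 - δ := by linarith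
  set k := 2 * σ / (1 - δ) with hk
  have hk0 : 0 < k := by positivity
  set q := 2 / δ with hq
  have hq0 : 0 < q := by positivity
  have hqk : q < k := by
    rw [hq, hk, div_lt_div_iff₀ hδ0 h1δ]
    nlinarith
  set c₃ := C₃.toReal with hc₃
  have hc₃0 : 0 ≤ c₃ := ENNReal.toReal_nonneg
  have hθ : 1 - q / k = (k - q) / k := by field_simp
  have hqk1 : q / k < 1 := (div_lt_one hk0).2 hqk
  refine ⟨c₃, 1 - q / k, hc₃0, by linarith, by linarith [div_pos hq0 hk0], ?_⟩
  intro ε hε V hV S η hη hVη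
  obtain ⟨W, hWm, hWle, hWint⟩ := hstr ε hε (H1.fn (V 0))
  have hVW : ∀ s, 0 ≤ s → scLpNorm (2 * σ + 2) ε (H1.fn (V s)) ≤ W s := fun s hs => by
    refine scLpNorm_lp_le_of_forall_schwartz hr hε _ fun φ => ?_
    have h1 := hV.eq_of_free le_rfl hs φ
    rw [sub_zero] at h1
    rw [h1]
    exact hWle s φ
  have h1 : ∫⁻ s in Icc 0 S, scLpNorm (2 * σ + 2) ε (H1.fn (V s)) ^ k ≤
      ENNReal.ofReal η ^ (k - q) * ∫⁻ s, W s ^ q := by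
    calc _ ≤ ∫⁻ s in Icc 0 S, ENNReal.ofReal η ^ (k - q) * W s ^ q := by
          refine setLIntegral_mono' measurableSet_Icc fun s hs => ?_
          rw [show k = (k - q) + q by ring, ENNReal.rpow_add_of_nonneg _ _ (by linarith) hq0.le,
            add_sub_cancel_right]
          exact mul_le_mul' (ENNReal.rpow_le_rpow (hVη s hs) (by linarith))
            (ENNReal.rpow_le_rpow (hVW s hs.1) hq0.le)
      _ ≤ ∫⁻ s, ENNReal.ofReal η ^ (k - q) * W s ^ q := lintegral_mono' Measure.restrict_le_self le_rfl
      _ = _ := lintegral_const_mul _ (hWm.pow_const _)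
  have h2 : ∫⁻ s, W s ^ q ≤ ENNReal.ofReal (c₃ * ‖H1.fn (V 0)‖) ^ q := by
    rw [ENNReal.ofReal_mul hc₃0, ENNReal.ofReal_toReal hC₃t, ofReal_norm]
    have h3 := ENNReal.rpow_le_rpow hWint hq0.le
    rwa [← ENNReal.rpow_mul, one_div, inv_mul_cancel₀ hq0.ne', ENNReal.rpow_one] at h3
  have h4 := ENNReal.rpow_le_rpow (h1.trans (mul_le_mul_right h2 _)) (z := 1 / k) (by positivity)
  refine h4.trans_eq ?_
  have hX : 0 ≤ c₃ * ‖H1.fn (V 0)‖ := by positivity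
  generalize c₃ * ‖H1.fn (V 0)‖ = X at hX
  rw [ENNReal.mul_rpow_of_nonneg _ _ (by positivity), ← ENNReal.rpow_mul, ← ENNReal.rpow_mul,
    ENNReal.ofReal_mul (by positivity), ← ENNReal.ofReal_rpow_of_pos hη,
    ← ENNReal.ofReal_rpow_of_nonneg hX (by rw [sub_sub_cancel]; positivity), sub_sub_cancel, hθ]
  simp only [mul_one_div]

/-- The rescaled solution `s ↦ u(ε s)`, extended to negative times by its initial value. -/
noncomputable def rescale (ε : ℝ) (u : ℝ → H1 n) (s : ℝ) : H1 n := u (ε * max s 0)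

lemma SolvesSchrodinger.continuous_rescale (hε : 0 < ε) {N : H1 n → Rn n → ℂ} {f : H1 n}
    {u : ℝ → H1 n} (h : SolvesSchrodinger ε N f u) : Continuous (rescale ε u) :=
  h.1.comp_continuous (by fun_prop) fun s => mul_nonneg hε.le (le_max_right _ _)

lemma rescale_zero (u : ℝ → H1 n) : rescale ε u 0 = u 0 := by simp [rescale]

lemma rescale_of_nonneg (u : ℝ → H1 n) {s : ℝ} (hs : 0 ≤ s) : rescale ε u s = u (ε * s) := by
  rw [rescale, max_eq_left hs]

lemma IsNLSSolution.isForcedSchrodinger (hε : 0 < ε) {f : H1 n} {u : ℝ → H1 n}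
    (h : IsNLSSolution σ ε f u) : IsForcedSchrodinger ε (fun s => H1.fn (rescale ε u s))
      (fun s => powerNonlinearity σ ε (H1.fn (rescale ε u s))) :=
  (SolvesSchrodinger.isForcedSchrodinger hε h).congr
    (fun s hs => by rw [rescale_of_nonneg u hs])
    (fun s hs => by rw [rescale_of_nonneg u hs]; rfl)

lemma IsFreeSolution.isForcedSchrodinger (hε : 0 < ε) {f : H1 n} {v : ℝ → H1 n}
    (h : IsFreeSolution ε f v) : IsForcedSchrodinger ε (fun s => H1.fn (rescale ε v s)) 0 :=
  (SolvesSchrodinger.isForcedSchrodinger hε h).congr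
    (fun s hs => by rw [rescale_of_nonneg v hs])
    (fun s hs => rfl)

lemma scLpNorm_le_ofReal_of_scPotential_le (hσ : 0 < σ) (hε : 0 < ε) {η : ℝ} (hη : 0 ≤ η) {f : H1 n}
    (h : H1.scPotential σ ε f ≤ ENNReal.ofReal (η ^ (2 * σ + 2))) :
    scLpNorm (2 * σ + 2) ε (H1.fn f) ≤ ENNReal.ofReal η := by
  rw [scPotential_eq hσ hε, ← ENNReal.ofReal_rpow_of_nonneg hη (by positivity)] at h
  exact (ENNReal.rpow_le_rpow_iff (by positivity)).1 h

/-- If the potential energy of the free evolution tends to zero uniformly in time, then the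
nonlinear evolution is asymptotic to the free one. -/
theorem tendsto_iSup_scNorm_of_limsup_eq_zero (hn : 1 ≤ n) (hσ : 0 < σ)
    (hδ : decayRate n (2 * σ + 2) < 1) (hδσ : 1 < decayRate n (2 * σ + 2) * (σ + 1))
    {u₀ : ℝ → H1 n} {u v : ℝ → ℝ → H1 n}
    (hbdd : ∃ C : ℝ, ∀ ε ∈ Ioc (0 : ℝ) 1, H1.scNorm ε (u₀ ε) ≤ C)
    (hu : ∀ ε ∈ Ioc (0 : ℝ) 1, IsNLSSolution σ ε (u₀ ε) (u ε))
    (hv : ∀ ε ∈ Ioc (0 : ℝ) 1, IsFreeSolution ε (u₀ ε) (v ε)) {T : ℝ} (hT : 0 < T)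
    (h : limsup (fun ε : ℝ => ⨆ t ∈ Icc (0 : ℝ) T, H1.scPotential σ ε (v ε t)) (𝓝[>] 0) = 0) :
    Tendsto (fun ε : ℝ => ⨆ t ∈ Icc (0 : ℝ) T, ENNReal.ofReal (H1.scNorm ε (u ε t - v ε t)))
      (𝓝[>] 0) (𝓝 0) := by
  have hr : (2 : ℝ) < 2 * σ + 2 := by linarith
  have hδ0 := decayRate_pos hn hr
  obtain ⟨C₁, a₀, hC₁, ha₀, hstab⟩ := exists_scNorm_sub_le hn hσ hδ (by nlinarith)
  obtain ⟨C₂, θ, hC₂, hθ, hθ1, hint⟩ := exists_lintegral_scLpNorm_rpow_le hn hσ hδ hδσ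
  obtain ⟨M, hM⟩ := hbdd
  have hM0 : 0 ≤ M := by
    refine le_trans ?_ (hM 1 (by simp))
    unfold H1.scNorm; positivity
  set D := (C₂ * M) ^ (1 - θ) + 1 with hD
  have hD0 : 0 < D := by positivity
  rw [ENNReal.tendsto_nhds_zero]
  intro κ hκ
  obtain ⟨κ', hκ'0, hκ'⟩ : ∃ κ' : ℝ, 0 < κ' ∧ ENNReal.ofReal κ' ≤ κ := by
    obtain ⟨c, hc0, hc⟩ := ENNReal.lt_iff_exists_nnreal_btwn.1 hκ
    exact ⟨c, by exact_mod_cast hc0, by simpa using hc.le⟩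
  -- choice of the size `η` of the free evolution
  have hlim1 : Tendsto (fun η : ℝ => η ^ θ * D) (𝓝[>] 0) (𝓝 0) := by
    have h1 : Tendsto (fun η : ℝ => η ^ θ * D) (𝓝 0) (𝓝 ((0 : ℝ) ^ θ * D)) :=
      (Real.continuousAt_rpow_const 0 θ (Or.inr hθ.le)).tendsto.mul_const D
    rw [Real.zero_rpow hθ.ne', zero_mul] at h1
    exact h1.mono_left nhdsWithin_le_nhds
  have hlim2 : Tendsto (fun η : ℝ => C₁ * (η ^ θ * D) ^ (2 * σ) * M) (𝓝[>] 0) (𝓝 0) := by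
    have h1 := (((Real.continuousAt_rpow_const 0 (2 * σ) (Or.inr (by positivity))).tendsto.comp
      hlim1).const_mul C₁).mul_const M
    rw [Real.zero_rpow (by positivity), mul_zero, zero_mul] at h1
    exact h1
  obtain ⟨η, hη1, hη2, hη0⟩ : ∃ η : ℝ, η ^ θ * D < a₀ ∧ C₁ * (η ^ θ * D) ^ (2 * σ) * M < κ' ∧ 0 < η :=
    (((hlim1.eventually_lt_const ha₀).and ((hlim2.eventually_lt_const hκ'0).and
      self_mem_nhdsWithin)).exists)
  have hev : ∀ᶠ ε in 𝓝[>] (0 : ℝ), ⨆ t ∈ Icc (0 : ℝ) T, H1.scPotential σ ε (v ε t) <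
      ENNReal.ofReal (η ^ (2 * σ + 2)) :=
    eventually_lt_of_limsup_lt (by rw [h]; exact ENNReal.ofReal_pos.2 (by positivity))
  filter_upwards [hev, Ioc_mem_nhdsGT zero_lt_one] with ε hεv hε1
  have hε : 0 < ε := hε1.1
  have hV0 : rescale ε (v ε) 0 = u₀ ε := by rw [rescale_zero]; exact (hv ε hε1).2.1
  have hU0 : rescale ε (u ε) 0 = u₀ ε := by rw [rescale_zero]; exact (hu ε hε1).2.1
  have hVf := (hv ε hε1).isForcedSchrodinger hε
  have hVη : ∀ s ∈ Icc 0 (T / ε), scLpNorm (2 * σ + 2) ε (H1.fn (rescale ε (v ε) s)) ≤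
      ENNReal.ofReal η := fun s hs => by
    rw [rescale_of_nonneg _ hs.1]
    refine scLpNorm_le_ofReal_of_scPotential_le hσ hε hη0.le (le_trans ?_ hεv.le)
    refine le_iSup₂_of_le (ε * s) ⟨mul_nonneg hε.le hs.1, ?_⟩ le_rfl
    have := (le_div_iff₀ hε).1 hs.2
    linarith
  have h1 := hint ε hε _ hVf (T / ε) η hη0 hVη
  have h2 := hstab ε hε _ _ (SolvesSchrodinger.continuous_rescale hε (hu ε hε1))
    (SolvesSchrodinger.continuous_rescale hε (hv ε hε1)) ((hu ε hε1).isForcedSchrodinger hε) hVf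
    (hU0.trans hV0.symm) (T / ε) (η ^ θ * D) (by positivity) (by positivity) hη1.le
    (h1.trans (ENNReal.ofReal_le_ofReal (by
      have h3 : ‖H1.fn (rescale ε (v ε) 0)‖ ≤ M := by
        rw [hV0]; exact (norm_fn_le_scNorm _).trans (hM ε hε1)
      have h4 : (C₂ * ‖H1.fn (rescale ε (v ε) 0)‖) ^ (1 - θ) ≤ (C₂ * M) ^ (1 - θ) :=
        Real.rpow_le_rpow (by positivity) (by gcongr) (by linarith)
      have h5 : 0 < η ^ θ := by positivity
      exact mul_le_mul_of_nonneg_left (by linarith) h5.le)))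
  refine le_trans (iSup₂_le fun t ht => ENNReal.ofReal_le_ofReal ?_) hκ'
  have h3 := h2 (t / ε) ⟨div_nonneg ht.1 hε.le, by gcongr; exact ht.2⟩
  rw [rescale_of_nonneg _ (div_nonneg ht.1 hε.le), rescale_of_nonneg _ (div_nonneg ht.1 hε.le),
    mul_div_cancel₀ _ hε.ne', hU0] at h3
  refine h3.trans (le_trans ?_ hη2.le)
  exact mul_le_mul_of_nonneg_left (hM ε hε1) (by positivity)

end Nonfocusing

end

section

/-! ### Approximation in `H¹` by Schwartz functions -/

open SchwartzMap

section Density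

variable {n : ℕ}

/-- The complex conjugate of a Schwartz function. -/
noncomputable def SchwartzMap.conj (φ : 𝓢(Rn n, ℂ)) : 𝓢(Rn n, ℂ) :=
  φ.postcompCLM (Complex.conjCLE : ℂ →L[ℝ] ℂ)

lemma SchwartzMap.conj_apply (φ : 𝓢(Rn n, ℂ)) (x : Rn n) : φ.conj x = (starRingEnd ℂ) (φ x) := rfl

lemma SchwartzMap.lineDerivOp_conj (e : Rn n) (φ : 𝓢(Rn n, ℂ)) : ∂_{e} φ.conj = (∂_{e} φ).conj := by
  ext x
  rw [conj_apply, lineDerivOp_apply_eq_fderiv, lineDerivOp_apply_eq_fderiv]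
  have h := (Complex.conjCLE : ℂ →L[ℝ] ℂ).hasFDerivAt.comp x (φ.differentiableAt (x := x)).hasFDerivAt
  have h2 : HasFDerivAt φ.conj ((Complex.conjCLE : ℂ →L[ℝ] ℂ).comp (fderiv ℝ φ x)) x := h
  rw [h2.fderiv]
  rfl

lemma SchwartzMap.norm_toLp_conj (φ : 𝓢(Rn n, ℂ)) : ‖φ.conj.toLp 2 volume‖ = ‖φ.toLp 2 volume‖ := by
  rw [norm_toLp, norm_toLp]
  congr 1
  exact eLpNorm_congr_norm_ae (Eventually.of_forall fun x => by rw [conj_apply, RCLike.norm_conj])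

/-- The symbol `(1 + 4π²|ξ|²)⁻¹` of `(1 - Δ)⁻¹`. -/
noncomputable def besselSymbol (n : ℕ) (ξ : Rn n) : ℝ := (1 + ‖(2 * Real.pi) • ξ‖ ^ 2) ^ (-1 : ℝ)

lemma besselSymbol_eq (ξ : Rn n) : besselSymbol n ξ = (1 + (2 * Real.pi * ‖ξ‖) ^ 2)⁻¹ := by
  rw [besselSymbol, Real.rpow_neg_one, norm_smul, Real.norm_of_nonneg (by positivity)]

/-- The Bessel potential `(1 - Δ)⁻¹` on Schwartz functions. -/
noncomputable def besselPotential (φ : 𝓢(Rn n, ℂ)) : 𝓢(Rn n, ℂ) :=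
  fourierMultiplierCLM ℂ (fun ξ => (besselSymbol n ξ : ℂ)) φ

lemma hasTemperateGrowth_besselSymbol :
    (fun ξ => (besselSymbol n ξ : ℂ)).HasTemperateGrowth := by
  have h := hasTemperateGrowth_bracket (n := n) (2 * Real.pi) (-1)
  change (besselSymbol n).HasTemperateGrowth at h
  fun_prop

lemma integral_besselPotential_mul (φ ψ : 𝓢(Rn n, ℂ)) :
    ∫ x, besselPotential φ x * ψ x = ∫ x, φ x * besselPotential ψ x :=
  integral_fourierMultiplierCLM_mul hasTemperateGrowth_besselSymbol
    (fun ξ => by rw [besselSymbol_eq, besselSymbol_eq, norm_neg]) φ ψ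

open scoped FourierTransform in
lemma fourier_besselPotential (φ : 𝓢(Rn n, ℂ)) (ξ : Rn n) :
    𝓕 (besselPotential φ) ξ = ((1 + (2 * Real.pi * ‖ξ‖) ^ 2)⁻¹ : ℝ) * 𝓕 φ ξ := by
  rw [besselPotential, fourier_fourierMultiplierCLM_apply hasTemperateGrowth_besselSymbol,
    besselSymbol_eq]

open scoped FourierTransform in
lemma norm_fourier_besselPotential (φ : 𝓢(Rn n, ℂ)) (ξ : Rn n) :
    ‖𝓕 (besselPotential φ) ξ‖ = (1 + (2 * Real.pi * ‖ξ‖) ^ 2)⁻¹ * ‖𝓕 φ ξ‖ := by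
  rw [fourier_besselPotential, norm_mul, Complex.norm_real, Real.norm_of_nonneg (by positivity)]

lemma besselPotential_sub_laplacian (φ : 𝓢(Rn n, ℂ)) : besselPotential φ - Δ (besselPotential φ) = φ := by
  refine ext_of_fourier fun ξ => ?_
  rw [fourier_sub', sub_apply, fourier_laplacian_apply, fourier_besselPotential]
  generalize 2 * Real.pi * ‖ξ‖ = a
  have h : ((1 + a ^ 2 : ℝ) : ℂ) ≠ 0 := by
    rw [Complex.ofReal_ne_zero]; positivity
  push_cast at h ⊢
  field_simp
  ring

lemma norm_toLp_besselPotential_le (φ : 𝓢(Rn n, ℂ)) :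
    ‖(besselPotential φ).toLp 2 volume‖ ≤ ‖φ.toLp 2 volume‖ := by
  have h := norm_toLp_two_le_of_norm_fourier_le (C := 1) (φ := besselPotential φ) (ψ := φ) fun ξ => by
    rw [norm_fourier_besselPotential]
    gcongr
    exact inv_le_one_of_one_le₀ (by linarith [sq_nonneg (2 * Real.pi * ‖ξ‖)])
  simpa using h

lemma norm_toLp_lineDeriv_besselPotential_le (i : Fin n) (φ : 𝓢(Rn n, ℂ)) :
    ‖(∂_{(EuclideanSpace.single i (1 : ℝ) : Rn n)} (besselPotential φ)).toLp 2 volume‖ ≤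
      ‖φ.toLp 2 volume‖ := by
  have h := norm_toLp_two_le_of_norm_fourier_le (C := 1)
    (φ := ∂_{(EuclideanSpace.single i (1 : ℝ) : Rn n)} (besselPotential φ)) (ψ := φ) fun ξ => by
    refine (norm_fourier_lineDeriv_single _ i ξ).trans ?_
    rw [norm_fourier_besselPotential, ← mul_assoc]
    gcongr
    rw [← div_eq_mul_inv, div_le_one (by positivity)]
    nlinarith [sq_nonneg (2 * Real.pi * ‖ξ‖ - 1), sq_nonneg (2 * Real.pi * ‖ξ‖)]
  simpa using h

lemma norm_toLp_besselPotential_lineDeriv_le (i : Fin n) (φ : 𝓢(Rn n, ℂ)) :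
    ‖(besselPotential (∂_{(EuclideanSpace.single i (1 : ℝ) : Rn n)} φ)).toLp 2 volume‖ ≤
      ‖φ.toLp 2 volume‖ := by
  have h := norm_toLp_two_le_of_norm_fourier_le (C := 1)
    (φ := besselPotential (∂_{(EuclideanSpace.single i (1 : ℝ) : Rn n)} φ)) (ψ := φ) fun ξ => by
    rw [norm_fourier_besselPotential]
    refine (mul_le_mul_of_nonneg_left (norm_fourier_lineDeriv_single _ i ξ) (by positivity)).trans ?_
    rw [← mul_assoc]
    gcongr
    rw [inv_mul_eq_div, div_le_one (by positivity)]
    nlinarith [sq_nonneg (2 * Real.pi * ‖ξ‖ - 1), sq_nonneg (2 * Real.pi * ‖ξ‖)]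
  simpa using h

lemma norm_toLp_lineDeriv_besselPotential_lineDeriv_le (i j : Fin n) (φ : 𝓢(Rn n, ℂ)) :
    ‖(∂_{(EuclideanSpace.single i (1 : ℝ) : Rn n)}
      (besselPotential (∂_{(EuclideanSpace.single j (1 : ℝ) : Rn n)} φ))).toLp 2 volume‖ ≤
      ‖φ.toLp 2 volume‖ := by
  have h := norm_toLp_two_le_of_norm_fourier_le (C := 1)
    (φ := ∂_{(EuclideanSpace.single i (1 : ℝ) : Rn n)}
      (besselPotential (∂_{(EuclideanSpace.single j (1 : ℝ) : Rn n)} φ))) (ψ := φ) fun ξ => by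
    refine (norm_fourier_lineDeriv_single _ i ξ).trans ?_
    rw [norm_fourier_besselPotential]
    refine (mul_le_mul_of_nonneg_left (mul_le_mul_of_nonneg_left
      (norm_fourier_lineDeriv_single _ j ξ) (by positivity)) (by positivity)).trans ?_
    rw [← mul_assoc, ← mul_assoc]
    gcongr
    rw [mul_right_comm, ← div_eq_mul_inv, div_le_one (by positivity)]
    nlinarith
  simpa using h

/-- Schwartz functions are dense in `H¹`. The function `f = (1 - Δ)⁻¹ (f - ∑ ∂ᵢ gᵢ)` is
approximated by replacing `f` and `gᵢ = ∂ᵢ f` on the right hand side by Schwartz functions. -/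
theorem exists_schwartz_norm_sub_le {f : L2 n} {g : Fin n → L2 n} (hfg : HasWeakGradient f g) {η : ℝ}
    (hη : 0 < η) : ∃ φ : 𝓢(Rn n, ℂ), ‖f - φ.toLp 2 volume‖ ≤ η ∧
      ∀ i, ‖g i - (∂_{(EuclideanSpace.single i (1 : ℝ) : Rn n)} φ).toLp 2 volume‖ ≤ η := by
  set η' := η / (1 + n) with hη'
  have hη'0 : 0 < η' := by positivity
  have hdense : ∀ h : L2 n, ∃ H : 𝓢(Rn n, ℂ), ‖h - H.toLp 2 volume‖ ≤ η' := fun h => by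
    obtain ⟨_, hH, H, rfl⟩ := Metric.dense_iff.1 denseRange_toLp_two h η' hη'0
    exact ⟨H, by rw [← dist_eq_norm, dist_comm]; exact (Metric.mem_ball.1 hH).le⟩
  obtain ⟨F, hF⟩ := hdense f
  choose G hG using fun i => hdense (g i)
  set φ := besselPotential (F - ∑ i, ∂_{(EuclideanSpace.single i (1 : ℝ) : Rn n)} (G i)) with hφ
  have hid : ∀ χ : 𝓢(Rn n, ℂ), ∫ x, (f - φ.toLp 2 volume : L2 n) x * χ x =
      (∫ x, (f - F.toLp 2 volume : L2 n) x * besselPotential χ x) +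
        ∑ i, ∫ x, (g i - (G i).toLp 2 volume : L2 n) x *
          (∂_{(EuclideanSpace.single i (1 : ℝ) : Rn n)} (besselPotential χ)) x := fun χ => by
    have h1 : ∫ x, f x * χ x = (∫ x, f x * besselPotential χ x) +
        ∑ i, ∫ x, g i x * (∂_{(EuclideanSpace.single i (1 : ℝ) : Rn n)} (besselPotential χ)) x := by
      conv_lhs => rw [← besselPotential_sub_laplacian χ]
      rw [integral_mul_schwartz_sub, integral_mul_laplacian hfg, sub_neg_eq_add]
    have h2 : ∫ x, (φ.toLp 2 volume) x * χ x = (∫ x, (F.toLp 2 volume) x * besselPotential χ x) +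
        ∑ i, ∫ x, ((G i).toLp 2 volume) x *
          (∂_{(EuclideanSpace.single i (1 : ℝ) : Rn n)} (besselPotential χ)) x := by
      have h3 : ∀ i, ∫ x, ((G i).toLp 2 volume) x *
          (∂_{(EuclideanSpace.single i (1 : ℝ) : Rn n)} (besselPotential χ)) x = -l2Pair
            ((∂_{(EuclideanSpace.single i (1 : ℝ) : Rn n)} (G i)).toLp 2 volume)
              ((besselPotential χ).toLp 2 volume) := fun i => by
        rw [l2Pair_toLp, hasWeakGradient_toLp (G i) i, neg_neg]
      have h4 : (F - ∑ i, ∂_{(EuclideanSpace.single i (1 : ℝ) : Rn n)} (G i)).toLp 2 volume =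
          F.toLp 2 volume - ∑ i, (∂_{(EuclideanSpace.single i (1 : ℝ) : Rn n)} (G i)).toLp 2 volume := by
        simp only [← toLpCLM_apply (𝕜 := ℂ), map_sub, map_sum]
      rw [integral_toLp_mul, hφ, integral_besselPotential_mul, ← integral_toLp_mul, h4, ← l2Pair_toLp,
        ← l2Pair_toLp, map_sub, map_sum, sub_apply, _root_.sum_apply, sub_eq_add_neg,
        ← Finset.sum_neg_distrib]
      exact congrArg _ (Finset.sum_congr rfl fun i _ => (h3 i).symm)
    rw [integral_sub_mul_schwartz, h1, h2, integral_sub_mul_schwartz]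
    simp only [integral_sub_mul_schwartz, Finset.sum_sub_distrib]
    ring
  have hle : ∀ (χ : 𝓢(Rn n, ℂ)) (X : ℝ), ‖(besselPotential χ).toLp 2 volume‖ ≤ X →
      (∀ i, ‖(∂_{(EuclideanSpace.single i (1 : ℝ) : Rn n)} (besselPotential χ)).toLp 2 volume‖ ≤ X) →
      ‖∫ x, (f - φ.toLp 2 volume : L2 n) x * χ x‖ ≤ η * X := fun χ X h1 h2 => by
    have hX : 0 ≤ X := (norm_nonneg _).trans h1
    rw [hid]
    refine (norm_add_le _ _).trans ((add_le_add (b := η' * X) ?_ ((norm_sum_le _ _).trans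
      (Finset.sum_le_card_nsmul _ _ (η' * X) fun i _ => ?_))).trans_eq ?_)
    · exact (norm_integral_mul_schwartz_le _ _).trans (mul_le_mul hF h1 (norm_nonneg _) hη'0.le)
    · exact (norm_integral_mul_schwartz_le _ _).trans (mul_le_mul (hG i) (h2 i) (norm_nonneg _) hη'0.le)
    · rw [Finset.card_univ, Fintype.card_fin, nsmul_eq_mul, hη']
      field_simp
  refine ⟨φ, norm_le_of_forall_schwartz hη.le fun χ => hle χ _ (norm_toLp_besselPotential_le χ)
    fun i => norm_toLp_lineDeriv_besselPotential_le i χ, fun j => norm_le_of_forall_schwartz hη.le fun χ => ?_⟩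
  rw [integral_sub_mul_schwartz, hfg, hasWeakGradient_toLp φ j, ← neg_sub', norm_neg,
    ← integral_sub_mul_schwartz]
  exact hle _ _ (norm_toLp_besselPotential_lineDeriv_le j χ)
    fun i => norm_toLp_lineDeriv_besselPotential_lineDeriv_le i j χ

end Density

end

section

/-! ### Linearizable evolutions do not focus -/

open SchwartzMap

section Focusing

variable {n : ℕ} {r σ ε : ℝ}

lemma lineDerivOp_schrodinger (e : Rn n) (a : ℝ) (φ : 𝓢(Rn n, ℂ)) :
    ∂_{e} (schrodinger a φ) = schrodinger a (∂_{e} φ) := by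
  have hp := hasTemperateGrowth_translationSymbol e
  have hpc : (fun ξ => Complex.I * (translationSymbol e ξ : ℂ)).HasTemperateGrowth := by fun_prop
  refine ext_of_fourier fun ξ => ?_
  rw [← fourierMultiplierCLM_I_mul_translationSymbol, ← fourierMultiplierCLM_I_mul_translationSymbol,
    schrodinger, fourier_fourierMultiplierCLM_apply hpc,
    fourier_phaseGroup hasTemperateGrowth_halfLaplacianSymbol,
    fourier_phaseGroup hasTemperateGrowth_halfLaplacianSymbol, fourier_fourierMultiplierCLM_apply hpc]
  ring

/-- The free evolution does not increase the `L²` norm; by duality, since the test functions are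
transported isometrically. -/
lemma norm_fn_free_le {V : ℝ → H1 n} (hV : IsForcedSchrodinger ε (fun s => H1.fn (V s)) 0) {s : ℝ}
    (hs : 0 ≤ s) : ‖H1.fn (V s)‖ ≤ ‖H1.fn (V 0)‖ := by
  refine norm_le_of_forall_schwartz (norm_nonneg _) fun φ => ?_
  rw [hV.eq_of_free le_rfl hs φ,
    ← norm_toLp_phaseGroup hasTemperateGrowth_halfLaplacianSymbol (ε ^ 2 * (s - 0)) φ]
  exact norm_integral_mul_schwartz_le _ _

/-- The free evolution does not increase the `L²` norm of the gradient, since derivatives commute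
with it. -/
lemma norm_grad_free_le {V : ℝ → H1 n} (hV : IsForcedSchrodinger ε (fun s => H1.fn (V s)) 0) {s : ℝ}
    (hs : 0 ≤ s) (i : Fin n) : ‖H1.grad (V s) i‖ ≤ ‖H1.grad (V 0) i‖ := by
  refine norm_le_of_forall_schwartz (norm_nonneg _) fun φ => ?_
  rw [H1.hasWeakGradient (V s) i φ, hV.eq_of_free le_rfl hs, ← lineDerivOp_schrodinger,
    ← H1.hasWeakGradient (V 0) i,
    ← norm_toLp_phaseGroup hasTemperateGrowth_halfLaplacianSymbol (ε ^ 2 * (s - 0)) φ]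
  exact norm_integral_mul_schwartz_le _ _

lemma HasWeakGradient.sub {f f' : L2 n} {g g' : Fin n → L2 n} (h : HasWeakGradient f g)
    (h' : HasWeakGradient f' g') : HasWeakGradient (f - f') (fun i => g i - g' i) := fun i χ => by
  rw [integral_sub_mul_schwartz, integral_sub_mul_schwartz, h, h']
  ring

lemma scLpNorm_congr_norm {f g : Rn n → ℂ} (h : ∀ᵐ x, ‖f x‖ = ‖g x‖) :
    scLpNorm r ε f = scLpNorm r ε g := by
  unfold scLpNorm; rw [eLpNorm_congr_norm_ae h]

/-- Paired with the conjugate function, the nonlinearity yields the potential energy. -/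
lemma integral_powerNonlinearity_mul_conj (hσ : 0 < σ) (hε : 0 < ε) {g : Rn n → ℂ}
    (hg : AEStronglyMeasurable g volume) :
    ∫ x, powerNonlinearity σ ε g x * (starRingEnd ℂ) (g x) =
      ((scLpNorm (2 * σ + 2) ε g ^ (2 * σ + 2)).toReal : ℂ) := by
  have hp : (0 : ℝ) < 2 * σ + 2 := by positivity
  have h1 : ∀ x, powerNonlinearity σ ε g x * (starRingEnd ℂ) (g x) =
      ((ε ^ ((n : ℝ) * σ) * ‖g x‖ ^ (2 * σ + 2) : ℝ) : ℂ) := fun x => by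
    rw [powerNonlinearity, mul_assoc, Complex.mul_conj, Complex.normSq_eq_norm_sq,
      Real.rpow_add_of_nonneg (norm_nonneg _) (by positivity) (by norm_num), Real.rpow_two]
    push_cast; ring
  simp_rw [h1]
  rw [integral_complex_ofReal, integral_eq_lintegral_of_nonneg_ae
    (Eventually.of_forall fun x => by positivity)
    ((hg.norm.aemeasurable.pow_const _).const_mul _).aestronglyMeasurable]
  congr 2
  rw [scLpNorm, ENNReal.mul_rpow_of_nonneg _ _ hp.le,
    ENNReal.ofReal_rpow_of_nonneg (by positivity) hp.le, ← Real.rpow_mul hε.le, decayRate_mul hσ,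
    eLpNorm_eq_lintegral_rpow_enorm_toReal (by simpa using hp) ENNReal.ofReal_ne_top,
    ENNReal.toReal_ofReal hp.le, ← ENNReal.rpow_mul, one_div, inv_mul_cancel₀ hp.ne', ENNReal.rpow_one,
    ← lintegral_const_mul'' _ (hg.enorm.pow_const _)]
  refine lintegral_congr fun x => ?_
  rw [ENNReal.ofReal_mul (by positivity), ← ENNReal.ofReal_rpow_of_nonneg (norm_nonneg _) hp.le,
    ofReal_norm]

/-- If `f` is close to `g` and the test function `χ` is close to `conj g`, then the pairing of the
nonlinearity of `f` with `χ` is close to the potential energy of `g`. -/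
lemma norm_integral_powerNonlinearity_mul_sub_le (hσ : 0 < σ) (hε : 0 < ε) {f g χ : Rn n → ℂ}
    (hf : AEStronglyMeasurable f volume) (hg : AEStronglyMeasurable g volume)
    (hχ : AEStronglyMeasurable χ volume) {a e d : ℝ} (ha : 0 ≤ a) (he : 0 ≤ e) (hd : 0 ≤ d)
    (hfa : scLpNorm (2 * σ + 2) ε f ≤ ENNReal.ofReal a)
    (hga : scLpNorm (2 * σ + 2) ε g ≤ ENNReal.ofReal a)
    (hfg : scLpNorm (2 * σ + 2) ε (f - g) ≤ ENNReal.ofReal e)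
    (hχg : scLpNorm (2 * σ + 2) ε (χ - fun x => (starRingEnd ℂ) (g x)) ≤ ENNReal.ofReal d) :
    ‖(∫ x, powerNonlinearity σ ε f x * χ x) -
        ((scLpNorm (2 * σ + 2) ε g ^ (2 * σ + 2)).toReal : ℂ)‖ ≤
      (2 * σ + 1) * ((2 * a) ^ (2 * σ) * e) * (a + d) + a ^ (2 * σ) * a * d := by
  have hr : (2 : ℝ) < 2 * σ + 2 := by linarith
  have hgc : AEStronglyMeasurable (fun x => (starRingEnd ℂ) (g x)) volume :=
    Complex.continuous_conj.comp_aestronglyMeasurable hg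
  have hgcn : scLpNorm (2 * σ + 2) ε (fun x => (starRingEnd ℂ) (g x)) = scLpNorm (2 * σ + 2) ε g :=
    scLpNorm_congr_norm (Eventually.of_forall fun x => RCLike.norm_conj _)
  have hχn : scLpNorm (2 * σ + 2) ε χ ≤ ENNReal.ofReal (a + d) := by
    have h := scLpNorm_add_le (ε := ε) hr (hχ.sub hgc) hgc
    rw [sub_add_cancel, hgcn] at h
    rw [add_comm a d, ENNReal.ofReal_add hd ha]
    exact h.trans (add_le_add hχg hga)
  have hft := ne_top_of_le_ne_top ENNReal.ofReal_ne_top hfa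
  have hgt := ne_top_of_le_ne_top ENNReal.ofReal_ne_top hga
  have hχt := ne_top_of_le_ne_top ENNReal.ofReal_ne_top hχn
  have i1 := integrable_powerNonlinearity_mul hσ hε hf hft hχ hχt
  have i2 := integrable_powerNonlinearity_mul hσ hε hg hgt hχ hχt
  have i3 := integrable_powerNonlinearity_mul hσ hε hg hgt hgc (by rwa [hgcn])
  have e1 : (∫ x, powerNonlinearity σ ε f x * χ x) -
      ((scLpNorm (2 * σ + 2) ε g ^ (2 * σ + 2)).toReal : ℂ) =
      (∫ x, χ x * (powerNonlinearity σ ε f - powerNonlinearity σ ε g : Rn n → ℂ) x) +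
        ∫ x, (χ - fun x => (starRingEnd ℂ) (g x) : Rn n → ℂ) x * powerNonlinearity σ ε g x := by
    have h2 : ∫ x, χ x * (powerNonlinearity σ ε f - powerNonlinearity σ ε g : Rn n → ℂ) x =
        (∫ x, powerNonlinearity σ ε f x * χ x) - ∫ x, powerNonlinearity σ ε g x * χ x := by
      rw [← integral_sub i1 i2]
      refine integral_congr_ae (Eventually.of_forall fun x => ?_)
      simp only [Pi.sub_apply]; ring
    have h3 : ∫ x, (χ - fun x => (starRingEnd ℂ) (g x) : Rn n → ℂ) x * powerNonlinearity σ ε g x =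
        (∫ x, powerNonlinearity σ ε g x * χ x) -
          ∫ x, powerNonlinearity σ ε g x * (starRingEnd ℂ) (g x) := by
      rw [← integral_sub i2 i3]
      refine integral_congr_ae (Eventually.of_forall fun x => ?_)
      simp only [Pi.sub_apply]; ring
    rw [h2, h3, integral_powerNonlinearity_mul_conj hσ hε hg]
    ring
  rw [e1]
  have hFf := aestronglyMeasurable_powerNonlinearity (σ := σ) (ε := ε) hf
  have hFg := aestronglyMeasurable_powerNonlinearity (σ := σ) (ε := ε) hg
  refine (norm_add_le _ _).trans (add_le_add ?_ ?_)
  · rw [← ENNReal.ofReal_le_ofReal_iff (by positivity), ofReal_norm]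
    refine (enorm_integral_mul_le_scNorm hr hε hχ (hFf.sub hFg)).trans ?_
    rw [mul_comm, ENNReal.ofReal_mul (by positivity)]
    refine mul_le_mul' ((scDualNorm_powerNonlinearity_sub_le hσ hε hf hg).trans ?_) hχn
    rw [ENNReal.ofReal_mul (by positivity), ENNReal.ofReal_mul (by positivity),
      ← ENNReal.ofReal_rpow_of_nonneg (by positivity) (by positivity)]
    refine mul_le_mul_right (mul_le_mul' (ENNReal.rpow_le_rpow ?_ (by positivity)) hfg) _
    rw [two_mul a, ENNReal.ofReal_add ha ha]
    exact add_le_add hfa hga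
  · rw [← ENNReal.ofReal_le_ofReal_iff (by positivity), ofReal_norm]
    refine (enorm_integral_mul_le_scNorm hr hε (hχ.sub hgc) hFg).trans ?_
    rw [mul_comm, ENNReal.ofReal_mul (by positivity)]
    refine mul_le_mul' ((scDualNorm_powerNonlinearity_le hσ hε hg).trans ?_) hχg
    rw [ENNReal.ofReal_mul (by positivity),
      ← ENNReal.ofReal_rpow_of_nonneg (by positivity) (by positivity)]
    exact mul_le_mul' (ENNReal.rpow_le_rpow hga (by positivity)) hga

end Focusing

end

section

open SchwartzMap

section Focusing

variable {n : ℕ} {r σ ε : ℝ}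

/-- A test function whose free evolution stays close to the complex conjugate of a given `H¹`
function for a short time. -/
lemma exists_schwartz_scLpNorm_sub_conj_le (hn : 1 ≤ n) (hr : 2 < r) (hδ : decayRate n r < 1) :
    ∃ C : ℝ, 0 ≤ C ∧ ∀ ε : ℝ, 0 < ε → ∀ (f : L2 n) (g : Fin n → L2 n), HasWeakGradient f g →
      ∀ M, 0 < M → ‖f‖ ≤ M → (∀ i, ε * ‖g i‖ ≤ M) → ∀ τ : ℝ, 0 < τ → τ ≤ 1 →
      ∃ φ : 𝓢(Rn n, ℂ), ‖φ.toLp 2 volume‖ ≤ 2 * M ∧ ∀ s, |s| ≤ τ →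
        scLpNorm r ε (⇑(schrodinger (ε ^ 2 * s) φ) - fun x => (starRingEnd ℂ) (f x)) ≤
          ENNReal.ofReal (C * M * τ ^ ((1 - decayRate n r) / 4)) := by
  obtain ⟨C, hC0, hC⟩ := exists_scLpNorm_le hn hr hδ
  set γ := (1 - decayRate n r) / 4 with hγ
  have hγ0 : 0 < γ := by rw [hγ]; linarith
  refine ⟨3 * C, by positivity, fun ε hε f g hfg M hM hf hg τ hτ hτ1 => ?_⟩
  have hτγ : τ ^ γ ≤ 1 := Real.rpow_le_one hτ.le hτ1 hγ0.le
  set η := M * τ ^ γ / (1 + ε) with hη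
  have hη0 : 0 < η := by positivity
  have hη1 : (1 + ε) * η = M * τ ^ γ := by rw [hη]; field_simp
  have hη2 : (1 + ε) * η ≤ M := by
    rw [hη1]; exact mul_le_of_le_one_right hM.le hτγ
  have hεη : 0 < ε * η := by positivity
  obtain ⟨ψ, hψ, hψ'⟩ := exists_schwartz_norm_sub_le hfg hη0
  have hψM : ‖ψ.toLp 2 volume‖ ≤ 2 * M := by
    have h := norm_sub_norm_le (ψ.toLp 2 volume) f
    rw [norm_sub_rev] at h
    linarith
  have hψM' : ∀ i, ε * ‖(∂_{(EuclideanSpace.single i (1 : ℝ) : Rn n)} ψ).toLp 2 volume‖ ≤ 2 * M := by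
    intro i
    have h := norm_sub_norm_le ((∂_{(EuclideanSpace.single i (1 : ℝ) : Rn n)} ψ).toLp 2 volume) (g i)
    rw [norm_sub_rev] at h
    have h2 := mul_le_mul_of_nonneg_left (h.trans (hψ' i)) hε.le
    rw [mul_sub] at h2
    linarith [hg i]
  refine ⟨ψ.conj, by rwa [norm_toLp_conj], fun s hs => ?_⟩
  have h1 := (hC ε hε _ _ (hasWeakGradient_toLp ψ.conj) (2 * M) (by rwa [norm_toLp_conj])
    (fun i => by rw [lineDerivOp_conj, norm_toLp_conj]; exact hψM' i)).2 s
    ((schrodinger (ε ^ 2 * s) ψ.conj).toLp 2 volume) fun χ => by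
      rw [integral_toLp_mul, integral_toLp_mul, integral_schrodinger_mul]
  have h2 := (hC ε hε _ _ (hfg.sub (hasWeakGradient_toLp ψ)) (M * τ ^ γ)
    (by rw [← hη1]; linarith) (fun i => by
      rw [← hη1]
      have := mul_le_mul_of_nonneg_left (hψ' i) hε.le
      linarith)).1
  have h3 : scLpNorm r ε (⇑ψ.conj - fun x => (starRingEnd ℂ) (f x)) =
      scLpNorm r ε (f - ψ.toLp 2 volume : L2 n) := by
    refine scLpNorm_congr_norm ?_
    filter_upwards [Lp.coeFn_sub f (ψ.toLp 2 volume), ψ.coeFn_toLp 2 volume] with x hx hx2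
    rw [hx, Pi.sub_apply, Pi.sub_apply, hx2, conj_apply, ← map_sub, RCLike.norm_conj, norm_sub_rev]
  have h4 : scLpNorm r ε (⇑(schrodinger (ε ^ 2 * s) ψ.conj) - ⇑ψ.conj) =
      scLpNorm r ε ((schrodinger (ε ^ 2 * s) ψ.conj).toLp 2 volume - ψ.conj.toLp 2 volume : L2 n) := by
    refine scLpNorm_congr_ae ?_
    filter_upwards [Lp.coeFn_sub ((schrodinger (ε ^ 2 * s) ψ.conj).toLp 2 volume)
      (ψ.conj.toLp 2 volume), ψ.conj.coeFn_toLp 2 volume,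
      (schrodinger (ε ^ 2 * s) ψ.conj).coeFn_toLp 2 volume] with x hx hx2 hx3
    rw [hx, Pi.sub_apply, Pi.sub_apply, hx2, hx3]
  have h5 := scLpNorm_add_le (ε := ε) hr
    (f := ⇑(schrodinger (ε ^ 2 * s) ψ.conj) - ⇑ψ.conj)
    (g := ⇑ψ.conj - fun x => (starRingEnd ℂ) (f x))
    ((SchwartzMap.continuous _).aestronglyMeasurable.sub (SchwartzMap.continuous _).aestronglyMeasurable)
    ((SchwartzMap.continuous _).aestronglyMeasurable.sub
      (Complex.continuous_conj.comp_aestronglyMeasurable (Lp.aestronglyMeasurable f)))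
  rw [sub_add_sub_cancel, h3, h4] at h5
  refine h5.trans ((add_le_add h1 h2).trans ?_)
  rw [← ENNReal.ofReal_add (by positivity) (by positivity)]
  refine ENNReal.ofReal_le_ofReal ?_
  have h6 : |s| ^ γ ≤ τ ^ γ := Real.rpow_le_rpow (abs_nonneg s) hs hγ0.le
  have h7 : C * (2 * M) * |s| ^ γ ≤ C * (2 * M) * τ ^ γ := by gcongr
  linarith

/-- If the nonlinear evolution stays close to the free one on `[0, S]`, then the potential energy of
the free evolution is small: over a time window of length `τ` around `t`, this energy is almost
constant, and it is almost the rate of change of the pairing of the difference of both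
evolutions with the complex conjugate of the free one. -/
theorem exists_scLpNorm_rpow_le (hn : 1 ≤ n) (hσ : 0 < σ) (hδ : decayRate n (2 * σ + 2) < 1) {M : ℝ}
    (hM : 0 < M) :
    ∃ C γ : ℝ, 0 ≤ C ∧ 0 < γ ∧ ∀ ε : ℝ, 0 < ε → ∀ U V : ℝ → H1 n,
      IsForcedSchrodinger ε (fun s => H1.fn (U s)) (fun s => powerNonlinearity σ ε (H1.fn (U s))) →
      IsForcedSchrodinger ε (fun s => H1.fn (V s)) 0 → H1.scNorm ε (V 0) ≤ M →
      ∀ S κ : ℝ, κ ≤ M → (∀ s ∈ Icc 0 S, H1.scNorm ε (U s - V s) ≤ κ) →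
      ∀ τ, 0 < τ → τ ≤ 1 → τ ≤ S → ∀ t ∈ Icc 0 S,
        scLpNorm (2 * σ + 2) ε (H1.fn (V t)) ^ (2 * σ + 2) ≤ ENNReal.ofReal (C * (τ ^ γ + κ / τ)) := by
  have hr : (2 : ℝ) < 2 * σ + 2 := by linarith
  obtain ⟨C₁, hC₁, hsob⟩ := exists_scLpNorm_le hn hr hδ
  obtain ⟨C₂, hC₂, hsch⟩ := exists_schwartz_scLpNorm_sub_conj_le hn hr hδ
  have hδ0 := decayRate_pos hn hr
  set γ := (1 - decayRate n (2 * σ + 2)) / 4 with hγ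
  have hγ0 : 0 < γ := by rw [hγ]; linarith
  set a := 2 * C₁ * M with ha
  have ha0 : 0 ≤ a := by positivity
  set K₁ := (2 * σ + 1) * (2 * a) ^ (2 * σ) * (a + C₂ * M) with hK₁
  have hK₁0 : 0 ≤ K₁ := by positivity
  set K₂ := a ^ (2 * σ) * a * (C₂ * M) with hK₂
  have hK₂0 : 0 ≤ K₂ := by positivity
  refine ⟨K₁ * (C₁ * M + C₁) + K₂ + 4 * M, γ, by positivity, hγ0, ?_⟩
  intro ε hε U V hU hV hV0 S κ hκM hUV τ hτ hτ1 hτS t ht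
  have hS : 0 ≤ S := ht.1.trans ht.2
  have hκ : 0 ≤ κ := by
    refine le_trans ?_ (hUV t ht)
    unfold H1.scNorm; positivity
  have hτγ : τ ^ γ ≤ 1 := Real.rpow_le_one hτ.le hτ1 hγ0.le
  -- bounds for the free evolution
  have hVfn : ∀ s, 0 ≤ s → ‖H1.fn (V s)‖ ≤ M := fun s hs =>
    (norm_fn_free_le hV hs).trans ((norm_fn_le_scNorm _).trans hV0)
  have hVgrad : ∀ s, 0 ≤ s → ∀ i, ε * ‖H1.grad (V s) i‖ ≤ M := fun s hs i =>
    (mul_le_mul_of_nonneg_left (norm_grad_free_le hV hs i) hε.le).trans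
      ((norm_grad_le_scNorm hε _ i).trans hV0)
  have hVN : ∀ s, 0 ≤ s → scLpNorm (2 * σ + 2) ε (H1.fn (V s)) ≤ ENNReal.ofReal (C₁ * M) :=
    fun s hs => (hsob ε hε _ _ (H1.hasWeakGradient (V s)) M (hVfn s hs) (hVgrad s hs)).1
  have hwN : ∀ s ∈ Icc 0 S, scLpNorm (2 * σ + 2) ε (H1.fn (U s) - H1.fn (V s) : L2 n) ≤
      ENNReal.ofReal (C₁ * κ) := fun s hs =>
    (hsob ε hε _ _ (H1.hasWeakGradient (U s - V s)) κ ((norm_fn_le_scNorm _).trans (hUV s hs))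
      fun i => (norm_grad_le_scNorm hε _ i).trans (hUV s hs)).1
  have hUN : ∀ s ∈ Icc 0 S, scLpNorm (2 * σ + 2) ε (H1.fn (U s)) ≤ ENNReal.ofReal a := fun s hs => by
    have h := scLpNorm_coe_add_le (ε := ε) hr (H1.fn (U s) - H1.fn (V s)) (H1.fn (V s))
    rw [sub_add_cancel] at h
    refine h.trans ((add_le_add (hwN s hs) (hVN s hs.1)).trans ?_)
    rw [← ENNReal.ofReal_add (by positivity) (by positivity)]
    refine ENNReal.ofReal_le_ofReal ?_
    have := mul_le_mul_of_nonneg_left hκM hC₁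
    linarith
  have hVta : scLpNorm (2 * σ + 2) ε (H1.fn (V t)) ≤ ENNReal.ofReal a :=
    (hVN t ht.1).trans (ENNReal.ofReal_le_ofReal (by nlinarith [mul_nonneg hC₁ hM.le]))
  have hUVt : ∀ s ∈ Icc 0 S, |s - t| ≤ τ → scLpNorm (2 * σ + 2) ε
      (⇑(H1.fn (U s)) - ⇑(H1.fn (V t))) ≤ ENNReal.ofReal (C₁ * κ + C₁ * M * τ ^ γ) := fun s hs hst => by
    have h1 := (hsob ε hε _ _ (H1.hasWeakGradient (V t)) M (hVfn t ht.1) (hVgrad t ht.1)).2 (s - t)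
      (H1.fn (V s)) fun φ => hV.eq_of_free ht.1 hs.1 φ
    have h2 := scLpNorm_coe_add_le (ε := ε) hr (H1.fn (U s) - H1.fn (V s)) (H1.fn (V s) - H1.fn (V t))
    rw [sub_add_sub_cancel, scLpNorm_congr_ae (Lp.coeFn_sub (H1.fn (U s)) (H1.fn (V t)))] at h2
    refine h2.trans ((add_le_add (hwN s hs) h1).trans ?_)
    rw [← ENNReal.ofReal_add (by positivity) (by positivity)]
    refine ENNReal.ofReal_le_ofReal ?_
    have := Real.rpow_le_rpow (abs_nonneg _) hst hγ0.le
    gcongr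
  obtain ⟨φ, hφ, hφN⟩ := hsch ε hε _ _ (H1.hasWeakGradient (V t)) M hM (hVfn t ht.1) (hVgrad t ht.1)
    τ hτ hτ1
  -- the time window
  set b := max (t - τ) 0 with hb
  have hb0 : 0 ≤ b := le_max_right _ _
  have hbt : b ≤ t := max_le (by linarith) ht.1
  have hbS : b + τ ≤ S := by
    rcases le_total (t - τ) 0 with h | h
    · rw [hb, max_eq_right h]; linarith
    · rw [hb, max_eq_left h]; linarith [ht.2]
  have htb : t ≤ b + τ := by linarith [le_max_left (t - τ) 0]
  set P := (scLpNorm (2 * σ + 2) ε (H1.fn (V t)) ^ (2 * σ + 2)).toReal with hP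
  set E := (2 * σ + 1) * ((2 * a) ^ (2 * σ) * (C₁ * κ + C₁ * M * τ ^ γ)) * (a + C₂ * M * τ ^ γ) +
    a ^ (2 * σ) * a * (C₂ * M * τ ^ γ) with hE
  -- the pairing of the difference with the transported test function; both linear parts cancel, so
  -- its derivative is the pairing of `-i` times the nonlinearity, which is close to `-i P`
  set G : ℝ → ℂ := fun s => (∫ x, H1.fn (U s) x * schrodinger (ε ^ 2 * (t - s)) φ x) -
    (∫ x, H1.fn (V s) x * schrodinger (ε ^ 2 * (t - s)) φ x) with hG
  have hGle : ∀ s ∈ Icc 0 S, ‖G s‖ ≤ κ * (2 * M) := fun s hs => by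
    simp only [hG]
    rw [← integral_sub_mul_schwartz]
    refine (norm_integral_mul_schwartz_le _ _).trans ?_
    rw [schrodinger, norm_toLp_phaseGroup hasTemperateGrowth_halfLaplacianSymbol]
    exact mul_le_mul ((norm_fn_le_scNorm (U s - V s)).trans (hUV s hs)) hφ (norm_nonneg _) hκ
  have hder : ∀ s ∈ Icc b (b + τ), HasDerivWithinAt (fun s => G s + Complex.I * P * s)
      (-Complex.I * ((∫ x, powerNonlinearity σ ε (H1.fn (U s)) x *
        schrodinger (ε ^ 2 * (t - s)) φ x) - P)) (Icc b (b + τ)) s := fun s hs => by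
    have hs0 : 0 ≤ s := hb0.trans hs.1
    have h1 := ((hU.hasDerivWithinAt_schrodinger t φ hs0).sub
      (hV.hasDerivWithinAt_schrodinger t φ hs0)).add
      ((Complex.ofRealCLM.hasDerivAt (x := s)).const_mul (Complex.I * P)).hasDerivWithinAt
    refine (h1.mono fun x hx => hb0.trans hx.1).congr_deriv ?_
    simp
    ring
  have hbound : ∀ s ∈ Icc b (b + τ), ‖-Complex.I * ((∫ x, powerNonlinearity σ ε (H1.fn (U s)) x *
        schrodinger (ε ^ 2 * (t - s)) φ x) - P)‖ ≤ E := fun s hs => by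
    have hsS : s ∈ Icc 0 S := ⟨hb0.trans hs.1, hs.2.trans hbS⟩
    have hst : |s - t| ≤ τ := abs_le.2 ⟨by linarith [hs.1, le_max_left (t - τ) 0], by linarith [hs.2]⟩
    rw [norm_mul, norm_neg, Complex.norm_I, one_mul]
    exact norm_integral_powerNonlinearity_mul_sub_le hσ hε (Lp.aestronglyMeasurable _)
      (Lp.aestronglyMeasurable _) (SchwartzMap.continuous _).aestronglyMeasurable ha0 (by positivity)
      (by positivity) (hUN s hsS) hVta (hUVt s hsS hst) (hφN (t - s) (by rwa [abs_sub_comm]))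
  have hmv := Convex.norm_image_sub_le_of_norm_hasDerivWithin_le hder hbound (convex_Icc _ _)
    (left_mem_Icc.2 (by linarith : b ≤ b + τ)) (right_mem_Icc.2 (by linarith))
  have hP0 : 0 ≤ P := ENNReal.toReal_nonneg
  have hPτ : P * τ ≤ E * τ + κ * (4 * M) := by
    have h1 := hGle b ⟨hb0, hbt.trans ht.2⟩
    have h2 := hGle (b + τ) ⟨by linarith, hbS⟩
    have h3 : Complex.I * P * τ = (G (b + τ) + Complex.I * P * ((b + τ : ℝ) : ℂ) -
        (G b + Complex.I * P * b)) - G (b + τ) + G b := by push_cast; ring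
    have h4 : ‖Complex.I * P * τ‖ = P * τ := by
      rw [norm_mul, norm_mul, Complex.norm_I, Complex.norm_real, Complex.norm_real,
        Real.norm_of_nonneg hP0, Real.norm_of_nonneg hτ.le, one_mul]
    rw [add_sub_cancel_left, Real.norm_of_nonneg hτ.le] at hmv
    have h5 := norm_add_le ((G (b + τ) + Complex.I * P * ((b + τ : ℝ) : ℂ) -
        (G b + Complex.I * P * b)) - G (b + τ)) (G b)
    have h6 := norm_sub_le (G (b + τ) + Complex.I * P * ((b + τ : ℝ) : ℂ) -
        (G b + Complex.I * P * b)) (G (b + τ))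
    rw [← h3, h4] at h5
    linarith
  have hκτ : κ ≤ κ / τ := le_div_self hκ hτ hτ1
  have hEle : E ≤ K₁ * (C₁ * κ + C₁ * M * τ ^ γ) + K₂ * τ ^ γ := by
    have h1 : a + C₂ * M * τ ^ γ ≤ a + C₂ * M :=
      add_le_add le_rfl (mul_le_of_le_one_right (by positivity) hτγ)
    have h2 : (2 * σ + 1) * ((2 * a) ^ (2 * σ) * (C₁ * κ + C₁ * M * τ ^ γ)) * (a + C₂ * M * τ ^ γ) ≤
        (2 * σ + 1) * ((2 * a) ^ (2 * σ) * (C₁ * κ + C₁ * M * τ ^ γ)) * (a + C₂ * M) :=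
      mul_le_mul_of_nonneg_left h1 (by positivity)
    rw [hE, hK₁, hK₂]
    linarith
  have hPle : P ≤ E + 4 * M * (κ / τ) := by
    rw [← mul_div_assoc, ← sub_le_iff_le_add', le_div_iff₀ hτ]
    linarith
  have hfin : P ≤ (K₁ * (C₁ * M + C₁) + K₂ + 4 * M) * (τ ^ γ + κ / τ) := by
    have hτγ0 : 0 ≤ τ ^ γ := by positivity
    have hκτ0 : 0 ≤ κ / τ := by positivity
    have h1 : K₁ * (C₁ * κ) ≤ K₁ * (C₁ * (κ / τ)) := by gcongr
    have h2 : 0 ≤ K₁ * C₁ * τ ^ γ := by positivity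
    have h3 : 0 ≤ K₁ * (C₁ * M) * (κ / τ) := by positivity
    have h4 : 0 ≤ K₂ * (κ / τ) := by positivity
    have h5 : 0 ≤ 4 * M * τ ^ γ := by positivity
    linarith
  rw [← ENNReal.ofReal_toReal (ENNReal.rpow_ne_top_of_nonneg (by positivity)
    (ne_top_of_le_ne_top ENNReal.ofReal_ne_top hVta))]
  exact ENNReal.ofReal_le_ofReal hfin

/-- If the nonlinear evolution is asymptotic to the free one, then the potential energy of the
free evolution tends to zero uniformly in time. -/
theorem limsup_iSup_scPotential_eq_zero (hn : 1 ≤ n) (hσ : 0 < σ)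
    (hδ : decayRate n (2 * σ + 2) < 1) {u₀ : ℝ → H1 n} {u v : ℝ → ℝ → H1 n}
    (hbdd : ∃ C : ℝ, ∀ ε ∈ Ioc (0 : ℝ) 1, H1.scNorm ε (u₀ ε) ≤ C)
    (hu : ∀ ε ∈ Ioc (0 : ℝ) 1, IsNLSSolution σ ε (u₀ ε) (u ε))
    (hv : ∀ ε ∈ Ioc (0 : ℝ) 1, IsFreeSolution ε (u₀ ε) (v ε)) {T : ℝ} (hT : 0 < T)
    (h : Tendsto (fun ε : ℝ => ⨆ t ∈ Icc (0 : ℝ) T, ENNReal.ofReal (H1.scNorm ε (u ε t - v ε t)))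
      (𝓝[>] 0) (𝓝 0)) :
    limsup (fun ε : ℝ => ⨆ t ∈ Icc (0 : ℝ) T, H1.scPotential σ ε (v ε t)) (𝓝[>] 0) = 0 := by
  obtain ⟨M₀, hM₀⟩ := hbdd
  set M := max M₀ 1 with hM
  have hM0 : 0 < M := lt_max_of_lt_right one_pos
  obtain ⟨C, γ, hC, hγ, hmain⟩ := exists_scLpNorm_rpow_le hn hσ hδ hM0
  refine Tendsto.limsup_eq (ENNReal.tendsto_nhds_zero.2 fun κ hκ => ?_)
  obtain ⟨κ', hκ'0, hκ'⟩ : ∃ κ' : ℝ, 0 < κ' ∧ ENNReal.ofReal κ' ≤ κ := by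
    obtain ⟨c, hc0, hc⟩ := ENNReal.lt_iff_exists_nnreal_btwn.1 hκ
    exact ⟨c, by exact_mod_cast hc0, by simpa using hc.le⟩
  -- the length `τ` of the time window is chosen first, then the size `ρ` of the error
  obtain ⟨τ, hτγ, ⟨hτ0, hττ⟩⟩ : ∃ τ : ℝ, C * τ ^ γ < κ' / 2 ∧ τ ∈ Ioc 0 (min 1 T) := by
    have hlim : Tendsto (fun τ : ℝ => C * τ ^ γ) (𝓝[>] 0) (𝓝 0) := by
      have h1 := (Real.continuousAt_rpow_const 0 γ (Or.inr hγ.le)).tendsto.const_mul C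
      rw [Real.zero_rpow hγ.ne', mul_zero] at h1
      exact h1.mono_left nhdsWithin_le_nhds
    exact ((hlim.eventually_lt_const (by positivity)).and
      (Ioc_mem_nhdsGT (lt_min one_pos hT))).exists
  set ρ := min M (κ' * τ / (2 * (C + 1))) with hρ
  have hρ0 : 0 < ρ := lt_min hM0 (by positivity)
  have hρle : C * (ρ / τ) ≤ κ' / 2 := by
    have h1 : ρ ≤ κ' * τ / (2 * (C + 1)) := min_le_right _ _
    calc C * (ρ / τ) ≤ (C + 1) * ((κ' * τ / (2 * (C + 1))) / τ) := by gcongr; linarith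
      _ = κ' / 2 := by field_simp
  filter_upwards [(ENNReal.tendsto_nhds_zero.1 h) (ENNReal.ofReal ρ) (ENNReal.ofReal_pos.2 hρ0),
    Ioc_mem_nhdsGT zero_lt_one] with ε hερ hε1
  have hε : 0 < ε := hε1.1
  refine le_trans (iSup₂_le fun t ht => ?_) hκ'
  have h1 := hmain ε hε _ _ ((hu ε hε1).isForcedSchrodinger hε) ((hv ε hε1).isForcedSchrodinger hε)
    (by rw [rescale_zero, (hv ε hε1).2.1]; exact (hM₀ ε hε1).trans (le_max_left _ _))
    (T / ε) ρ (min_le_left _ _) (fun s hs => by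
      rw [rescale_of_nonneg _ hs.1, rescale_of_nonneg _ hs.1]
      have hsT : ε * s ∈ Icc 0 T := ⟨mul_nonneg hε.le hs.1, by
        have := (le_div_iff₀ hε).1 hs.2
        linarith⟩
      exact (ENNReal.ofReal_le_ofReal_iff hρ0.le).1 ((le_iSup₂_of_le (ε * s) hsT le_rfl).trans hερ))
    τ hτ0 (hττ.trans (min_le_left _ _))
    ((hττ.trans (min_le_right _ _)).trans (le_div_self hT.le hε hε1.2)) (t / ε)
    ⟨div_nonneg ht.1 hε.le, by gcongr; exact ht.2⟩
  rw [rescale_of_nonneg _ (div_nonneg ht.1 hε.le), mul_div_cancel₀ _ hε.ne'] at h1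
  rw [scPotential_eq hσ hε]
  refine h1.trans (ENNReal.ofReal_le_ofReal ?_)
  linarith

end Focusing

theorem theorem1p1 (n : ℕ) (hn : 1 ≤ n) (σ : ℝ) (hσ : 2 / (n : ℝ) < σ)
    (hσ' : 3 ≤ n → σ < 2 / ((n : ℝ) - 2))
    (u₀ : ℝ → H1 n) (u v : ℝ → ℝ → H1 n)
    -- the data are bounded in the semiclassical Sobolev space
    (hbdd : ∃ C : ℝ, ∀ ε ∈ Ioc (0 : ℝ) 1, H1.scNorm ε (u₀ ε) ≤ C)
    -- there is no focusing at time 0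
    (hfocus : limsup (fun ε : ℝ => H1.scPotential σ ε (u₀ ε)) (𝓝[>] 0) = 0)
    (hu : ∀ ε ∈ Ioc (0 : ℝ) 1, IsNLSSolution σ ε (u₀ ε) (u ε))
    (hv : ∀ ε ∈ Ioc (0 : ℝ) 1, IsFreeSolution ε (u₀ ε) (v ε))
    (T : ℝ) (hT : 0 < T) :
    Tendsto (fun ε : ℝ => ⨆ t ∈ Icc (0 : ℝ) T, ENNReal.ofReal (H1.scNorm ε (u ε t - v ε t)))
        (𝓝[>] 0) (𝓝 0) ↔
      limsup (fun ε : ℝ => ⨆ t ∈ Icc (0 : ℝ) T, H1.scPotential σ ε (v ε t)) (𝓝[>] 0) = 0 := by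
  have hn0 : (0 : ℝ) < n := by exact_mod_cast hn
  have hσ0 : 0 < σ := lt_trans (by positivity) hσ
  have hδeq := decayRate_mul (n := n) hσ0
  have hnσ : 2 < n * σ := by
    rw [div_lt_iff₀ hn0] at hσ
    linarith
  have hδ : decayRate n (2 * σ + 2) < 1 := by
    have h : (n : ℝ) * σ < 2 * σ + 2 := by
      rcases Nat.lt_or_ge n 3 with h | h
      · have h2 : (n : ℝ) ≤ 2 := by exact_mod_cast Nat.lt_succ_iff.1 h
        nlinarith
      · have h2 : (3 : ℝ) ≤ n := by exact_mod_cast h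
        have h3 := (lt_div_iff₀ (by linarith)).1 (hσ' h)
        linarith
    by_contra! hc
    have := mul_le_mul_of_nonneg_right hc (by positivity : 0 ≤ 2 * σ + 2)
    linarith
  have hδσ : 1 < decayRate n (2 * σ + 2) * (σ + 1) := by linarith
  exact ⟨limsup_iSup_scPotential_eq_zero hn hσ0 hδ hbdd hu hv hT,
    tendsto_iSup_scNorm_of_limsup_eq_zero hn hσ0 hδ hδσ hbdd hu hv hT⟩

end
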